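/- Let $\Bbbk$ be a field. A coquasi-bialgebra over $\Bbbk$ is a coassociative counital coalgebra $(B,\Delta,\varepsilon)$ with coalgebra maps $m:B\otimes B\to B$, $u:\Bbbk\to B$ (write $ab=m(a\otimes b)$, $1_B=u(1)$) and a convolution invertible linear map $\omega:B\otimes B\otimes B\to\Bbbk$ such that $1_Bb=b=b1_B$, $\omega(a\otimes 1_B\otimes b)=\varepsilon(a)\varepsilon(b)$, and $$\omega(B\otimes B\otimes m)*\omega(m\otimes B\otimes B)=(\varepsilon\otimes\omega)*\omega(B\otimes m\otimes B)*(\omega\otimes\varepsilon),\qquad m(B\otimes m)*\omega=\omega*m(m\otimes B).$$ The category ${}^B\mathfrak M_f$ of finite-dimensional left $B$-comodules is monoidal with the diagonal coaction $v\otimes w\mapsto\sum v_{-1}w_{-1}\otimes v_0\otimes w_0$, the unit $\Bbbk$ with coaction $x\mapsto 1_B\otimes x$, the usual unit constraints of vector spaces, and the associativity constraint $(x\otimes y)\otimes z\mapsto\sum\omega^{-1}(x_{-1}\otimes y_{-1}\otimes z_{-1})\,x_0\otimes(y_0\otimes z_0)$. A right dual of $V$ is an object $V^\star$ with morphisms $\mathrm{ev}:V\otimes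 V^\star\to\Bbbk$ and $\mathrm{db}:\Bbbk\to V^\star\otimes V$ satisfying the two triangle identities; the category is right rigid if every object has a right dual. A preantipode for $B$ is a linear map $S:B\to B$ such that for all $h\in B$ $$\sum S(h_1)_1h_2\otimes S(h_1)_2=1_B\otimes S(h),\quad \sum S(h_2)_1\otimes h_1S(h_2)_2=S(h)\otimes 1_B,\quad \sum\omega(h_1\otimes S(h_2)\otimes h_3)=\varepsilon(h).$$ A coquasi-antipode for $B$ is a triple $(s,\alpha,\beta)$ of an anti-coalgebra endomorphism $s$ of $B$ and $\alpha,\beta\in B^*$ such that for all $h\in B$ $$\sum h_1\beta(h_2)s(h_3)=\beta(h)1_B,\qquad \sum s(h_1)\alpha(h_2)h_3=\alpha(h)1_B,$$ $$\sum\omega(h_1\otimes\beta(h_2)s(h_3)\alpha(h_4)\otimes h_5)=\varepsilon(h)=\sum\omega^{-1}(s(h_1)\otimes\alpha(h_2)h_3\beta(h_4)\otimes s(h_5)).$$ A coquasi-Hopf algebra is a coquasi-bialgebra that admits a coquasi-antipode. **Theorem.** Let $B$ be a coquasi-bialgebra over a field $\Bbbk$. 1. $B$ admits a preantipode if and only if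 ${}^B\mathfrak M_f$ is right rigid. 2. $B$ is a coquasi-Hopf algebra if and only if ${}^B\mathfrak M_f$ is right rigid and, in addition, the right duals can be given by endowing the linear duals with a suitable comodule structure; that is, one can choose for every $V$ in ${}^B\mathfrak M_f$ a coaction on $V^*=\mathrm{Hom}_{\Bbbk}(V,\Bbbk)$ and morphisms $\mathrm{ev}_V,\mathrm{db}_V$ making $V^*$ a right dual of $V$, in such a way that the dual of every morphism $f:V\to W$ is its transpose $f^*:W^*\to V^*$. -/

import Mathlib

open CategoryTheory MonoidalCategory TensorProduct Coalgebra

universe u v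

noncomputable section

namespace CoquasiHopf

/-! ### Convolution -/

section Convolution

variable {k C M : Type*} [Field k] [AddCommGroup C] [Module k C] [Coalgebra k C]
  [AddCommGroup M] [Module k M]

/-- The convolution `f * φ` of a functional `f : C → k` with a linear map `φ : C → M`:
`(f * φ)(x) = ∑ f(x₁) φ(x₂)`. -/
def leftConv (f : C →ₗ[k] k) (φ : C →ₗ[k] M) : C →ₗ[k] M :=
  (TensorProduct.lid k M).toLinearMap ∘ₗ TensorProduct.map f φ ∘ₗ comul

/-- The convolution `φ * f` of a linear map `φ : C → M` with a functional `f : C → k`: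
`(φ * f)(x) = ∑ φ(x₁) f(x₂)`. -/
def rightConv (φ : C →ₗ[k] M) (f : C →ₗ[k] k) : C →ₗ[k] M :=
  (TensorProduct.rid k M).toLinearMap ∘ₗ TensorProduct.map φ f ∘ₗ comul

end Convolution

/-! ### Coquasi-bialgebras, preantipodes and coquasi-antipodes -/

/-- A coquasi-bialgebra over a field `k`, normalised so that the unit constraints are trivial:
a coassociative counital coalgebra `B` with coalgebra maps `mul : B ⊗ B → B`, `unit : k → B`
and a convolution invertible reassociator `ω : B ⊗ B ⊗ B → k` (with inverse `ωInv`). -/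
class CoquasiBialgebra (k : Type u) (B : Type v) [Field k] [AddCommGroup B] [Module k B]
    extends Coalgebra k B where
  /-- the multiplication `m` -/
  mul : B ⊗[k] B →ₗc[k] B
  /-- the unit `u` -/
  unit : k →ₗc[k] B
  /-- the reassociator -/
  ω : B ⊗[k] (B ⊗[k] B) →ₗ[k] k
  /-- the convolution inverse of the reassociator -/
  ωInv : B ⊗[k] (B ⊗[k] B) →ₗ[k] k
  /-- `ω * ω⁻¹ = ε ⊗ ε ⊗ ε` -/
  ω_conv_ωInv : leftConv ω ωInv = CoalgebraStruct.counit
  /-- `ω⁻¹ * ω = ε ⊗ ε ⊗ ε` -/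
  ωInv_conv_ω : leftConv ωInv ω = CoalgebraStruct.counit
  /-- `1 b = b` -/
  unit_mul : ∀ b : B, mul (unit 1 ⊗ₜ b) = b
  /-- `b 1 = b` -/
  mul_unit : ∀ b : B, mul (b ⊗ₜ unit 1) = b
  /-- `ω (a ⊗ 1 ⊗ b) = ε(a) ε(b)` -/
  ω_unit : ∀ a b : B, ω (a ⊗ₜ (unit 1 ⊗ₜ b)) = CoalgebraStruct.counit (R := k) a * CoalgebraStruct.counit (R := k) b
  /-- `ω(B ⊗ B ⊗ m) * ω(m ⊗ B ⊗ B) = (ε ⊗ ω) * ω(B ⊗ m ⊗ B) * (ω ⊗ ε)` -/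
  cocycle :
    leftConv
      (ω ∘ₗ TensorProduct.map LinearMap.id (TensorProduct.map LinearMap.id mul.toLinearMap))
      (ω ∘ₗ TensorProduct.map mul.toLinearMap LinearMap.id ∘ₗ
        (TensorProduct.assoc k B B (B ⊗[k] B)).symm.toLinearMap) =
    leftConv
      (leftConv
        ((TensorProduct.lid k k).toLinearMap ∘ₗ TensorProduct.map CoalgebraStruct.counit ω)
        (ω ∘ₗ TensorProduct.map LinearMap.id
          (TensorProduct.map mul.toLinearMap LinearMap.id ∘ₗ
            (TensorProduct.assoc k B B B).symm.toLinearMap)))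
      ((TensorProduct.lid k k).toLinearMap ∘ₗ TensorProduct.map ω CoalgebraStruct.counit ∘ₗ
        (TensorProduct.assoc k B (B ⊗[k] B) B).symm.toLinearMap ∘ₗ
        TensorProduct.map LinearMap.id (TensorProduct.assoc k B B B).symm.toLinearMap)
  /-- `m(B ⊗ m) * ω = ω * m(m ⊗ B)` -/
  quasi_assoc :
    rightConv (mul.toLinearMap ∘ₗ TensorProduct.map LinearMap.id mul.toLinearMap) ω =
    leftConv ω (mul.toLinearMap ∘ₗ TensorProduct.map mul.toLinearMap LinearMap.id ∘ₗ
      (TensorProduct.assoc k B B B).symm.toLinearMap)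

open CoquasiBialgebra

section Antipodes

variable (k : Type u) (B : Type v) [Field k] [AddCommGroup B] [Module k B] [CoquasiBialgebra k B]

/-- A preantipode for the coquasi-bialgebra `B`. -/
structure Preantipode where
  /-- the underlying linear endomorphism -/
  S : B →ₗ[k] B
  /-- `∑ S(h₁)₁ h₂ ⊗ S(h₁)₂ = 1 ⊗ S(h)` -/
  left_eq : ∀ h : B,
    TensorProduct.map (mul (k := k) (B := B)).toLinearMap LinearMap.id
      (TensorProduct.rightComm k B B B
        (TensorProduct.map (comul (R := k) ∘ₗ S) LinearMap.id (comul (R := k) h))) =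
    unit (k := k) (B := B) 1 ⊗ₜ[k] S h
  /-- `∑ S(h₂)₁ ⊗ h₁ S(h₂)₂ = S(h) ⊗ 1` -/
  right_eq : ∀ h : B,
    TensorProduct.map LinearMap.id (mul (k := k) (B := B)).toLinearMap
      (TensorProduct.leftComm k B B B
        (TensorProduct.map LinearMap.id (comul (R := k) ∘ₗ S) (comul (R := k) h))) =
    S h ⊗ₜ[k] unit (k := k) (B := B) 1
  /-- `∑ ω(h₁ ⊗ S(h₂) ⊗ h₃) = ε(h)` -/
  ω_eq : ∀ h : B,
    ω (k := k) (B := B)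
      (TensorProduct.map LinearMap.id (TensorProduct.map S LinearMap.id ∘ₗ comul (R := k))
        (comul (R := k) h)) =
    counit (R := k) h

/-- A coquasi-antipode `(s, α, β)` for the coquasi-bialgebra `B`. A coquasi-Hopf algebra is a
coquasi-bialgebra endowed with a coquasi-antipode. -/
structure CoquasiAntipode where
  /-- the underlying linear endomorphism -/
  s : B →ₗ[k] B
  /-- the functional `α` -/
  α : B →ₗ[k] k
  /-- the functional `β` -/
  β : B →ₗ[k] k
  /-- `∑ s(h)₁ ⊗ s(h)₂ = ∑ s(h₂) ⊗ s(h₁)` -/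
  comul_s : ∀ h : B,
    comul (R := k) (s h) = TensorProduct.map s s (TensorProduct.comm k B B (comul (R := k) h))
  /-- `ε(s(h)) = ε(h)` -/
  counit_s : ∀ h : B, counit (R := k) (s h) = counit (R := k) h
  /-- `∑ h₁ β(h₂) s(h₃) = β(h) 1` -/
  mul_β_s : ∀ h : B,
    mul (k := k) (B := B) (TensorProduct.map LinearMap.id (leftConv β s) (comul (R := k) h)) =
    β h • unit (k := k) (B := B) 1
  /-- `∑ s(h₁) α(h₂) h₃ = α(h) 1` -/
  s_α_mul : ∀ h : B,
    mul (k := k) (B := B) (TensorProduct.map (rightConv s α) LinearMap.id (comul (R := k) h)) =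
    α h • unit (k := k) (B := B) 1
  /-- `∑ ω(h₁ ⊗ β(h₂) s(h₃) α(h₄) ⊗ h₅) = ε(h)` -/
  ω_eq : ∀ h : B,
    ω (k := k) (B := B)
      (TensorProduct.map LinearMap.id
        (TensorProduct.map (rightConv (leftConv β s) α) LinearMap.id ∘ₗ comul (R := k))
        (comul (R := k) h)) =
    counit (R := k) h
  /-- `∑ ω⁻¹(s(h₁) ⊗ α(h₂) h₃ β(h₄) ⊗ s(h₅)) = ε(h)` -/
  ωInv_eq : ∀ h : B,
    ωInv (k := k) (B := B)
      (TensorProduct.map s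
        (TensorProduct.map (rightConv (leftConv α LinearMap.id) β) s ∘ₗ comul (R := k))
        (comul (R := k) h)) =
    counit (R := k) h

end Antipodes

/-! ### Left coactions -/

/-- A left coaction of the coalgebra `C` on the vector space `V`: a coassociative and counital
linear map `V → C ⊗ V`. -/
structure LeftCoaction (k C V : Type*) [Field k] [AddCommGroup C] [Module k C] [Coalgebra k C]
    [AddCommGroup V] [Module k V] where
  /-- the structure map `v ↦ ∑ v₋₁ ⊗ v₀` -/
  coact : V →ₗ[k] C ⊗[k] V
  coassoc : (TensorProduct.assoc k C C V).toLinearMap ∘ₗ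
      TensorProduct.map comul LinearMap.id ∘ₗ coact =
    TensorProduct.map LinearMap.id coact ∘ₗ coact
  counit_coact : (TensorProduct.lid k V).toLinearMap ∘ₗ
      TensorProduct.map counit LinearMap.id ∘ₗ coact = LinearMap.id

namespace LeftCoaction

section Functional

variable {k C D E C' D' V W X V' W' : Type*} [Field k]
  [AddCommGroup C] [Module k C] [Coalgebra k C] [AddCommGroup D] [Module k D] [Coalgebra k D]
  [AddCommGroup E] [Module k E] [Coalgebra k E]
  [AddCommGroup C'] [Module k C'] [Coalgebra k C'] [AddCommGroup D'] [Module k D'] [Coalgebra k D']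
  [AddCommGroup V] [Module k V] [AddCommGroup W] [Module k W] [AddCommGroup X] [Module k X]
  [AddCommGroup V'] [Module k V'] [AddCommGroup W'] [Module k W']

/-- The coaction along a coalgebra map `φ`: `v ↦ ∑ φ(v₋₁) ⊗ v₀`. -/
def push (c : LeftCoaction k C V) (φ : C →ₗc[k] D) : LeftCoaction k D V where
  coact := TensorProduct.map φ.toLinearMap LinearMap.id ∘ₗ c.coact
  coassoc := by
    have h := congr(TensorProduct.map φ.toLinearMap
      (TensorProduct.map φ.toLinearMap (LinearMap.id (R := k) (M := V))) ∘ₗ $(c.coassoc))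
    have e1 : TensorProduct.map φ.toLinearMap
        (TensorProduct.map φ.toLinearMap (LinearMap.id (R := k) (M := V))) ∘ₗ
        (TensorProduct.assoc k C C V).toLinearMap =
        (TensorProduct.assoc k D D V).toLinearMap ∘ₗ
        TensorProduct.map (TensorProduct.map φ.toLinearMap φ.toLinearMap) LinearMap.id := by
      ext; rfl
    rw [← LinearMap.comp_assoc, e1] at h
    simp only [← LinearMap.comp_assoc, ← TensorProduct.map_comp, LinearMap.id_comp,
      LinearMap.comp_id] at h ⊢
    simp only [LinearMap.comp_assoc, ← TensorProduct.map_comp, LinearMap.id_comp,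
      φ.map_comp_comul] at h ⊢
    exact h
  counit_coact := by
    have e1 : TensorProduct.map counit (LinearMap.id (R := k) (M := V)) ∘ₗ
        TensorProduct.map φ.toLinearMap LinearMap.id ∘ₗ c.coact =
        TensorProduct.map counit LinearMap.id ∘ₗ c.coact := by
      rw [← LinearMap.comp_assoc, ← TensorProduct.map_comp, φ.counit_comp, LinearMap.id_comp]
    rw [e1]
    exact c.counit_coact

/-- The exterior tensor product of a `C`-coaction and a `D`-coaction, a `C ⊗ D`-coaction:
`v ⊗ w ↦ ∑ (v₋₁ ⊗ w₋₁) ⊗ (v₀ ⊗ w₀)`. -/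
def prod (c : LeftCoaction k C V) (d : LeftCoaction k D W) :
    LeftCoaction k (C ⊗[k] D) (V ⊗[k] W) where
  coact := (TensorProduct.tensorTensorTensorComm k C V D W).toLinearMap ∘ₗ
    TensorProduct.map c.coact d.coact
  coassoc := by
    let F : (C ⊗[k] (C ⊗[k] V)) ⊗[k] (D ⊗[k] (D ⊗[k] W)) →ₗ[k]
        (C ⊗[k] D) ⊗[k] ((C ⊗[k] D) ⊗[k] (V ⊗[k] W)) :=
      TensorProduct.map LinearMap.id
        (TensorProduct.tensorTensorTensorComm k C V D W).toLinearMap ∘ₗ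
        (TensorProduct.tensorTensorTensorComm k C (C ⊗[k] V) D (D ⊗[k] W)).toLinearMap
    have key1 : (TensorProduct.assoc k (C ⊗[k] D) (C ⊗[k] D) (V ⊗[k] W)).toLinearMap ∘ₗ
        TensorProduct.map comul LinearMap.id ∘ₗ
        (TensorProduct.tensorTensorTensorComm k C V D W).toLinearMap =
        F ∘ₗ TensorProduct.map
          ((TensorProduct.assoc k C C V).toLinearMap ∘ₗ TensorProduct.map comul LinearMap.id)
          ((TensorProduct.assoc k D D W).toLinearMap ∘ₗ
            TensorProduct.map comul LinearMap.id) := by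
      ext x y x' y'
      change TensorProduct.assoc k (C ⊗[k] D) (C ⊗[k] D) (V ⊗[k] W)
          (TensorProduct.tensorTensorTensorComm k C C D D
            (comul (R := k) x ⊗ₜ comul (R := k) x') ⊗ₜ (y ⊗ₜ y')) =
        F (TensorProduct.assoc k C C V (comul (R := k) x ⊗ₜ y) ⊗ₜ
          TensorProduct.assoc k D D W (comul (R := k) x' ⊗ₜ y'))
      hopf_tensor_induction comul (R := k) x with p q
      hopf_tensor_induction comul (R := k) x' with p' q'
      rfl
    have key2 : TensorProduct.map LinearMap.id
          ((TensorProduct.tensorTensorTensorComm k C V D W).toLinearMap ∘ₗ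
            TensorProduct.map c.coact d.coact) ∘ₗ
        (TensorProduct.tensorTensorTensorComm k C V D W).toLinearMap =
        F ∘ₗ TensorProduct.map (TensorProduct.map LinearMap.id c.coact)
          (TensorProduct.map LinearMap.id d.coact) := by
      ext x y x' y'
      rfl
    have h1 := congr($key1 ∘ₗ TensorProduct.map c.coact d.coact)
    have h2 := congr($key2 ∘ₗ TensorProduct.map c.coact d.coact)
    simp only [LinearMap.comp_assoc, ← TensorProduct.map_comp] at h1 h2
    rw [h1, h2, c.coassoc, d.coassoc]
  counit_coact := by
    have key : (TensorProduct.lid k (V ⊗[k] W)).toLinearMap ∘ₗ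
        TensorProduct.map counit LinearMap.id ∘ₗ
        (TensorProduct.tensorTensorTensorComm k C V D W).toLinearMap =
        TensorProduct.map
          ((TensorProduct.lid k V).toLinearMap ∘ₗ TensorProduct.map counit LinearMap.id)
          ((TensorProduct.lid k W).toLinearMap ∘ₗ TensorProduct.map counit LinearMap.id) := by
      ext x y x' y'
      simp [TensorProduct.smul_tmul', smul_smul, TensorProduct.tmul_smul]
    have h := congr($key ∘ₗ TensorProduct.map c.coact d.coact)
    simp only [LinearMap.comp_assoc, ← TensorProduct.map_comp] at h
    rw [h, c.counit_coact, d.counit_coact, TensorProduct.map_id]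

variable (k V) in
/-- The coaction `v ↦ 1 ⊗ v` of the coalgebra `k`. -/
def trivial : LeftCoaction k k V where
  coact := (TensorProduct.lid k V).symm.toLinearMap
  coassoc := by ext v; simp
  counit_coact := by ext v; simp

/-- The action of a functional `f` on a left comodule: `v ↦ ∑ f(v₋₁) v₀`. -/
def act (c : LeftCoaction k C V) (f : C →ₗ[k] k) : V →ₗ[k] V :=
  (TensorProduct.lid k V).toLinearMap ∘ₗ TensorProduct.map f LinearMap.id ∘ₗ c.coact

/-- `e` intertwines the two coactions over the linear map `θ`:
`∑ e(v)₋₁ ⊗ e(v)₀ = ∑ θ(v₋₁) ⊗ e(v₀)`. For `θ = id` this says that `e` is colinear. -/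
def Compat (c : LeftCoaction k C V) (d : LeftCoaction k D W) (θ : C →ₗ[k] D) (e : V →ₗ[k] W) :
    Prop :=
  d.coact ∘ₗ e = TensorProduct.map θ e ∘ₗ c.coact

theorem act_counit (c : LeftCoaction k C V) : c.act counit = LinearMap.id := c.counit_coact

theorem act_comp_act (c : LeftCoaction k C V) (f g : C →ₗ[k] k) :
    c.act g ∘ₗ c.act f = c.act (leftConv f g) := by
  have e1 : c.act g ∘ₗ c.act f =
      (TensorProduct.lid k V).toLinearMap ∘ₗ TensorProduct.map f
        ((TensorProduct.lid k V).toLinearMap ∘ₗ TensorProduct.map g LinearMap.id) ∘ₗ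
        (TensorProduct.map LinearMap.id c.coact ∘ₗ c.coact) := by
    have : c.act g ∘ₗ (TensorProduct.lid k V).toLinearMap ∘ₗ TensorProduct.map f LinearMap.id =
      (TensorProduct.lid k V).toLinearMap ∘ₗ TensorProduct.map f
        ((TensorProduct.lid k V).toLinearMap ∘ₗ TensorProduct.map g LinearMap.id) ∘ₗ
        TensorProduct.map LinearMap.id c.coact := by
      ext x y
      simp [act]
    exact congr($this ∘ₗ c.coact)
  rw [e1, ← c.coassoc]
  have e2 : (TensorProduct.lid k V).toLinearMap ∘ₗ TensorProduct.map f
        ((TensorProduct.lid k V).toLinearMap ∘ₗ TensorProduct.map g LinearMap.id) ∘ₗ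
        (TensorProduct.assoc k C C V).toLinearMap ∘ₗ TensorProduct.map comul LinearMap.id =
      (TensorProduct.lid k V).toLinearMap ∘ₗ
        TensorProduct.map (leftConv f g) LinearMap.id := by
    ext x y
    change TensorProduct.lid k V (TensorProduct.map f
        ((TensorProduct.lid k V).toLinearMap ∘ₗ TensorProduct.map g LinearMap.id)
        (TensorProduct.assoc k C C V (comul (R := k) x ⊗ₜ y))) =
      TensorProduct.lid k k (TensorProduct.map f g (comul (R := k) x)) • y
    induction comul (R := k) x with
    | zero => simp
    | tmul p q => simp [smul_smul, mul_comm]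
    | add a b ha hb => simp only [map_add, add_tmul, add_smul, ha, hb]
  exact congr($e2 ∘ₗ c.coact)

theorem act_comp_act_of_inv (c : LeftCoaction k C V) {f g : C →ₗ[k] k}
    (h : leftConv f g = counit) : c.act g ∘ₗ c.act f = LinearMap.id := by
  rw [act_comp_act, h, act_counit]

theorem Compat.comp {c : LeftCoaction k C V} {d : LeftCoaction k D W} {x : LeftCoaction k E X}
    {θ : C →ₗ[k] D} {e : V →ₗ[k] W} {η : D →ₗ[k] E} {g : W →ₗ[k] X}
    (h' : Compat d x η g) (h : Compat c d θ e) : Compat c x (η ∘ₗ θ) (g ∘ₗ e) := by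
  unfold Compat at *
  rw [← LinearMap.comp_assoc, h', LinearMap.comp_assoc, h, TensorProduct.map_comp,
    LinearMap.comp_assoc]

theorem Compat.prod {c : LeftCoaction k C V} {c' : LeftCoaction k C' V'}
    {d : LeftCoaction k D W} {d' : LeftCoaction k D' W'}
    {θ : C →ₗ[k] C'} {e : V →ₗ[k] V'} {η : D →ₗ[k] D'} {g : W →ₗ[k] W'}
    (h : Compat c c' θ e) (h' : Compat d d' η g) :
    Compat (c.prod d) (c'.prod d') (TensorProduct.map θ η) (TensorProduct.map e g) := by
  unfold Compat at *
  have e1 : (TensorProduct.tensorTensorTensorComm k C' V' D' W').toLinearMap ∘ₗ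
      TensorProduct.map (TensorProduct.map θ e) (TensorProduct.map η g) =
      TensorProduct.map (TensorProduct.map θ η) (TensorProduct.map e g) ∘ₗ
      (TensorProduct.tensorTensorTensorComm k C V D W).toLinearMap := by
    ext; rfl
  have e2 := congr($e1 ∘ₗ TensorProduct.map c.coact d.coact)
  simp only [LinearMap.comp_assoc, ← TensorProduct.map_comp, ← h, ← h'] at e2
  simpa only [LeftCoaction.prod, LinearMap.comp_assoc, ← TensorProduct.map_comp] using e2

theorem Compat.refl (c : LeftCoaction k C V) : Compat c c LinearMap.id LinearMap.id := by
  simp [Compat]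

theorem Compat.symm {c : LeftCoaction k C V} {d : LeftCoaction k C W} {e : V ≃ₗ[k] W}
    (h : Compat c d LinearMap.id e.toLinearMap) :
    Compat d c LinearMap.id e.symm.toLinearMap := by
  unfold Compat at *
  have e1 : TensorProduct.map LinearMap.id e.symm.toLinearMap ∘ₗ
      (d.coact ∘ₗ e.toLinearMap) ∘ₗ e.symm.toLinearMap = c.coact ∘ₗ e.symm.toLinearMap := by
    rw [h, ← LinearMap.comp_assoc, ← LinearMap.comp_assoc, ← TensorProduct.map_comp]
    simp
  rw [← e1, LinearMap.comp_assoc]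
  simp

theorem compat_push (c : LeftCoaction k C V) (φ : C →ₗc[k] D) :
    Compat c (c.push φ) φ.toLinearMap LinearMap.id := by
  simp [Compat, push]

theorem compat_assoc_symm (c : LeftCoaction k C V) (d : LeftCoaction k D W)
    (x : LeftCoaction k E X) :
    Compat (c.prod (d.prod x)) ((c.prod d).prod x)
      (TensorProduct.assoc k C D E).symm.toLinearMap
      (TensorProduct.assoc k V W X).symm.toLinearMap := by
  unfold Compat
  have e1 : (TensorProduct.tensorTensorTensorComm k (C ⊗[k] D) (V ⊗[k] W) E X).toLinearMap ∘ₗ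
      TensorProduct.map (TensorProduct.tensorTensorTensorComm k C V D W).toLinearMap
        LinearMap.id ∘ₗ (TensorProduct.assoc k (C ⊗[k] V) (D ⊗[k] W) (E ⊗[k] X)).symm.toLinearMap =
      TensorProduct.map (TensorProduct.assoc k C D E).symm.toLinearMap
        (TensorProduct.assoc k V W X).symm.toLinearMap ∘ₗ
      (TensorProduct.tensorTensorTensorComm k C V (D ⊗[k] E) (W ⊗[k] X)).toLinearMap ∘ₗ
      TensorProduct.map LinearMap.id
        (TensorProduct.tensorTensorTensorComm k D W E X).toLinearMap := by
    ext; rfl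
  have e2 : (TensorProduct.assoc k (C ⊗[k] V) (D ⊗[k] W) (E ⊗[k] X)).symm.toLinearMap ∘ₗ
      TensorProduct.map c.coact (TensorProduct.map d.coact x.coact) =
      TensorProduct.map (TensorProduct.map c.coact d.coact) x.coact ∘ₗ
      (TensorProduct.assoc k V W X).symm.toLinearMap := by
    ext; rfl
  have e3 := congr($e1 ∘ₗ TensorProduct.map c.coact (TensorProduct.map d.coact x.coact))
  simp only [LinearMap.comp_assoc, e2] at e3
  simp only [← LinearMap.comp_assoc, ← TensorProduct.map_comp, LinearMap.id_comp] at e3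
  simp only [LinearMap.comp_assoc] at e3
  simpa only [LeftCoaction.prod, LinearMap.comp_assoc] using e3

theorem Compat.act {c : LeftCoaction k C V} {d : LeftCoaction k D W}
    {θ : C →ₗ[k] D} {e : V →ₗ[k] W} (h : Compat c d θ e) (f : D →ₗ[k] k) :
    d.act f ∘ₗ e = e ∘ₗ c.act (f ∘ₗ θ) := by
  unfold Compat at h
  have e1 : (TensorProduct.lid k W).toLinearMap ∘ₗ TensorProduct.map f LinearMap.id ∘ₗ
      TensorProduct.map θ e = e ∘ₗ (TensorProduct.lid k V).toLinearMap ∘ₗ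
      TensorProduct.map (f ∘ₗ θ) LinearMap.id := by
    ext; simp
  unfold LeftCoaction.act
  simp only [LinearMap.comp_assoc, h]
  exact congr($e1 ∘ₗ c.coact)

theorem map_id_act (c : LeftCoaction k C V) (d : LeftCoaction k D W) (f : D →ₗ[k] k) :
    TensorProduct.map LinearMap.id (d.act f) =
      (c.prod d).act ((TensorProduct.lid k k).toLinearMap ∘ₗ TensorProduct.map counit f) := by
  have e1 : (TensorProduct.lid k (V ⊗[k] W)).toLinearMap ∘ₗ
      TensorProduct.map ((TensorProduct.lid k k).toLinearMap ∘ₗ TensorProduct.map counit f)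
        LinearMap.id ∘ₗ (TensorProduct.tensorTensorTensorComm k C V D W).toLinearMap =
      TensorProduct.map
        ((TensorProduct.lid k V).toLinearMap ∘ₗ TensorProduct.map counit LinearMap.id)
        ((TensorProduct.lid k W).toLinearMap ∘ₗ TensorProduct.map f LinearMap.id) := by
    ext; simp [TensorProduct.smul_tmul', smul_smul, TensorProduct.tmul_smul, mul_comm]
  have e2 := congr($e1 ∘ₗ TensorProduct.map c.coact d.coact)
  simp only [LinearMap.comp_assoc, ← TensorProduct.map_comp, c.counit_coact] at e2
  exact e2.symm

theorem map_act_id (c : LeftCoaction k C V) (d : LeftCoaction k D W) (f : C →ₗ[k] k) :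
    TensorProduct.map (c.act f) LinearMap.id =
      (c.prod d).act ((TensorProduct.lid k k).toLinearMap ∘ₗ TensorProduct.map f counit) := by
  have e1 : (TensorProduct.lid k (V ⊗[k] W)).toLinearMap ∘ₗ
      TensorProduct.map ((TensorProduct.lid k k).toLinearMap ∘ₗ TensorProduct.map f counit)
        LinearMap.id ∘ₗ (TensorProduct.tensorTensorTensorComm k C V D W).toLinearMap =
      TensorProduct.map
        ((TensorProduct.lid k V).toLinearMap ∘ₗ TensorProduct.map f LinearMap.id)
        ((TensorProduct.lid k W).toLinearMap ∘ₗ TensorProduct.map counit LinearMap.id) := by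
    ext; simp [TensorProduct.smul_tmul', smul_smul, TensorProduct.tmul_smul, mul_comm]
  have e2 := congr($e1 ∘ₗ TensorProduct.map c.coact d.coact)
  simp only [LinearMap.comp_assoc, ← TensorProduct.map_comp, d.counit_coact] at e2
  exact e2.symm

theorem map_coact_act_left (c : LeftCoaction k C V) (f : C →ₗ[k] k) (φ : C →ₗ[k] W) :
    (TensorProduct.map φ LinearMap.id ∘ₗ c.coact) ∘ₗ c.act f =
      TensorProduct.map (leftConv f φ) LinearMap.id ∘ₗ c.coact := by
  have e1 : (TensorProduct.map φ LinearMap.id ∘ₗ c.coact) ∘ₗ (TensorProduct.lid k V).toLinearMap ∘ₗ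
      TensorProduct.map f LinearMap.id =
      (TensorProduct.lid k (W ⊗[k] V)).toLinearMap ∘ₗ
        TensorProduct.map f (TensorProduct.map φ LinearMap.id) ∘ₗ
        TensorProduct.map LinearMap.id c.coact := by
    ext; simp
  have e2 : (TensorProduct.lid k (W ⊗[k] V)).toLinearMap ∘ₗ
        TensorProduct.map f (TensorProduct.map φ LinearMap.id) ∘ₗ
        (TensorProduct.assoc k C C V).toLinearMap ∘ₗ TensorProduct.map comul LinearMap.id =
      TensorProduct.map (leftConv f φ) LinearMap.id := by
    ext x y
    change TensorProduct.lid k (W ⊗[k] V) (TensorProduct.map f (TensorProduct.map φ LinearMap.id)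
        (TensorProduct.assoc k C C V (comul (R := k) x ⊗ₜ y))) =
      (TensorProduct.lid k W (TensorProduct.map f φ (comul (R := k) x))) ⊗ₜ y
    hopf_tensor_induction comul (R := k) x with p q
    exact (TensorProduct.smul_tmul' (f p) (φ q) y)
  have h1 := congr($e1 ∘ₗ c.coact)
  have h2 := congr($e2 ∘ₗ c.coact)
  simp only [LinearMap.comp_assoc] at h1 h2
  rw [c.coassoc] at h2
  simpa only [act, LinearMap.comp_assoc] using h1.trans h2

theorem map_act_coact (c : LeftCoaction k C V) (f : C →ₗ[k] k) (φ : C →ₗ[k] W) :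
    TensorProduct.map φ (c.act f) ∘ₗ c.coact =
      TensorProduct.map (rightConv φ f) LinearMap.id ∘ₗ c.coact := by
  have e2 : TensorProduct.map φ ((TensorProduct.lid k V).toLinearMap ∘ₗ
        TensorProduct.map f LinearMap.id) ∘ₗ
        (TensorProduct.assoc k C C V).toLinearMap ∘ₗ TensorProduct.map comul LinearMap.id =
      TensorProduct.map (rightConv φ f) LinearMap.id := by
    ext x y
    change TensorProduct.map φ ((TensorProduct.lid k V).toLinearMap ∘ₗ
        TensorProduct.map f LinearMap.id)
        (TensorProduct.assoc k C C V (comul (R := k) x ⊗ₜ y)) =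
      (TensorProduct.rid k W (TensorProduct.map φ f (comul (R := k) x))) ⊗ₜ y
    hopf_tensor_induction comul (R := k) x with p q
    change φ p ⊗ₜ[k] (f q • y) = (f q • φ p) ⊗ₜ[k] y
    exact (TensorProduct.smul_tmul (f q) (φ p) y).symm
  have h2 := congr($e2 ∘ₗ c.coact)
  simp only [LinearMap.comp_assoc] at h2
  rw [c.coassoc, ← LinearMap.comp_assoc, ← TensorProduct.map_comp] at h2
  simpa only [act, LinearMap.comp_assoc, LinearMap.comp_id] using h2

end Functional

section Monoidal

variable {k : Type u} {B : Type v} [Field k] [AddCommGroup B] [Module k B] [CoquasiBialgebra k B]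
  {U₀ U₁ U₂ U₃ U₁' U₂' U₃' : Type*} [AddCommGroup U₀] [Module k U₀] [AddCommGroup U₁] [Module k U₁]
  [AddCommGroup U₂] [Module k U₂] [AddCommGroup U₃] [Module k U₃] [AddCommGroup U₁'] [Module k U₁']
  [AddCommGroup U₂'] [Module k U₂'] [AddCommGroup U₃'] [Module k U₃']

/-- The diagonal coaction on a tensor product: `v ⊗ w ↦ ∑ v₋₁ w₋₁ ⊗ (v₀ ⊗ w₀)`. -/
def tens (X : LeftCoaction k B U₁) (Y : LeftCoaction k B U₂) : LeftCoaction k B (U₁ ⊗[k] U₂) :=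
  (X.prod Y).push mul

variable (k B) in
/-- The coaction `x ↦ 1 ⊗ x` of `B` on the field `k`. -/
def unitCoaction : LeftCoaction k B k := (LeftCoaction.trivial k k).push unit

theorem compat_tens_self (X : LeftCoaction k B U₁) (Y : LeftCoaction k B U₂) :
    Compat (X.prod Y) (tens X Y) (mul (k := k) (B := B)).toLinearMap LinearMap.id :=
  compat_push _ _

theorem compat_tens {X : LeftCoaction k B U₁} {Y : LeftCoaction k B U₂}
    {X' : LeftCoaction k B U₁'} {Y' : LeftCoaction k B U₂'}
    {f : U₁ →ₗ[k] U₁'} {g : U₂ →ₗ[k] U₂'}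
    (hf : Compat X X' LinearMap.id f) (hg : Compat Y Y' LinearMap.id g) :
    Compat (tens X Y) (tens X' Y') LinearMap.id (TensorProduct.map f g) := by
  have h := (compat_push (X'.prod Y') (mul (k := k) (B := B))).comp (hf.prod hg)
  have e1 : TensorProduct.map LinearMap.id (TensorProduct.map f g) ∘ₗ
      TensorProduct.map (mul (k := k) (B := B)).toLinearMap LinearMap.id =
      TensorProduct.map ((mul (k := k) (B := B)).toLinearMap ∘ₗ
        TensorProduct.map LinearMap.id LinearMap.id)
        (LinearMap.id ∘ₗ TensorProduct.map f g) := by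
    rw [← TensorProduct.map_comp, TensorProduct.map_id]; rfl
  have h2 := congr($e1 ∘ₗ (X.prod Y).coact)
  exact h.trans h2.symm

/-- The coaction `u ⊗ (v ⊗ w) ↦ ∑ (u₋₁ ⊗ (v₋₁ ⊗ w₋₁)) ⊗ (u₀ ⊗ (v₀ ⊗ w₀))` of `B ⊗ (B ⊗ B)`. -/
abbrev triple (X : LeftCoaction k B U₁) (Y : LeftCoaction k B U₂) (Z : LeftCoaction k B U₃) :
    LeftCoaction k (B ⊗[k] (B ⊗[k] B)) (U₁ ⊗[k] (U₂ ⊗[k] U₃)) :=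
  X.prod (Y.prod Z)

/-- The linear map underlying the associativity constraint:
`(u ⊗ v) ⊗ w ↦ ∑ ω⁻¹(u₋₁ ⊗ v₋₁ ⊗ w₋₁) u₀ ⊗ (v₀ ⊗ w₀)`. -/
def assocEquiv (X : LeftCoaction k B U₁) (Y : LeftCoaction k B U₂) (Z : LeftCoaction k B U₃) :
    (U₁ ⊗[k] U₂) ⊗[k] U₃ ≃ₗ[k]
      U₁ ⊗[k] (U₂ ⊗[k] U₃) :=
  TensorProduct.assoc k U₁ U₂ U₃ ≪≫ₗ
    LinearEquiv.ofLinearMap ((triple X Y Z).act ωInv) ((triple X Y Z).act ω)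
      (act_comp_act_of_inv _ ω_conv_ωInv) (act_comp_act_of_inv _ ωInv_conv_ω)

theorem assocEquiv_symm (X : LeftCoaction k B U₁) (Y : LeftCoaction k B U₂) (Z : LeftCoaction k B U₃) : (assocEquiv X Y Z).symm.toLinearMap =
    (TensorProduct.assoc k U₁ U₂ U₃).symm.toLinearMap ∘ₗ
      (triple X Y Z).act ω := rfl

theorem compat_triple (X : LeftCoaction k B U₁) (Y : LeftCoaction k B U₂) (Z : LeftCoaction k B U₃) :
    Compat (triple X Y Z) (tens X (tens Y Z))
      (mul.toLinearMap ∘ₗ TensorProduct.map LinearMap.id mul.toLinearMap) LinearMap.id := by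
  have h := (compat_push (X.prod (tens Y Z)) (mul (k := k) (B := B))).comp
    ((Compat.refl X).prod (compat_push (Y.prod Z) mul))
  simp only [TensorProduct.map_id, LinearMap.id_comp] at h
  exact h

theorem compat_triple' (X : LeftCoaction k B U₁) (Y : LeftCoaction k B U₂) (Z : LeftCoaction k B U₃) :
    Compat (triple X Y Z) (tens (tens X Y) Z)
      (mul.toLinearMap ∘ₗ TensorProduct.map mul.toLinearMap LinearMap.id ∘ₗ
        (TensorProduct.assoc k B B B).symm.toLinearMap)
      (TensorProduct.assoc k U₁ U₂ U₃).symm.toLinearMap := by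
  have h := ((compat_push ((tens X Y).prod Z) (mul (k := k) (B := B))).comp
    ((compat_push (X.prod Y) mul).prod (Compat.refl Z))).comp
    (compat_assoc_symm X Y Z)
  simp only [TensorProduct.map_id, LinearMap.id_comp, LinearMap.comp_assoc] at h
  exact h

theorem compat_assocEquiv_symm (X : LeftCoaction k B U₁) (Y : LeftCoaction k B U₂) (Z : LeftCoaction k B U₃) :
    Compat (tens X (tens Y Z)) (tens (tens X Y) Z) LinearMap.id
      (assocEquiv X Y Z).symm.toLinearMap := by
  have h1 := compat_triple X Y Z
  have h2 := compat_triple' X Y Z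
  have h3 := map_coact_act_left (triple X Y Z) ω
    ((mul (k := k) (B := B)).toLinearMap ∘ₗ
      TensorProduct.map mul.toLinearMap LinearMap.id ∘ₗ
        (TensorProduct.assoc k B B B).symm.toLinearMap)
  have h4 := map_act_coact (triple X Y Z) ω
    ((mul (k := k) (B := B)).toLinearMap ∘ₗ
      TensorProduct.map LinearMap.id mul.toLinearMap)
  rw [quasi_assoc, ← h3] at h4
  unfold Compat at *
  rw [LinearMap.comp_id] at h1
  rw [assocEquiv_symm]
  generalize (mul (k := k) (B := B)).toLinearMap ∘ₗ
    TensorProduct.map mul.toLinearMap LinearMap.id ∘ₗ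
      (TensorProduct.assoc k B B B).symm.toLinearMap = φ₂ at *
  generalize (mul (k := k) (B := B)).toLinearMap ∘ₗ
    TensorProduct.map LinearMap.id mul.toLinearMap = φ₁ at *
  generalize (TensorProduct.assoc k U₁ U₂ U₃).symm.toLinearMap = a at *
  generalize (triple X Y Z).act ω = A at *
  have f1 : TensorProduct.map φ₂ a =
      TensorProduct.map LinearMap.id a ∘ₗ TensorProduct.map φ₂ LinearMap.id := by
    rw [← TensorProduct.map_comp, LinearMap.id_comp, LinearMap.comp_id]
  have f2 : TensorProduct.map LinearMap.id (a ∘ₗ A) ∘ₗ TensorProduct.map φ₁ LinearMap.id =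
      TensorProduct.map LinearMap.id a ∘ₗ TensorProduct.map φ₁ A := by
    rw [← TensorProduct.map_comp, ← TensorProduct.map_comp, LinearMap.id_comp, LinearMap.comp_id]
  rw [h1, ← LinearMap.comp_assoc, h2, f1, ← LinearMap.comp_assoc _ _ (TensorProduct.map _ (a ∘ₗ A)),
    f2, LinearMap.comp_assoc, LinearMap.comp_assoc, LinearMap.comp_assoc, h4, LinearMap.comp_assoc]

theorem compat_unit_prod (X : LeftCoaction k B U₁) :
    Compat X ((unitCoaction k B).prod X) (TensorProduct.mk k B B (unit (k := k) (B := B) 1))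
      (TensorProduct.mk k k U₁ 1) := by
  have e : (TensorProduct.tensorTensorTensorComm k B k B U₁).toLinearMap ∘ₗ
      TensorProduct.mk k (B ⊗[k] k) (B ⊗[k] U₁) (unit (k := k) (B := B) 1 ⊗ₜ 1) =
      TensorProduct.map (TensorProduct.mk k B B (unit (k := k) (B := B) 1))
        (TensorProduct.mk k k U₁ 1) := by
    ext; rfl
  refine LinearMap.ext fun v => ?_
  exact LinearMap.congr_fun e (X.coact v)

theorem compat_prod_unit (X : LeftCoaction k B U₁) :
    Compat X (X.prod (unitCoaction k B))
      ((TensorProduct.mk k B B).flip (unit (k := k) (B := B) 1))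
      ((TensorProduct.mk k U₁ k).flip 1) := by
  have e : (TensorProduct.tensorTensorTensorComm k B U₁ B k).toLinearMap ∘ₗ
      (TensorProduct.mk k (B ⊗[k] U₁) (B ⊗[k] k)).flip (unit (k := k) (B := B) 1 ⊗ₜ 1) =
      TensorProduct.map ((TensorProduct.mk k B B).flip (unit (k := k) (B := B) 1))
        ((TensorProduct.mk k U₁ k).flip 1) := by
    ext; rfl
  refine LinearMap.ext fun v => ?_
  exact LinearMap.congr_fun e (X.coact v)

theorem compat_lid (X : LeftCoaction k B U₁) :
    Compat (tens (unitCoaction k B) X) X LinearMap.id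
      (TensorProduct.lid k U₁).toLinearMap := by
  have h := (compat_tens_self (unitCoaction k B) X).comp (compat_unit_prod X)
  have e : (mul (k := k) (B := B)).toLinearMap ∘ₗ
      TensorProduct.mk k B B (unit (k := k) (B := B) 1) = LinearMap.id :=
    LinearMap.ext unit_mul
  rw [e, LinearMap.id_comp] at h
  exact Compat.symm (e := (TensorProduct.lid k U₁).symm) h

theorem compat_rid (X : LeftCoaction k B U₁) :
    Compat (tens X (unitCoaction k B)) X LinearMap.id
      (TensorProduct.rid k U₁).toLinearMap := by
  have h := (compat_tens_self X (unitCoaction k B)).comp (compat_prod_unit X)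
  have e : (mul (k := k) (B := B)).toLinearMap ∘ₗ
      (TensorProduct.mk k B B).flip (unit (k := k) (B := B) 1) = LinearMap.id :=
    LinearMap.ext mul_unit
  rw [e, LinearMap.id_comp] at h
  exact Compat.symm (e := (TensorProduct.rid k U₁).symm) h

theorem assocEquiv_natural {X : LeftCoaction k B U₁} {Y : LeftCoaction k B U₂} {Z : LeftCoaction k B U₃}
    {X' : LeftCoaction k B U₁'} {Y' : LeftCoaction k B U₂'} {Z' : LeftCoaction k B U₃'}
    {f : U₁ →ₗ[k] U₁'} {g : U₂ →ₗ[k] U₂'} {h : U₃ →ₗ[k] U₃'}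
    (hf : Compat X X' LinearMap.id f) (hg : Compat Y Y' LinearMap.id g)
    (hh : Compat Z Z' LinearMap.id h) :
    (assocEquiv X' Y' Z').toLinearMap ∘ₗ
        TensorProduct.map (TensorProduct.map f g) h =
      TensorProduct.map f (TensorProduct.map g h) ∘ₗ
        (assocEquiv X Y Z).toLinearMap := by
  have h1 := (hf.prod (hg.prod hh)).act ωInv
  rw [TensorProduct.map_id, TensorProduct.map_id, LinearMap.comp_id] at h1
  have h2 : (TensorProduct.assoc k U₁' U₂' U₃').toLinearMap ∘ₗ
      TensorProduct.map (TensorProduct.map f g) h =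
      TensorProduct.map f (TensorProduct.map g h) ∘ₗ
      (TensorProduct.assoc k U₁ U₂ U₃).toLinearMap := by
    ext; rfl
  change (triple X' Y' Z').act ωInv ∘ₗ (TensorProduct.assoc k _ _ _).toLinearMap ∘ₗ _ = _
  rw [h2, ← LinearMap.comp_assoc, h1, LinearMap.comp_assoc]
  rfl

theorem pentagon_formal {V₀ V₁ V₂ V₃ V₄ : Type*} [AddCommGroup V₀] [Module k V₀]
    [AddCommGroup V₁] [Module k V₁] [AddCommGroup V₂] [Module k V₂] [AddCommGroup V₃] [Module k V₃]
    [AddCommGroup V₄] [Module k V₄] {p₁ p₂ p₃ p₄ p₅ : V₀ →ₗ[k] V₀}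
    {t : V₀ →ₗ[k] V₁} {a₂ : V₁ →ₗ[k] V₂} {b : V₂ →ₗ[k] V₃} {a₃ : V₀ →ₗ[k] V₄} {a₄ : V₄ →ₗ[k] V₃}
    {q₂ : V₁ →ₗ[k] V₁} {q₃ : V₂ →ₗ[k] V₂} {q₄ : V₀ →ₗ[k] V₀} {q₅ : V₄ →ₗ[k] V₄}
    (h₂ : q₂ ∘ₗ t = t ∘ₗ p₂) (h₃ : q₃ ∘ₗ (a₂ ∘ₗ t) = (a₂ ∘ₗ t) ∘ₗ p₃) (h₄ : q₄ = p₄)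
    (h₅ : q₅ ∘ₗ a₃ = a₃ ∘ₗ p₅) (coh : b ∘ₗ a₂ ∘ₗ t = a₄ ∘ₗ a₃)
    (hp : p₅ ∘ₗ p₄ = p₃ ∘ₗ p₂ ∘ₗ p₁) :
    (b ∘ₗ q₃) ∘ₗ (a₂ ∘ₗ q₂) ∘ₗ (t ∘ₗ p₁) = (a₄ ∘ₗ q₅) ∘ₗ (a₃ ∘ₗ q₄) := by
  subst h₄
  ext x
  have e₂ := LinearMap.congr_fun h₂ (p₁ x)
  have e₃ := LinearMap.congr_fun h₃ (p₂ (p₁ x))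
  have e₅ := LinearMap.congr_fun h₅ (q₄ x)
  have e := LinearMap.congr_fun coh (p₅ (q₄ x))
  have ep := LinearMap.congr_fun hp x
  simp only [LinearMap.comp_apply] at *
  rw [e₂, e₃, e₅, ← e, ep]

theorem pentagon_aux (W : LeftCoaction k B U₀) (X : LeftCoaction k B U₁)
    (Y : LeftCoaction k B U₂) (Z : LeftCoaction k B U₃) :
    TensorProduct.map (assocEquiv W X Y).symm.toLinearMap LinearMap.id ∘ₗ
      (assocEquiv W (tens X Y) Z).symm.toLinearMap ∘ₗ
      TensorProduct.map LinearMap.id (assocEquiv X Y Z).symm.toLinearMap =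
    (assocEquiv (tens W X) Y Z).symm.toLinearMap ∘ₗ
      (assocEquiv W X (tens Y Z)).symm.toLinearMap := by
  -- the actions of `ω(B ⊗ m ⊗ B)`, `ω ⊗ ε`, `ω(B ⊗ B ⊗ m)` and `ω(m ⊗ B ⊗ B)`
  have c2 := ((Compat.refl W).prod (((compat_tens_self X Y).prod (Compat.refl Z)).comp
    (compat_assoc_symm X Y Z))).act ω
  have c3 := ((compat_assoc_symm W (X.prod Y) Z).comp
    ((Compat.refl W).prod (compat_assoc_symm X Y Z))).act
      ((TensorProduct.lid k k).toLinearMap ∘ₗ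
        TensorProduct.map (ω (k := k) (B := B)) counit)
  have c4 := ((Compat.refl W).prod ((Compat.refl X).prod (compat_tens_self Y Z))).act ω
  have c5 := (((compat_tens_self W X).prod (Compat.refl (Y.prod Z))).comp
    (compat_assoc_symm W X (Y.prod Z))).act ω
  simp only [TensorProduct.map_id, LinearMap.id_comp, LinearMap.comp_id] at c2 c4 c5
  rw [← map_act_id] at c3
  have cc := congr((W.prod (X.prod (Y.prod Z))).act $(cocycle (k := k) (B := B)))
  rw [← act_comp_act, ← act_comp_act, ← act_comp_act, ← map_id_act] at cc
  have coh : TensorProduct.map (TensorProduct.assoc k U₀ U₁ U₂).symm.toLinearMap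
        (LinearMap.id (R := k) (M := U₃)) ∘ₗ
      (TensorProduct.assoc k U₀ (U₁ ⊗[k] U₂) U₃).symm.toLinearMap ∘ₗ
      TensorProduct.map LinearMap.id (TensorProduct.assoc k U₁ U₂ U₃).symm.toLinearMap =
      (TensorProduct.assoc k (U₀ ⊗[k] U₁) U₂ U₃).symm.toLinearMap ∘ₗ
      (TensorProduct.assoc k U₀ U₁ (U₂ ⊗[k] U₃)).symm.toLinearMap := by
    ext; rfl
  have t1 : TensorProduct.map (LinearMap.id (R := k) (M := U₀))
      ((TensorProduct.assoc k U₁ U₂ U₃).symm.toLinearMap ∘ₗ (triple X Y Z).act ω) =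
      TensorProduct.map LinearMap.id (TensorProduct.assoc k U₁ U₂ U₃).symm.toLinearMap ∘ₗ
        TensorProduct.map LinearMap.id ((triple X Y Z).act ω) := by
    rw [← TensorProduct.map_comp, LinearMap.id_comp]
  have t2 : TensorProduct.map
      ((TensorProduct.assoc k U₀ U₁ U₂).symm.toLinearMap ∘ₗ (triple W X Y).act ω)
      (LinearMap.id (R := k) (M := U₃)) =
      TensorProduct.map (TensorProduct.assoc k U₀ U₁ U₂).symm.toLinearMap LinearMap.id ∘ₗ
        TensorProduct.map ((triple W X Y).act ω) LinearMap.id := by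
    rw [← TensorProduct.map_comp, LinearMap.id_comp]
  rw [assocEquiv_symm, assocEquiv_symm, assocEquiv_symm, assocEquiv_symm, assocEquiv_symm, t1, t2]
  exact pentagon_formal (V₃ := ((U₀ ⊗[k] U₁) ⊗[k] U₂) ⊗[k] U₃) c2 c3 c4 c5 coh cc

theorem triangle_aux (X : LeftCoaction k B U₁) (Y : LeftCoaction k B U₂) :
    TensorProduct.map (TensorProduct.rid k U₁).toLinearMap LinearMap.id ∘ₗ
      (assocEquiv X (unitCoaction k B) Y).symm.toLinearMap =
    TensorProduct.map LinearMap.id (TensorProduct.lid k U₂).toLinearMap := by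
  have s1 := ((Compat.refl X).prod (compat_unit_prod Y)).act ω
  have e1 : ω (k := k) (B := B) ∘ₗ TensorProduct.map LinearMap.id
      (TensorProduct.mk k B B (unit (k := k) (B := B) 1)) = counit := by
    refine TensorProduct.ext' fun a b => ?_
    change ω (k := k) (B := B) (a ⊗ₜ (unit (k := k) (B := B) 1 ⊗ₜ b)) = _
    rw [ω_unit, TensorProduct.counit_tmul, smul_eq_mul, mul_comm]
  rw [e1, act_counit, LinearMap.comp_id] at s1
  refine TensorProduct.ext' fun x z => ?_
  obtain ⟨y, rfl⟩ : ∃ y, z = (1 : k) ⊗ₜ[k] y :=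
    ⟨TensorProduct.lid k U₂ z, ((TensorProduct.lid k U₂).symm_apply_apply z).symm⟩
  have s2 : (triple X (unitCoaction k B) Y).act ω (x ⊗ₜ (1 ⊗ₜ y)) = x ⊗ₜ (1 ⊗ₜ y) :=
    LinearMap.congr_fun s1 (x ⊗ₜ y)
  rw [assocEquiv_symm, LinearMap.comp_apply, LinearMap.comp_apply, s2]
  simp

theorem pentagon_symm {V₀ V₁ V₂ V₃ V₄ V₅ V₆ V₇ : Type*} [AddCommGroup V₀] [Module k V₀]
    [AddCommGroup V₁] [Module k V₁] [AddCommGroup V₂] [Module k V₂] [AddCommGroup V₃] [Module k V₃]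
    [AddCommGroup V₄] [Module k V₄] [AddCommGroup V₅] [Module k V₅] [AddCommGroup V₆] [Module k V₆]
    [AddCommGroup V₇] [Module k V₇]
    (a : V₀ ≃ₗ[k] V₁) (b : V₁ ⊗[k] V₂ ≃ₗ[k] V₃ ⊗[k] V₄) (c : V₄ ≃ₗ[k] V₅)
    (d : V₀ ⊗[k] V₂ ≃ₗ[k] V₆ ⊗[k] V₇) (e : V₆ ⊗[k] V₇ ≃ₗ[k] V₃ ⊗[k] V₅)
    (h : TensorProduct.map a.symm.toLinearMap LinearMap.id ∘ₗ b.symm.toLinearMap ∘ₗ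
      TensorProduct.map LinearMap.id c.symm.toLinearMap = d.symm.toLinearMap ∘ₗ e.symm.toLinearMap) :
    (TensorProduct.map LinearMap.id c.toLinearMap ∘ₗ b.toLinearMap) ∘ₗ
      TensorProduct.map a.toLinearMap LinearMap.id = e.toLinearMap ∘ₗ d.toLinearMap := by
  let e₁ := TensorProduct.congr a (LinearEquiv.refl k V₂) ≪≫ₗ b ≪≫ₗ
    TensorProduct.congr (LinearEquiv.refl k V₃) c
  let e₂ := d ≪≫ₗ e
  have h : e₁.symm = e₂.symm := LinearEquiv.toLinearMap_injective h
  have h' : e₁ = e₂ := by rw [← e₁.symm_symm, h, e₂.symm_symm]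
  exact congr(($h').toLinearMap)

theorem pentagon_aux' (W : LeftCoaction k B U₀) (X : LeftCoaction k B U₁)
    (Y : LeftCoaction k B U₂) (Z : LeftCoaction k B U₃) :
    (TensorProduct.map LinearMap.id (assocEquiv X Y Z).toLinearMap ∘ₗ
      (assocEquiv W (tens X Y) Z).toLinearMap) ∘ₗ
      TensorProduct.map (assocEquiv W X Y).toLinearMap LinearMap.id =
    (assocEquiv W X (tens Y Z)).toLinearMap ∘ₗ (assocEquiv (tens W X) Y Z).toLinearMap :=
  pentagon_symm _ _ _ _ _ (pentagon_aux W X Y Z)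

theorem triangle_aux' (X : LeftCoaction k B U₁) (Y : LeftCoaction k B U₂) :
    TensorProduct.map LinearMap.id (TensorProduct.lid k U₂).toLinearMap ∘ₗ
      (assocEquiv X (unitCoaction k B) Y).toLinearMap =
    TensorProduct.map (TensorProduct.rid k U₁).toLinearMap LinearMap.id := by
  rw [← triangle_aux X Y, LinearMap.comp_assoc, LinearEquiv.symm_comp, LinearMap.comp_id]

theorem lid_natural (f : U₁ →ₗ[k] U₁') :
    (TensorProduct.lid k U₁').toLinearMap ∘ₗ TensorProduct.map LinearMap.id f =
      f ∘ₗ (TensorProduct.lid k U₁).toLinearMap := by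
  ext; simp

theorem rid_natural (f : U₁ →ₗ[k] U₁') :
    (TensorProduct.rid k U₁').toLinearMap ∘ₗ TensorProduct.map f LinearMap.id =
      f ∘ₗ (TensorProduct.rid k U₁).toLinearMap := by
  ext; simp

end Monoidal

end LeftCoaction

/-! ### The category of finite-dimensional left comodules -/

open LeftCoaction

/-- A finite-dimensional left comodule over the coalgebra `B`. -/
structure FDComod (k : Type u) (B : Type v) [Field k] [AddCommGroup B] [Module k B]
    [Coalgebra k B] where
  /-- the underlying vector space -/
  carrier : Type u
  [addCommGroup : AddCommGroup carrier]
  [module : Module k carrier]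
  [finite : FiniteDimensional k carrier]
  /-- the coaction -/
  coaction : LeftCoaction k B carrier

namespace FDComod

attribute [instance] FDComod.addCommGroup FDComod.module FDComod.finite

section Category

variable {k : Type u} {B : Type v} [Field k] [AddCommGroup B] [Module k B] [Coalgebra k B]

/-- A morphism of left comodules is a colinear map. -/
@[ext]
structure Hom (X Y : FDComod k B) where
  /-- the underlying linear map -/
  toLin : X.carrier →ₗ[k] Y.carrier
  colinear : Y.coaction.coact ∘ₗ toLin =
    TensorProduct.map LinearMap.id toLin ∘ₗ X.coaction.coact

instance : Category.{u} (FDComod k B) where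
  Hom := Hom
  id X := ⟨LinearMap.id, by simp⟩
  comp f g := ⟨g.toLin ∘ₗ f.toLin, by
    have := Compat.comp (g.colinear : Compat _ _ _ _) (f.colinear : Compat _ _ _ _)
    simpa [Compat] using this⟩

@[ext]
theorem hom_ext {X Y : FDComod k B} {f g : X ⟶ Y} (h : f.toLin = g.toLin) : f = g :=
  Hom.ext h

@[simp]
theorem id_toLin (X : FDComod k B) : Hom.toLin (𝟙 X) = LinearMap.id := rfl

@[simp]
theorem comp_toLin {X Y Z : FDComod k B} (f : X ⟶ Y) (g : Y ⟶ Z) :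
    (f ≫ g).toLin = g.toLin ∘ₗ f.toLin := rfl

theorem compat {X Y : FDComod k B} (f : X ⟶ Y) :
    Compat X.coaction Y.coaction LinearMap.id f.toLin := f.colinear

/-- A colinear linear isomorphism is an isomorphism of comodules. -/
def isoMk {X Y : FDComod k B} (e : X.carrier ≃ₗ[k] Y.carrier)
    (h : Compat X.coaction Y.coaction LinearMap.id e.toLinearMap) : X ≅ Y where
  hom := ⟨e.toLinearMap, h⟩
  inv := ⟨e.symm.toLinearMap, Compat.symm h⟩
  hom_inv_id := by ext : 1; simp
  inv_hom_id := by ext : 1; simp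

end Category

section Monoidal

variable {k : Type u} {B : Type v} [Field k] [AddCommGroup B] [Module k B] [CoquasiBialgebra k B]

/-- The tensor product of comodules, with the diagonal coaction. -/
def tensor (X Y : FDComod k B) : FDComod k B where
  carrier := X.carrier ⊗[k] Y.carrier
  coaction := tens X.coaction Y.coaction

variable (k B) in
/-- The unit comodule: the field `k` with the coaction `x ↦ 1 ⊗ x`. -/
def unitObj : FDComod k B where
  carrier := k
  coaction := unitCoaction k B

/-- The tensor product of colinear maps. -/
def tensorMap {X Y X' Y' : FDComod k B} (f : X ⟶ Y) (g : X' ⟶ Y') :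
    tensor X X' ⟶ tensor Y Y' where
  toLin := TensorProduct.map f.toLin g.toLin
  colinear := compat_tens (compat f) (compat g)

instance : MonoidalCategoryStruct (FDComod k B) where
  tensorObj := tensor
  tensorUnit := unitObj k B
  tensorHom f g := tensorMap f g
  whiskerLeft X _ _ g := tensorMap (𝟙 X) g
  whiskerRight f Y := tensorMap f (𝟙 Y)
  associator X Y Z := (isoMk (X := tensor X (tensor Y Z)) (Y := tensor (tensor X Y) Z)
    (assocEquiv X.coaction Y.coaction Z.coaction).symm
    (compat_assocEquiv_symm X.coaction Y.coaction Z.coaction)).symm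
  leftUnitor X := isoMk (X := tensor (unitObj k B) X)
    (TensorProduct.lid k X.carrier) (compat_lid X.coaction)
  rightUnitor X := isoMk (X := tensor X (unitObj k B))
    (TensorProduct.rid k X.carrier) (compat_rid X.coaction)

/-- The monoidal category of finite-dimensional left comodules over a coquasi-bialgebra. -/
instance : MonoidalCategory (FDComod k B) :=
  MonoidalCategory.ofTensorHom
    (id_tensorHom_id := fun _ _ => hom_ext TensorProduct.map_id)
    (id_tensorHom := fun _ _ _ _ => rfl)
    (tensorHom_id := fun _ _ => rfl)
    (tensorHom_comp_tensorHom := fun f₁ f₂ g₁ g₂ =>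
      hom_ext (TensorProduct.map_comp g₁.toLin g₂.toLin f₁.toLin f₂.toLin).symm)
    (associator_naturality := fun f g h =>
      hom_ext (assocEquiv_natural (compat f) (compat g) (compat h)))
    (leftUnitor_naturality := fun f => hom_ext (lid_natural f.toLin))
    (rightUnitor_naturality := fun f => hom_ext (rid_natural f.toLin))
    (pentagon := fun W X Y Z =>
      hom_ext (pentagon_aux' W.coaction X.coaction Y.coaction Z.coaction))
    (triangle := fun X Y => hom_ext (triangle_aux' X.coaction Y.coaction))

end Monoidal

end FDComod

/-! ### Right duals -/

/-- A monoidal category is right rigid if every object `X` has a right dual: an object `X'` with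
morphisms `ev : X ⊗ X' ⟶ 𝟙` and `db : 𝟙 ⟶ X' ⊗ X` satisfying the two triangle identities.
In Mathlib's naming such a triple is an exact pairing of `X'` with `X`. -/
def IsRightRigid (C : Type*) [Category C] [MonoidalCategory C] : Prop :=
  ∀ X : C, ∃ X' : C, Nonempty (ExactPairing X' X)

/-- The morphism `f' : Y' ⟶ X'` between right duals induced by `f : X ⟶ Y`:
`Y' ⟶ (X' ⊗ X) ⊗ Y' ⟶ (X' ⊗ Y) ⊗ Y' ⟶ X' ⊗ (Y ⊗ Y') ⟶ X'`. -/
def rightDualMap {C : Type*} [Category C] [MonoidalCategory C] {X X' Y Y' : C}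
    (p : ExactPairing X' X) (q : ExactPairing Y' Y) (f : X ⟶ Y) : Y' ⟶ X' :=
  @leftAdjointMate C _ _ X Y ⟨X'⟩ ⟨Y'⟩ f

/-- The linear dual of the space underlying `X`, endowed with the coaction `c`. -/
def linearDual {k : Type u} {B : Type v} [Field k] [AddCommGroup B] [Module k B] [Coalgebra k B]
    (X : FDComod k B) (c : LeftCoaction k B (Module.Dual k X.carrier)) : FDComod k B where
  carrier := Module.Dual k X.carrier
  coaction := c

/-- A choice of right duals in the category of finite-dimensional left comodules for which the
dual of `X` is the linear dual of `X` with a suitable coaction, and the dual of a morphism `f` is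
the transpose of `f`. -/
structure LinearDuals (k : Type u) (B : Type v) [Field k] [AddCommGroup B] [Module k B]
    [CoquasiBialgebra k B] where
  /-- the coaction on the linear dual -/
  coaction : ∀ X : FDComod k B, LeftCoaction k B (Module.Dual k X.carrier)
  /-- the evaluation and dual basis morphisms -/
  pairing : ∀ X : FDComod k B, ExactPairing (linearDual X (coaction X)) X
  /-- the dual of a morphism is its transpose -/
  map_eq : ∀ {X Y : FDComod k B} (f : X ⟶ Y),
    (rightDualMap (pairing X) (pairing Y) f).toLin = Module.Dual.transpose (R := k) f.toLin

end CoquasiHopf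
end

/-! Everything rests on reconstruction. Each element of a coalgebra lies in a finite-dimensional
subcomodule, so a natural family `X → N ⊗ X` over all finite-dimensional comodules has the form v ↦
∑ S(v₋₁) ⊗ v₀ for a single linear map S : B → N (`exists_linearMap_of_natural`), and identities
between such maps can be checked on comodules (`ext_of_fdComod`).

The link between duals and preantipodes is the coefficient map E(v ⊗ x) = ∑ ev(v ⊗ x₀) x₋₁ of a
pairing (`evCoeff`); for fixed v it is colinear into the regular comodule. Applying E(v ⊗ –) to the
first leg of db gives an element of B ⊗ X. The mate identities make it natural in X, hence equal to
∑ S(v₋₁) ⊗ v₀. Under this dictionary, colinearity of db is the first preantipode axiom (`coact_db`),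
colinearity of ev the second (`mulCoeff_db`), and the triangle identity on X the third
(`triangle_db`).

Conversely, given S, a dual of X is found inside the cofree comodule B ⊗ X*. The maps v ↦ S(∑ v₋₁
bᵢ*(v₀)) are elements xᵢ of it, and the subcomodule they generate is finite-dimensional. There ev is
the restricted pairing ε(b) f(v), and db = ∑ xᵢ ⊗ bᵢ. The maps E(v ⊗ –) separate points of a cofree
comodule. This lets the coinvariance of db be tested in B, and also yields the second triangle
identity from the first: the zigzag on the dual is a colinear endomorphism absorbed by ev, so it
does not change E and must be the identity (`exists_exactPairing`).

For linear duals the same dictionary splits into three parts (`IsDualData`): s encodes the coaction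
on X*, β the form ev, and α the tensor db, with S = β * s * α the corresponding preantipode. The
axioms of a coquasi-antipode then match the comodule axioms of X*, the colinearity of ev and db, and
the two triangle identities. In the converse direction, requiring dual morphisms to be transposes
makes the three structures dinatural in X, and dinatural pairings on X ⊗ X* are functions of
coefficients (`exists_linearMap_of_dinatural`). -/

noncomputable section

namespace CoquasiHopf

open CoquasiBialgebra LeftCoaction

namespace LeftCoaction

/-! ### Tensors and their slices -/

section Slices

variable {k C M N : Type*} [Field k] [AddCommGroup C] [Module k C]
  [AddCommGroup M] [Module k M] [AddCommGroup N] [Module k N]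

/-- If all slices of `t` lie in `N` then so does the right leg of `t`. -/
theorem mem_range_lTensor_of_forall_slice (N : Submodule k M) (t : C ⊗[k] M)
    (h : ∀ f : C →ₗ[k] k, TensorProduct.lid k M (TensorProduct.map f LinearMap.id t) ∈ N) :
    t ∈ LinearMap.range (TensorProduct.map (LinearMap.id (R := k) (M := C)) N.subtype) := by
  classical
  let b := Module.Basis.ofVectorSpace k C
  obtain ⟨c, hc⟩ := (TensorProduct.equivFinsuppOfBasisLeft (N := M) b).symm.surjective t
  -- The coefficients of `t` along a basis of `C` are its slices by the coordinate functionals.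
  have hcN : ∀ i, c i ∈ N := fun i => by
    have : c i = TensorProduct.equivFinsuppOfBasisLeft b t i := by
      rw [← hc, LinearEquiv.apply_symm_apply]
    rw [this, TensorProduct.equivFinsuppOfBasisLeft_apply]
    exact h _
  rw [← hc, TensorProduct.equivFinsuppOfBasisLeft_symm_apply]
  refine Submodule.sum_mem _ fun i _ => ⟨b i ⊗ₜ ⟨c i, hcN i⟩, rfl⟩

/-- Elements of `N ⊗ M` are separated by the functionals on `M`. -/
theorem tensor_ext_of_slices {t t' : N ⊗[k] M}
    (h : ∀ f : M →ₗ[k] k, TensorProduct.rid k N (TensorProduct.map LinearMap.id f t) =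
      TensorProduct.rid k N (TensorProduct.map LinearMap.id f t')) : t = t' := by
  classical
  let b := Module.Basis.ofVectorSpace k M
  refine (TensorProduct.equivFinsuppOfBasisRight (M := N) b).injective (Finsupp.ext fun i => ?_)
  rw [TensorProduct.equivFinsuppOfBasisRight_apply, TensorProduct.equivFinsuppOfBasisRight_apply]
  exact h _

end Slices

/-! ### Regular and cofree comodules, subcomodules, local finiteness -/

section General

variable {k C M N W : Type*} [Field k] [AddCommGroup C] [Module k C] [Coalgebra k C]
  [AddCommGroup M] [Module k M] [AddCommGroup N] [Module k N] [AddCommGroup W] [Module k W]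

variable (k C) in
/-- A coalgebra as a left comodule over itself. -/
def regular : LeftCoaction k C C where
  coact := comul
  coassoc := Coalgebra.coassoc
  counit_coact := by
    ext x
    exact congr(TensorProduct.lid k C $(Coalgebra.rTensor_counit_comul (R := k) x)).trans
      (TensorProduct.lid_tmul _ _ |>.trans (one_smul _ _))

variable (k C W) in
/-- The cofree comodule on the vector space `W`. -/
def cofree : LeftCoaction k C (C ⊗[k] W) where
  coact := (TensorProduct.assoc k C C W).toLinearMap ∘ₗ TensorProduct.map comul LinearMap.id
  coassoc := by
    refine TensorProduct.ext' fun x w => ?_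
    have h := congr(TensorProduct.map (LinearMap.id (R := k) (M := C))
      (TensorProduct.map LinearMap.id ((TensorProduct.mk k C W).flip w)) 
      $(Coalgebra.coassoc_apply (R := k) x))
    change TensorProduct.assoc k C C (C ⊗[k] W) (TensorProduct.map comul LinearMap.id
        (TensorProduct.assoc k C C W (comul (R := k) x ⊗ₜ w))) =
      TensorProduct.map LinearMap.id ((TensorProduct.assoc k C C W).toLinearMap ∘ₗ
        TensorProduct.map comul LinearMap.id)
        (TensorProduct.assoc k C C W (comul (R := k) x ⊗ₜ w))
    have e1 : ∀ t : C ⊗[k] C, TensorProduct.assoc k C C (C ⊗[k] W)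
        (TensorProduct.map comul LinearMap.id (TensorProduct.assoc k C C W (t ⊗ₜ w))) =
        TensorProduct.map (LinearMap.id (R := k) (M := C))
          (TensorProduct.map LinearMap.id ((TensorProduct.mk k C W).flip w))
          (TensorProduct.assoc k C C C (comul.rTensor C t)) := by
      intro t
      hopf_tensor_induction t with p q
      change TensorProduct.assoc k C C (C ⊗[k] W) (comul p ⊗ₜ (q ⊗ₜ w)) =
        TensorProduct.map (LinearMap.id (R := k) (M := C))
          (TensorProduct.map LinearMap.id ((TensorProduct.mk k C W).flip w))
          (TensorProduct.assoc k C C C (comul p ⊗ₜ q))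
      hopf_tensor_induction comul (R := k) p with a b
      rfl
    have e2 : ∀ t : C ⊗[k] C, TensorProduct.map LinearMap.id
        ((TensorProduct.assoc k C C W).toLinearMap ∘ₗ TensorProduct.map comul LinearMap.id)
        (TensorProduct.assoc k C C W (t ⊗ₜ w)) =
        TensorProduct.map (LinearMap.id (R := k) (M := C))
          (TensorProduct.map LinearMap.id ((TensorProduct.mk k C W).flip w))
          (comul.lTensor C t) := by
      intro t
      hopf_tensor_induction t with p q
      change p ⊗ₜ TensorProduct.assoc k C C W (comul q ⊗ₜ w) =
        p ⊗ₜ TensorProduct.map LinearMap.id ((TensorProduct.mk k C W).flip w) (comul q)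
      congr 1
      hopf_tensor_induction comul (R := k) q with a b
      rfl
    rw [e1, e2, h]
  counit_coact := by
    refine TensorProduct.ext' fun x w => ?_
    change TensorProduct.lid k (C ⊗[k] W) (TensorProduct.map counit LinearMap.id
        (TensorProduct.assoc k C C W (comul (R := k) x ⊗ₜ w))) = x ⊗ₜ w
    have e1 : ∀ t : C ⊗[k] C, TensorProduct.lid k (C ⊗[k] W) (TensorProduct.map counit LinearMap.id
        (TensorProduct.assoc k C C W (t ⊗ₜ w))) =
        TensorProduct.lid k C (counit.rTensor C t) ⊗ₜ w := by
      intro t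
      hopf_tensor_induction t with p q
      exact TensorProduct.smul_tmul' _ _ _
    rw [e1, Coalgebra.rTensor_counit_comul, TensorProduct.lid_tmul, one_smul]

/-- The restriction of a coaction along an injective linear map. -/
def restrict (c : LeftCoaction k C M) (ι : N →ₗ[k] M) (π : M →ₗ[k] N)
    (hπ : π ∘ₗ ι = LinearMap.id)
    (h : TensorProduct.map LinearMap.id (ι ∘ₗ π) ∘ₗ c.coact ∘ₗ ι = c.coact ∘ₗ ι) :
    LeftCoaction k C N where
  coact := TensorProduct.map LinearMap.id π ∘ₗ c.coact ∘ₗ ι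
  coassoc := by
    have h1 : TensorProduct.map LinearMap.id (TensorProduct.map LinearMap.id π ∘ₗ c.coact ∘ₗ ι) ∘ₗ
        TensorProduct.map LinearMap.id π ∘ₗ c.coact ∘ₗ ι =
        TensorProduct.map LinearMap.id (TensorProduct.map LinearMap.id π) ∘ₗ
          (TensorProduct.map LinearMap.id c.coact ∘ₗ c.coact) ∘ₗ ι := by
      -- Stability of the image of `ι` allows the projection `ι ∘ₗ π` to be inserted between the two
      -- coactions.
      conv_rhs => rw [LinearMap.comp_assoc, ← h]
      simp only [← LinearMap.comp_assoc, ← TensorProduct.map_comp, LinearMap.id_comp]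
    have h2 : (TensorProduct.assoc k C C N).toLinearMap ∘ₗ
        TensorProduct.map comul LinearMap.id ∘ₗ TensorProduct.map LinearMap.id π =
        TensorProduct.map LinearMap.id (TensorProduct.map LinearMap.id π) ∘ₗ
        (TensorProduct.assoc k C C M).toLinearMap ∘ₗ TensorProduct.map comul LinearMap.id := by
      refine TensorProduct.ext' fun x m => ?_
      change TensorProduct.assoc k C C N (comul (R := k) x ⊗ₜ π m) =
        TensorProduct.map LinearMap.id (TensorProduct.map LinearMap.id π)
          (TensorProduct.assoc k C C M (comul (R := k) x ⊗ₜ m))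
      hopf_tensor_induction comul (R := k) x with p q
      rfl
    rw [h1, ← c.coassoc]
    have h3 := congr($h2 ∘ₗ c.coact ∘ₗ ι)
    simpa only [LinearMap.comp_assoc] using h3
  counit_coact := by
    have h2 : (TensorProduct.lid k N).toLinearMap ∘ₗ
        TensorProduct.map counit LinearMap.id ∘ₗ TensorProduct.map LinearMap.id π =
        π ∘ₗ (TensorProduct.lid k M).toLinearMap ∘ₗ
          TensorProduct.map (counit (R := k) (A := C)) LinearMap.id := by
      ext; simp
    have h3 := congr($h2 ∘ₗ c.coact ∘ₗ ι)
    have h4 := congr(π ∘ₗ $(c.counit_coact) ∘ₗ ι)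
    simp only [LinearMap.comp_assoc] at h3 h4
    rw [h3, h4, LinearMap.id_comp, hπ]

theorem compat_restrict (c : LeftCoaction k C M) (ι : N →ₗ[k] M) (π : M →ₗ[k] N)
    (hπ : π ∘ₗ ι = LinearMap.id)
    (h : TensorProduct.map LinearMap.id (ι ∘ₗ π) ∘ₗ c.coact ∘ₗ ι = c.coact ∘ₗ ι) :
    Compat (c.restrict ι π hπ h) c LinearMap.id ι := by
  unfold Compat restrict
  rw [← LinearMap.comp_assoc, ← TensorProduct.map_comp, LinearMap.id_comp, h]

/-- A submodule stable under the action of all functionals is a subcomodule. -/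
theorem coact_mem_range_of_stable (c : LeftCoaction k C M) (ι : N →ₗ[k] M) (π : M →ₗ[k] N)
    (hπ : π ∘ₗ ι = LinearMap.id)
    (h : ∀ f, ∀ m ∈ LinearMap.range ι, c.act f m ∈ LinearMap.range ι) :
    TensorProduct.map LinearMap.id (ι ∘ₗ π) ∘ₗ c.coact ∘ₗ ι = c.coact ∘ₗ ι := by
  ext n
  obtain ⟨t, ht⟩ := mem_range_lTensor_of_forall_slice (LinearMap.range ι) (c.coact (ι n))
    fun f => h f _ ⟨n, rfl⟩
  have e : (ι ∘ₗ π) ∘ₗ (LinearMap.range ι).subtype = (LinearMap.range ι).subtype := by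
    ext ⟨_, m, rfl⟩
    exact congr(ι $(LinearMap.congr_fun hπ m))
  change TensorProduct.map LinearMap.id (ι ∘ₗ π) (c.coact (ι n)) = c.coact (ι n)
  rw [← ht, ← LinearMap.comp_apply, ← TensorProduct.map_comp, e, LinearMap.id_comp]

/-- The submodule generated by `W` under the action of the functionals on `C`. -/
def closure (c : LeftCoaction k C M) (W : Submodule k M) : Submodule k M :=
  ⨆ f : C →ₗ[k] k, W.map (c.act f)

theorem le_closure (c : LeftCoaction k C M) (W : Submodule k M) : W ≤ c.closure W := by
  refine le_trans ?_ (le_iSup (fun f : C →ₗ[k] k => W.map (c.act f)) counit)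
  rw [c.act_counit, Submodule.map_id]

/-- The actions of two functionals compose to the action of their convolution, so one round of
actions already yields a stable subspace. -/
theorem act_mem_closure (c : LeftCoaction k C M) (W : Submodule k M) (f : C →ₗ[k] k) (m : M)
    (hm : m ∈ c.closure W) : c.act f m ∈ c.closure W := by
  have key : c.closure W ≤ (c.closure W).comap (c.act f) := by
    refine iSup_le fun g => Submodule.map_le_iff_le_comap.2 fun w hw => ?_
    change (c.act f ∘ₗ c.act g) w ∈ c.closure W
    rw [act_comp_act]
    exact Submodule.mem_iSup_of_mem (leftConv g f) ⟨w, hw, rfl⟩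
  exact key hm

/-- The coactions of finitely many generators of `W` involve only finitely many vectors of `M` in
their right legs, and every action of a functional stays in the span `M'` of those vectors. -/
theorem finite_closure (c : LeftCoaction k C M) (W : Submodule k M) [FiniteDimensional k W] :
    FiniteDimensional k (c.closure W) := by
  obtain ⟨s, hs⟩ := (Module.Finite.iff_fg (N := W)).1 inferInstance
  obtain ⟨M', hM', hs'⟩ := TensorProduct.exists_finite_submodule_right_of_setFinite
    (c.coact '' (s : Set M)) (s.finite_toSet.image _)
  have : c.closure W ≤ M' := by
    refine iSup_le fun f => ?_
    rw [← hs, Submodule.map_span, Submodule.span_le]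
    rintro _ ⟨m, hm, rfl⟩
    obtain ⟨t, ht⟩ := hs' ⟨m, hm, rfl⟩
    change TensorProduct.lid k M (TensorProduct.map f LinearMap.id (c.coact m)) ∈ M'
    rw [← ht]
    have e : ∀ t : C ⊗[k] M', TensorProduct.lid k M (TensorProduct.map f LinearMap.id
        (M'.subtype.lTensor C t)) ∈ M' := by
      intro t
      induction t with
      | zero => simp
      | tmul x y => simpa using M'.smul_mem (f x) y.2
      | add a b ha hb => simpa only [map_add] using M'.add_mem ha hb
    exact e t
  have := Submodule.finrank_mono (s := c.closure W) (t := M')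
  exact Submodule.finiteDimensional_of_le ‹_›

end General

section FundamentalTheorem

variable {k : Type u} {C : Type v} {M : Type*} [Field k] [AddCommGroup C] [Module k C]
  [Coalgebra k C] [AddCommGroup M] [Module k M]

/-- A finite-dimensional subspace of a comodule is contained in a finite-dimensional
subcomodule. -/
theorem exists_fdComod (c : LeftCoaction k C M) (W : Submodule k M) [FiniteDimensional k W] :
    ∃ (X : FDComod k C) (ι : X.carrier →ₗ[k] M) (π : M →ₗ[k] X.carrier),
      π ∘ₗ ι = LinearMap.id ∧ Compat X.coaction c LinearMap.id ι ∧
      LinearMap.range ι = c.closure W := by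
  have := c.finite_closure W
  -- The carrier of an `FDComod` must live in the universe of `k`, whereas `M` may not; the
  -- subcomodule is therefore modelled on `Fin n → k`.
  let e := (Module.finBasis k (c.closure W)).equivFun
  let ι : (Fin (Module.finrank k (c.closure W)) → k) →ₗ[k] M :=
    (c.closure W).subtype ∘ₗ e.symm.toLinearMap
  have hι : LinearMap.ker ι = ⊥ := LinearMap.ker_eq_bot.2
    (Subtype.val_injective.comp e.symm.injective)
  obtain ⟨π, hπ⟩ := LinearMap.exists_leftInverse_of_injective ι hι
  have hr : LinearMap.range ι = c.closure W := by
    simp [ι, LinearMap.range_comp]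
  have hs := coact_mem_range_of_stable c ι π hπ (by rw [hr]; exact act_mem_closure c W)
  exact ⟨⟨_, c.restrict ι π hπ hs⟩, ι, π, hπ, compat_restrict c ι π hπ hs, hr⟩

end FundamentalTheorem

/-! ### Reconstruction of linear maps from natural transformations -/

section Reconstruction

variable {k : Type u} {C : Type v} {N : Type*} [Field k] [AddCommGroup C] [Module k C]
  [Coalgebra k C] [AddCommGroup N] [Module k N]

/-- The coefficient map `v ↦ ∑ f(v₀) v₋₁` of a functional `f` on a comodule. -/
def coeff {M : Type*} [AddCommGroup M] [Module k M] (c : LeftCoaction k C M) (f : M →ₗ[k] k) :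
    M →ₗ[k] C :=
  (TensorProduct.rid k C).toLinearMap ∘ₗ TensorProduct.map LinearMap.id f ∘ₗ c.coact

/-- This is coassociativity of `c` with `f` applied to the last leg. It supplies the colinear maps
into the coalgebra on which reconstruction operates. -/
theorem compat_coeff {M : Type*} [AddCommGroup M] [Module k M] (c : LeftCoaction k C M)
    (f : M →ₗ[k] k) : Compat c (regular k C) LinearMap.id (c.coeff f) := by
  have e1 : comul ∘ₗ (TensorProduct.rid k C).toLinearMap ∘ₗ TensorProduct.map LinearMap.id f =
      TensorProduct.map LinearMap.id ((TensorProduct.rid k C).toLinearMap ∘ₗ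
        TensorProduct.map LinearMap.id f) ∘ₗ
      (TensorProduct.assoc k C C M).toLinearMap ∘ₗ TensorProduct.map comul LinearMap.id := by
    refine TensorProduct.ext' fun x m => ?_
    change comul (R := k) (f m • x) = TensorProduct.map LinearMap.id
      ((TensorProduct.rid k C).toLinearMap ∘ₗ TensorProduct.map LinearMap.id f)
      (TensorProduct.assoc k C C M (comul (R := k) x ⊗ₜ m))
    rw [map_smul]
    induction comul (R := k) x with
    | zero => simp
    | tmul p q => exact (TensorProduct.tmul_smul _ _ _).symm
    | add a b ha hb => simp only [smul_add, add_tmul, map_add, ha, hb]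
  refine LinearMap.ext fun m => ?_
  have h1 := LinearMap.congr_fun e1 (c.coact m)
  have h2 := LinearMap.congr_fun c.coassoc m
  have h3 := LinearMap.congr_fun (TensorProduct.map_comp (LinearMap.id (R := k) (M := C))
    ((TensorProduct.rid k C).toLinearMap ∘ₗ TensorProduct.map LinearMap.id f) LinearMap.id
    c.coact) (c.coact m)
  simp only [LinearMap.comp_apply] at h1 h2 h3
  refine h1.trans (Eq.trans ?_ h3.symm)
  exact congr(TensorProduct.map LinearMap.id ((TensorProduct.rid k C).toLinearMap ∘ₗ
    TensorProduct.map LinearMap.id f) $h2)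

theorem counit_comp_coeff {M : Type*} [AddCommGroup M] [Module k M] (c : LeftCoaction k C M)
    (f : M →ₗ[k] k) : counit ∘ₗ c.coeff f = f := by
  have e1 : counit ∘ₗ (TensorProduct.rid k C).toLinearMap ∘ₗ TensorProduct.map LinearMap.id f =
      f ∘ₗ (TensorProduct.lid k M).toLinearMap ∘ₗ
        TensorProduct.map (counit (R := k) (A := C)) LinearMap.id := by
    ext; simp [mul_comm]
  have h := congr($e1 ∘ₗ c.coact)
  simp only [LinearMap.comp_assoc] at h
  rw [c.counit_coact, LinearMap.comp_id] at h
  exact h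

/-- A colinear map whose image lies in the image of an injective colinear map factors. -/
theorem exists_lift {M : Type*} [AddCommGroup M] [Module k M] {c : LeftCoaction k C M}
    {X Z : FDComod k C} {f : X.carrier →ₗ[k] M} {ι : Z.carrier →ₗ[k] M}
    (hf : Compat X.coaction c LinearMap.id f) (hι : Compat Z.coaction c LinearMap.id ι)
    {π : M →ₗ[k] Z.carrier} (hπ : π ∘ₗ ι = LinearMap.id)
    (h : LinearMap.range f ≤ LinearMap.range ι) : ∃ g : X ⟶ Z, ι ∘ₗ g.toLin = f := by
  have h1 : ι ∘ₗ π ∘ₗ f = f := by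
    ext x
    obtain ⟨z, hz⟩ := h ⟨x, rfl⟩
    simp only [LinearMap.comp_apply, ← hz]
    exact congr(ι $(LinearMap.congr_fun hπ z))
  refine ⟨⟨π ∘ₗ f, ?_⟩, h1⟩
  -- Since `ι` is colinear with retraction `π`, the coaction of `Z` is recovered from that of `M`;
  -- this makes `π ∘ₗ f` colinear although `π` need not be.
  have h2 : Z.coaction.coact =
      TensorProduct.map LinearMap.id π ∘ₗ c.coact ∘ₗ ι := by
    rw [hι, ← LinearMap.comp_assoc, ← TensorProduct.map_comp, hπ, LinearMap.id_comp,
      TensorProduct.map_id, LinearMap.id_comp]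
  rw [h2, LinearMap.comp_assoc, LinearMap.comp_assoc, h1, hf, ← LinearMap.comp_assoc,
    ← TensorProduct.map_comp, LinearMap.id_comp]

/-- Every finite family in a coalgebra lies in a finite-dimensional left coideal. -/
theorem exists_fdComod_regular (W : Submodule k C) [FiniteDimensional k W] :
    ∃ (X : FDComod k C) (ι : X.carrier →ₗ[k] C) (π : C →ₗ[k] X.carrier),
      π ∘ₗ ι = LinearMap.id ∧ Compat X.coaction (regular k C) LinearMap.id ι ∧
      W ≤ LinearMap.range ι := by
  obtain ⟨X, ι, π, h1, h2, h3⟩ := exists_fdComod (regular k C) W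
  exact ⟨X, ι, π, h1, h2, h3 ▸ le_closure _ _⟩

/-- Linear maps on a coalgebra agree if the maps they induce on all finite-dimensional comodules
agree. -/
theorem ext_of_fdComod {L R : C →ₗ[k] N}
    (h : ∀ X : FDComod k C, TensorProduct.map L LinearMap.id ∘ₗ X.coaction.coact =
      TensorProduct.map R LinearMap.id ∘ₗ X.coaction.coact) : L = R := by
  ext b
  obtain ⟨X, ι, π, -, hι, hb⟩ := exists_fdComod_regular (k := k) (k ∙ b)
  obtain ⟨x, rfl⟩ := hb (Submodule.mem_span_singleton_self b)
  -- Counitality: ∑ L(x₋₁) ε(ι(x₀)) = L(ι(x)), so the induced map on `X` determines `L` at `ι x`.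
  have e : ∀ L : C →ₗ[k] N, L (ι x) = TensorProduct.rid k N
      (TensorProduct.map LinearMap.id (counit ∘ₗ ι)
        (TensorProduct.map L LinearMap.id (X.coaction.coact x))) := by
    intro L
    have e1 : ∀ t, TensorProduct.rid k N (TensorProduct.map LinearMap.id (counit ∘ₗ ι)
        (TensorProduct.map L LinearMap.id t)) =
        L (TensorProduct.rid k C (TensorProduct.map LinearMap.id (counit (R := k))
          (TensorProduct.map LinearMap.id ι t))) := by
      intro t
      hopf_tensor_induction t with p q
      simp
    have e2 : comul (R := k) (ι x) = TensorProduct.map LinearMap.id ι (X.coaction.coact x) :=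
      LinearMap.congr_fun hι x
    have e3 : TensorProduct.map LinearMap.id (counit (R := k)) (comul (R := k) (ι x)) =
      ι x ⊗ₜ (1 : k) := Coalgebra.lTensor_counit_comul (R := k) (ι x)
    rw [e1, ← e2, e3]
    simp
  rw [e L, e R]
  exact congr(TensorProduct.rid k N (TensorProduct.map LinearMap.id (counit ∘ₗ ι)
    $(LinearMap.congr_fun (h X) x)))

section Natural

variable (σ : ∀ X : FDComod k C, X.carrier →ₗ[k] N ⊗[k] X.carrier)

/-- The value of a natural transformation on a coefficient. -/
def coeffValue (X : FDComod k C) (ι : X.carrier →ₗ[k] C) : X.carrier →ₗ[k] N :=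
  (TensorProduct.rid k N).toLinearMap ∘ₗ TensorProduct.map LinearMap.id (counit ∘ₗ ι) ∘ₗ σ X

variable (hσ : ∀ (X Y : FDComod k C) (f : X ⟶ Y),
  σ Y ∘ₗ f.toLin = TensorProduct.map LinearMap.id f.toLin ∘ₗ σ X)

include hσ

theorem coeffValue_comp {X Z : FDComod k C} (g : X ⟶ Z) (ζ : Z.carrier →ₗ[k] C) :
    coeffValue σ Z ζ ∘ₗ g.toLin = coeffValue σ X (ζ ∘ₗ g.toLin) := by
  unfold coeffValue
  rw [LinearMap.comp_assoc, LinearMap.comp_assoc, hσ, ← LinearMap.comp_assoc (σ X),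
    ← TensorProduct.map_comp, LinearMap.id_comp, LinearMap.comp_assoc]

/-- Well-definedness of the reconstructed map: both colinear maps factor through one
finite-dimensional subcomodule `Z` of `C`, where `x` and `y` have the same image, and naturality of
`σ` transports the values to `Z`. Injectivity of `ι` and `κ` is not required, so coefficient maps
qualify. -/
theorem coeffValue_eq {X Y : FDComod k C} {ι : X.carrier →ₗ[k] C} {κ : Y.carrier →ₗ[k] C}
    (hι : Compat X.coaction (regular k C) LinearMap.id ι)
    (hκ : Compat Y.coaction (regular k C) LinearMap.id κ) {x : X.carrier} {y : Y.carrier}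
    (h : ι x = κ y) : coeffValue σ X ι x = coeffValue σ Y κ y := by
  obtain ⟨Z, ζ, π, hπ, hζ, hr⟩ := exists_fdComod_regular (LinearMap.range ι ⊔ LinearMap.range κ)
  obtain ⟨i, hi⟩ := exists_lift hι hζ hπ (le_sup_left.trans hr)
  obtain ⟨j, hj⟩ := exists_lift hκ hζ hπ (le_sup_right.trans hr)
  rw [← hi, ← hj, ← coeffValue_comp σ hσ, ← coeffValue_comp σ hσ]
  have : i.toLin x = j.toLin y := by
    have h' : ζ (i.toLin x) = ζ (j.toLin y) := by
      rw [← LinearMap.comp_apply, ← LinearMap.comp_apply, hi, hj, h]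
    exact (Function.LeftInverse.injective (g := π) (LinearMap.congr_fun hπ)) h'
  exact congr(coeffValue σ Z ζ $this)

/-- Natural transformations `X → N ⊗ X` on finite-dimensional comodules are induced by linear
maps `C → N`. -/
theorem exists_linearMap_of_natural :
    ∃ S : C →ₗ[k] N, ∀ X : FDComod k C,
      σ X = TensorProduct.map S LinearMap.id ∘ₗ X.coaction.coact := by
  -- If σ is v ↦ ∑ S(v₋₁) ⊗ v₀, then (id ⊗ ε ∘ ι) σ(x) = S(ι(x)); this dictates the value of `S` at
  -- `b`.
  have hex : ∀ b : C, ∃ n : N, ∀ (X : FDComod k C) (ι : X.carrier →ₗ[k] C),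
      Compat X.coaction (regular k C) LinearMap.id ι → ∀ x, ι x = b →
      coeffValue σ X ι x = n := by
    intro b
    obtain ⟨Z, ζ, -, -, hζ, hb⟩ := exists_fdComod_regular (k := k) (k ∙ b)
    obtain ⟨z, hz⟩ := hb (Submodule.mem_span_singleton_self b)
    exact ⟨coeffValue σ Z ζ z, fun X ι hι x hx => coeffValue_eq σ hσ hι hζ (hx.trans hz.symm)⟩
  choose S hS using hex
  have hadd : ∀ b b', S (b + b') = S b + S b' := by
    intro b b'
    obtain ⟨Z, ζ, -, -, hζ, hr⟩ := exists_fdComod_regular (k := k) ((k ∙ b) ⊔ (k ∙ b'))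
    obtain ⟨z, rfl⟩ := hr (Submodule.mem_sup_left (Submodule.mem_span_singleton_self b))
    obtain ⟨z', rfl⟩ := hr (Submodule.mem_sup_right (Submodule.mem_span_singleton_self b'))
    rw [← hS _ Z ζ hζ z rfl, ← hS _ Z ζ hζ z' rfl, ← hS _ Z ζ hζ (z + z') (map_add _ _ _), map_add]
  have hsmul : ∀ (a : k) b, S (a • b) = a • S b := by
    intro a b
    obtain ⟨Z, ζ, -, -, hζ, hr⟩ := exists_fdComod_regular (k := k) (k ∙ b)
    obtain ⟨z, rfl⟩ := hr (Submodule.mem_span_singleton_self b)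
    rw [← hS _ Z ζ hζ z rfl, ← hS _ Z ζ hζ (a • z) (map_smul _ _ _), map_smul]
  -- Slicing by `f` amounts to choosing the colinear map `coeff f`, because ε ∘ `coeff f` = `f`.
  refine ⟨⟨⟨S, hadd⟩, hsmul⟩, fun X => LinearMap.ext fun x => tensor_ext_of_slices fun f => ?_⟩
  have h1 := hS _ X (X.coaction.coeff f) (X.coaction.compat_coeff f) x rfl
  rw [coeffValue, counit_comp_coeff] at h1
  refine Eq.trans h1 ?_
  have e : ∀ t, S (TensorProduct.rid k C (TensorProduct.map LinearMap.id f t)) =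
      TensorProduct.rid k N (TensorProduct.map LinearMap.id f
        (TensorProduct.map (LinearMap.mk ⟨S, hadd⟩ hsmul) LinearMap.id t)) := by
    intro t
    induction t with
    | zero => simpa using hsmul 0 0
    | tmul p q => simpa using hsmul _ _
    | add a b ha hb => simp only [map_add, hadd, ha, hb]
  exact e _

end Natural

end Reconstruction

end LeftCoaction

namespace LeftCoaction

/-! ### Coefficient maps of pairings, and duality expressed through them -/

section Pairing

variable {k B U U' U'' : Type*} [Field k] [AddCommGroup B] [Module k B]
  [AddCommGroup U] [Module k U] [AddCommGroup U'] [Module k U'] [AddCommGroup U''] [Module k U'']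

theorem map_assoc_symm_tmul {N V : Type*} [AddCommGroup N] [Module k N] [AddCommGroup V]
    [Module k V] (E : U ⊗[k] U' →ₗ[k] N) (v : U) (t : U' ⊗[k] V) :
    TensorProduct.map E LinearMap.id ((TensorProduct.assoc k U U' V).symm (v ⊗ₜ t)) =
      TensorProduct.map (TensorProduct.curry E v) LinearMap.id t := by
  induction t with
  | zero => simp
  | add a b ha hb => simp only [tmul_add, map_add, ha, hb]
  | tmul x y => rfl

section Coalg

variable [Coalgebra k B]

/-- The coefficient map `v ⊗ x ↦ ∑ τ(v ⊗ x₀) x₋₁` of a pairing `τ`. -/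
def evCoeff (X' : LeftCoaction k B U') (τ : U ⊗[k] U' →ₗ[k] k) : U ⊗[k] U' →ₗ[k] B :=
  (TensorProduct.rid k B).toLinearMap ∘ₗ TensorProduct.map LinearMap.id τ ∘ₗ
    (TensorProduct.leftComm k U B U').toLinearMap ∘ₗ TensorProduct.map LinearMap.id X'.coact

/-- Coassociativity of `X'` with `τ` applied to the last leg: Δ E(v ⊗ x) = ∑ x₋₁ ⊗ E(v ⊗ x₀). No
coaction on `U` enters. -/
theorem comul_evCoeff (X' : LeftCoaction k B U') (τ : U ⊗[k] U' →ₗ[k] k) :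
    comul ∘ₗ evCoeff X' τ = TensorProduct.map LinearMap.id (evCoeff X' τ) ∘ₗ
      (TensorProduct.leftComm k U B U').toLinearMap ∘ₗ
      TensorProduct.map LinearMap.id X'.coact := by
  refine TensorProduct.ext' fun v x => ?_
  change comul (R := k) (TensorProduct.rid k B (TensorProduct.map LinearMap.id τ
      (TensorProduct.leftComm k U B U' (v ⊗ₜ X'.coact x)))) =
    TensorProduct.map LinearMap.id (evCoeff X' τ)
      (TensorProduct.leftComm k U B U' (v ⊗ₜ X'.coact x))
  have e1 : ∀ t, comul (R := k) (TensorProduct.rid k B (TensorProduct.map LinearMap.id τ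
      (TensorProduct.leftComm k U B U' (v ⊗ₜ t)))) =
      TensorProduct.map LinearMap.id ((TensorProduct.rid k B).toLinearMap ∘ₗ
        TensorProduct.map LinearMap.id (TensorProduct.curry τ v))
        (TensorProduct.assoc k B B U' (TensorProduct.map comul LinearMap.id t)) := by
    intro t
    hopf_tensor_induction t with c y
    change comul (R := k) (τ (v ⊗ₜ y) • c) = TensorProduct.map LinearMap.id
      ((TensorProduct.rid k B).toLinearMap ∘ₗ
        TensorProduct.map LinearMap.id (TensorProduct.curry τ v))
      (TensorProduct.assoc k B B U' (comul (R := k) c ⊗ₜ y))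
    rw [map_smul]
    induction comul (R := k) c with
    | zero => simp
    | tmul p q => exact (TensorProduct.tmul_smul _ _ _).symm
    | add a b ha hb => simp only [smul_add, add_tmul, map_add, ha, hb]
  have e2 : ∀ t, TensorProduct.map LinearMap.id (evCoeff X' τ)
      (TensorProduct.leftComm k U B U' (v ⊗ₜ t)) =
      TensorProduct.map LinearMap.id ((TensorProduct.rid k B).toLinearMap ∘ₗ
        TensorProduct.map LinearMap.id (TensorProduct.curry τ v))
        (TensorProduct.map LinearMap.id X'.coact t) := by
    intro t
    hopf_tensor_induction t with c y
    change c ⊗ₜ TensorProduct.rid k B (TensorProduct.map LinearMap.id τ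
        (TensorProduct.leftComm k U B U' (v ⊗ₜ X'.coact y))) =
      c ⊗ₜ TensorProduct.rid k B (TensorProduct.map LinearMap.id (TensorProduct.curry τ v)
        (X'.coact y))
    congr 1
    hopf_tensor_induction X'.coact y with p q
    rfl
  rw [e1, e2]
  exact congr(TensorProduct.map LinearMap.id ((TensorProduct.rid k B).toLinearMap ∘ₗ
        TensorProduct.map LinearMap.id (TensorProduct.curry τ v))
        $(LinearMap.congr_fun X'.coassoc x))

theorem counit_evCoeff (X' : LeftCoaction k B U') (τ : U ⊗[k] U' →ₗ[k] k) :
    counit ∘ₗ evCoeff X' τ = τ := by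
  refine TensorProduct.ext' fun v x => ?_
  have e1 : ∀ t, counit (R := k) (TensorProduct.rid k B (TensorProduct.map LinearMap.id τ
      (TensorProduct.leftComm k U B U' (v ⊗ₜ t)))) =
      τ (v ⊗ₜ TensorProduct.lid k U' (TensorProduct.map counit LinearMap.id t)) := by
    intro t
    induction t with
    | zero => simp
    | tmul c y => simp [mul_comm]
    | add a b ha hb => simp only [tmul_add, map_add, ha, hb]
  exact (e1 _).trans congr(τ (v ⊗ₜ $(LinearMap.congr_fun X'.counit_coact x)))

theorem map_curry_evCoeff_comp_coact (X' : LeftCoaction k B U') (τ : U ⊗[k] U' →ₗ[k] k) (v : U) :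
    TensorProduct.map LinearMap.id (TensorProduct.curry (evCoeff X' τ) v) ∘ₗ X'.coact =
      comul ∘ₗ TensorProduct.curry (evCoeff X' τ) v := by
  refine LinearMap.ext fun x => Eq.trans ?_ (LinearMap.congr_fun (comul_evCoeff X' τ) (v ⊗ₜ x)).symm
  change _ = TensorProduct.map LinearMap.id (evCoeff X' τ)
    (TensorProduct.leftComm k U B U' (v ⊗ₜ X'.coact x))
  change TensorProduct.map LinearMap.id (TensorProduct.curry (evCoeff X' τ) v) (X'.coact x) = _
  hopf_tensor_induction X'.coact x with p q
  rfl

theorem curry_evCoeff_apply (X' : LeftCoaction k B U') (τ : U ⊗[k] U' →ₗ[k] k) (v : U) (x : U') :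
    evCoeff X' τ (v ⊗ₜ x) = TensorProduct.rid k B
      (TensorProduct.map LinearMap.id (TensorProduct.curry τ v) (X'.coact x)) := by
  change TensorProduct.rid k B (TensorProduct.map LinearMap.id τ
    (TensorProduct.leftComm k U B U' (v ⊗ₜ X'.coact x))) = _
  hopf_tensor_induction X'.coact x with p q
  rfl

/-- Colinearity of `g` is exactly what lets it pass through the coaction; in the other variable
(`evCoeff_map_left`) any linear map is allowed. -/
theorem evCoeff_comp {X' : LeftCoaction k B U'} {X'' : LeftCoaction k B U''}
    {g : U' →ₗ[k] U''} (hg : Compat X' X'' LinearMap.id g) (τ : U ⊗[k] U'' →ₗ[k] k) :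
    evCoeff X' (τ ∘ₗ TensorProduct.map LinearMap.id g) =
      evCoeff X'' τ ∘ₗ TensorProduct.map LinearMap.id g := by
  refine TensorProduct.ext' fun v x => ?_
  change TensorProduct.rid k B (TensorProduct.map LinearMap.id
      (τ ∘ₗ TensorProduct.map LinearMap.id g)
      (TensorProduct.leftComm k U B U' (v ⊗ₜ X'.coact x))) =
    TensorProduct.rid k B (TensorProduct.map LinearMap.id τ
      (TensorProduct.leftComm k U B U'' (v ⊗ₜ X''.coact (g x))))
  rw [show X''.coact (g x) = _ from LinearMap.congr_fun hg x, LinearMap.comp_apply]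
  induction X'.coact x with
  | zero => simp
  | tmul c y => rfl
  | add a b ha hb => simp only [tmul_add, map_add, ha, hb]

theorem evCoeff_map_left {V : Type*} [AddCommGroup V] [Module k V] (X' : LeftCoaction k B U')
    (f : U →ₗ[k] V) (τ : V ⊗[k] U' →ₗ[k] k) :
    evCoeff X' (τ ∘ₗ TensorProduct.map f LinearMap.id) =
      evCoeff X' τ ∘ₗ TensorProduct.map f LinearMap.id := by
  refine TensorProduct.ext' fun v x => ?_
  change TensorProduct.rid k B (TensorProduct.map LinearMap.id
      (τ ∘ₗ TensorProduct.map f LinearMap.id)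
      (TensorProduct.leftComm k U B U' (v ⊗ₜ X'.coact x))) =
    TensorProduct.rid k B (TensorProduct.map LinearMap.id τ
      (TensorProduct.leftComm k V B U' (f v ⊗ₜ X'.coact x)))
  induction X'.coact x with
  | zero => simp
  | tmul c y => rfl
  | add a b ha hb => simp only [tmul_add, map_add, ha, hb]

/-- The iterated coaction in terms of the iterated comultiplication. -/
theorem act_comul_comul (X : LeftCoaction k B U) (Φ : B ⊗[k] (B ⊗[k] B) →ₗ[k] k) (v : U) :
    X.act (Φ ∘ₗ TensorProduct.map LinearMap.id comul ∘ₗ comul) v =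
      TensorProduct.lid k U (TensorProduct.map Φ LinearMap.id
        ((TensorProduct.assoc k B (B ⊗[k] B) U).symm
          (TensorProduct.map LinearMap.id ((TensorProduct.assoc k B B U).symm.toLinearMap ∘ₗ
            TensorProduct.map LinearMap.id X.coact ∘ₗ X.coact) (X.coact v)))) := by
  rw [← X.coassoc]
  have e1 : (TensorProduct.assoc k B B U).symm.toLinearMap ∘ₗ
      (TensorProduct.assoc k B B U).toLinearMap ∘ₗ
      TensorProduct.map comul LinearMap.id ∘ₗ X.coact =
      TensorProduct.map comul LinearMap.id ∘ₗ X.coact := by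
    rw [← LinearMap.comp_assoc, LinearEquiv.symm_comp, LinearMap.id_comp]
  have e2 : TensorProduct.map LinearMap.id (TensorProduct.map comul LinearMap.id ∘ₗ X.coact)
      (X.coact v) = TensorProduct.map LinearMap.id (TensorProduct.map comul LinearMap.id)
        (TensorProduct.assoc k B B U (TensorProduct.map comul LinearMap.id (X.coact v))) := by
    rw [show TensorProduct.assoc k B B U (TensorProduct.map comul LinearMap.id (X.coact v)) = _
      from LinearMap.congr_fun X.coassoc v, LinearMap.comp_apply, TensorProduct.map_map,
      LinearMap.id_comp]
  rw [e1, e2]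
  refine congr(TensorProduct.lid k U $(?_))
  change TensorProduct.map _ LinearMap.id (X.coact v) = _
  induction X.coact v with
  | zero => simp
  | add a b ha hb => simp only [map_add, ha, hb]
  | tmul c w =>
    change Φ (TensorProduct.map LinearMap.id comul (comul (R := k) c)) ⊗ₜ w =
      TensorProduct.map Φ LinearMap.id ((TensorProduct.assoc k B (B ⊗[k] B) U).symm
        (TensorProduct.map LinearMap.id (TensorProduct.map comul LinearMap.id)
          (TensorProduct.assoc k B B U (comul (R := k) c ⊗ₜ w))))
    hopf_tensor_induction comul (R := k) c with p q
    rfl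

theorem ext_act {k : Type u} {B : Type v} [Field k] [AddCommGroup B] [Module k B]
    [Coalgebra k B] {f g : B →ₗ[k] k}
    (h : ∀ (X : FDComod k B) (v : X.carrier), X.coaction.act f v = X.coaction.act g v) :
    f = g :=
  ext_of_fdComod fun X => LinearMap.ext fun v => (TensorProduct.lid k X.carrier).injective (h X v)

end Coalg

section Tens

variable [CoquasiBialgebra k B]

/-- `h ↦ ∑ S(h₁) h₂`, the product being taken in the first leg of `B ⊗ N`. -/
def leftTwist {N : Type*} [AddCommGroup N] [Module k N] (S : B →ₗ[k] B ⊗[k] N) :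
    B →ₗ[k] B ⊗[k] N :=
  TensorProduct.map (mul (k := k) (B := B)).toLinearMap LinearMap.id ∘ₗ
    (TensorProduct.rightComm k B N B).toLinearMap ∘ₗ TensorProduct.map S LinearMap.id ∘ₗ comul

/-- Testing the dual leg of `db` with `τ` replaces the coaction of X' by `S`, after which
coassociativity of `X` gathers both factors of the product into one function of v₋₁. With `τ` = E(v
⊗ –) and Δ ∘ S in place of `S` this produces the left side of the first preantipode axiom; with `τ`
the evaluation at v it produces ∑ s(h₁) α(h₂) h₃. -/
theorem coact_db {N : Type*} [AddCommGroup N] [Module k N] (X : LeftCoaction k B U)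
    (X' : LeftCoaction k B U') (τ : U' →ₗ[k] N) (S : B →ₗ[k] B ⊗[k] N) (db : U' ⊗[k] U) (v : U)
    (hs : TensorProduct.map (TensorProduct.map LinearMap.id τ ∘ₗ X'.coact) LinearMap.id db =
      TensorProduct.map S LinearMap.id (X.coact v)) :
    TensorProduct.map LinearMap.id (TensorProduct.map τ LinearMap.id) ((tens X' X).coact db) =
      TensorProduct.assoc k B N U
        (TensorProduct.map (leftTwist S) LinearMap.id (X.coact v)) := by
  -- `Γ` sends (b ⊗ n) ⊗ (b' ⊗ u) to bb' ⊗ (n ⊗ u).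
  let Γ : (B ⊗[k] N) ⊗[k] (B ⊗[k] U) →ₗ[k] B ⊗[k] (N ⊗[k] U) :=
    (TensorProduct.assoc k B N U).toLinearMap ∘ₗ
      TensorProduct.map (TensorProduct.map (mul (k := k) (B := B)).toLinearMap LinearMap.id ∘ₗ
        (TensorProduct.rightComm k B N B).toLinearMap) LinearMap.id ∘ₗ
      (TensorProduct.assoc k (B ⊗[k] N) B U).symm.toLinearMap
  have e1 : TensorProduct.map LinearMap.id (TensorProduct.map τ LinearMap.id) ∘ₗ
      (tens X' X).coact = Γ ∘ₗ TensorProduct.map LinearMap.id X.coact ∘ₗ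
        TensorProduct.map (TensorProduct.map LinearMap.id τ ∘ₗ X'.coact) LinearMap.id := by
    refine TensorProduct.ext' fun x y => ?_
    change TensorProduct.map LinearMap.id (TensorProduct.map τ LinearMap.id)
      (TensorProduct.map (mul (k := k) (B := B)).toLinearMap LinearMap.id
        (TensorProduct.tensorTensorTensorComm k B U' B U (X'.coact x ⊗ₜ X.coact y))) =
      Γ (TensorProduct.map LinearMap.id τ (X'.coact x) ⊗ₜ X.coact y)
    hopf_tensor_induction X'.coact x with p q
    hopf_tensor_induction X.coact y with p' q'
    rfl
  have e2 : ∀ t : B ⊗[k] U, Γ (TensorProduct.map S LinearMap.id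
      (TensorProduct.assoc k B B U (TensorProduct.map comul LinearMap.id t))) =
      TensorProduct.assoc k B N U (TensorProduct.map (leftTwist S) LinearMap.id t) := by
    intro t
    hopf_tensor_induction t with c w
    change Γ (TensorProduct.map S LinearMap.id
      (TensorProduct.assoc k B B U (comul (R := k) c ⊗ₜ w))) =
      TensorProduct.assoc k B N U ((TensorProduct.map
        (mul (k := k) (B := B)).toLinearMap LinearMap.id (TensorProduct.rightComm k B N B
          (TensorProduct.map S LinearMap.id (comul (R := k) c)))) ⊗ₜ w)
    hopf_tensor_induction comul (R := k) c with p q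
    rfl
  have e3 : TensorProduct.map LinearMap.id X.coact (TensorProduct.map S LinearMap.id
      (X.coact v)) = TensorProduct.map S LinearMap.id
        (TensorProduct.map LinearMap.id X.coact (X.coact v)) := by
    rw [TensorProduct.map_map, TensorProduct.map_map]
    rfl
  have e4 : TensorProduct.assoc k B B U (TensorProduct.map comul LinearMap.id (X.coact v)) =
      TensorProduct.map LinearMap.id X.coact (X.coact v) := LinearMap.congr_fun X.coassoc v
  refine (LinearMap.congr_fun e1 db).trans ?_
  rw [← e2, e4, ← e3, ← hs]
  rfl

/-- `(b ⊗ w) ⊗ x ↦ ∑ b ⟨w, x⟩` where `⟨ , ⟩` is the coefficient map of a pairing. -/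
def mulCoeff (E : U ⊗[k] U' →ₗ[k] B) : (B ⊗[k] U) ⊗[k] U' →ₗ[k] B :=
  (mul (k := k) (B := B)).toLinearMap ∘ₗ TensorProduct.map LinearMap.id E ∘ₗ
    (TensorProduct.assoc k B U U').toLinearMap

theorem coact_ev (X : LeftCoaction k B U) (X' : LeftCoaction k B U') (ev : U ⊗[k] U' →ₗ[k] k)
    (v : U) (x : U') :
    TensorProduct.map LinearMap.id ev ((tens X X').coact (v ⊗ₜ x)) =
      mulCoeff (evCoeff X' ev) (X.coact v ⊗ₜ x) ⊗ₜ 1 := by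
  refine (TensorProduct.rid k B).injective ?_
  rw [TensorProduct.rid_tmul, one_smul]
  change TensorProduct.rid k B (TensorProduct.map LinearMap.id ev
      (TensorProduct.map (mul (k := k) (B := B)).toLinearMap LinearMap.id
        (TensorProduct.tensorTensorTensorComm k B U B U' (X.coact v ⊗ₜ X'.coact x)))) = _
  induction X.coact v with
  | zero => simp
  | add a b ha hb => simp only [add_tmul, map_add, ha, hb]
  | tmul b w =>
    change _ = mul (k := k) (B := B) (b ⊗ₜ TensorProduct.rid k B (TensorProduct.map LinearMap.id ev
      (TensorProduct.leftComm k U B U' (w ⊗ₜ X'.coact x))))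
    induction X'.coact x with
    | zero => simp
    | add a b ha hb => simp only [tmul_add, map_add, ha, hb]
    | tmul c y => simp [TensorProduct.tmul_smul]

/-- Both sides of the colinearity equation lie in B ⊗ k, so it is an equation in B: ∑ v₋₁ E(v₀ ⊗ x)
= ev(v ⊗ x) 1. -/
theorem compat_ev_iff (X : LeftCoaction k B U) (X' : LeftCoaction k B U')
    (ev : U ⊗[k] U' →ₗ[k] k) :
    Compat (tens X X') (unitCoaction k B) LinearMap.id ev ↔ ∀ v x,
      mulCoeff (evCoeff X' ev) (X.coact v ⊗ₜ x) = ev (v ⊗ₜ x) • unit (k := k) (B := B) 1 := by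
  have e : ∀ v x, (unitCoaction k B).coact (ev (v ⊗ₜ x)) =
      (ev (v ⊗ₜ x) • unit (k := k) (B := B) 1) ⊗ₜ 1 := by
    intro v x
    change unit (k := k) (B := B) 1 ⊗ₜ ev (v ⊗ₜ x) = _
    rw [TensorProduct.smul_tmul, smul_eq_mul, mul_one]
  constructor
  · intro h v x
    have h1 := LinearMap.congr_fun h (v ⊗ₜ x)
    rw [LinearMap.comp_apply, LinearMap.comp_apply, coact_ev, e] at h1
    simpa using congr(TensorProduct.rid k B $h1).symm
  · intro h
    refine TensorProduct.ext' fun v x => ?_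
    rw [LinearMap.comp_apply, LinearMap.comp_apply, coact_ev, e, h]

/-- `h ↦ ∑ S(h₂)₁ ⊗ h₁ S(h₂)₂`. -/
def rightTwist (S : B →ₗ[k] B) : B →ₗ[k] B ⊗[k] B :=
  TensorProduct.map LinearMap.id (mul (k := k) (B := B)).toLinearMap ∘ₗ
    (TensorProduct.leftComm k B B B).toLinearMap ∘ₗ
    TensorProduct.map LinearMap.id (comul ∘ₗ S) ∘ₗ comul

/-- By `comul_evCoeff`, ∑ x₋₁ ⊗ v₋₁ E(v₀ ⊗ x₀) is obtained from v₋₁ ⊗ Δ E(v₀ ⊗ x); feeding `db` into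
x turns E into S. Neither `ev` nor `db` is assumed colinear, so the formula serves both to derive
the second preantipode axiom from a dual and to prove colinearity of `ev` from that axiom. -/
theorem mulCoeff_db (X : LeftCoaction k B U) (X' : LeftCoaction k B U') (ev : U ⊗[k] U' →ₗ[k] k)
    (db : U' ⊗[k] U) (S : B →ₗ[k] B)
    (hs : ∀ v, TensorProduct.map (TensorProduct.curry (evCoeff X' ev) v) LinearMap.id db =
      TensorProduct.map S LinearMap.id (X.coact v)) (v : U) :
    TensorProduct.map (TensorProduct.map LinearMap.id
      (TensorProduct.curry (mulCoeff (evCoeff X' ev)) (X.coact v)) ∘ₗ X'.coact) LinearMap.id db =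
      TensorProduct.map (rightTwist S) LinearMap.id (X.coact v) := by
  let Θ : B ⊗[k] (B ⊗[k] U) →ₗ[k] (B ⊗[k] B) ⊗[k] U :=
    TensorProduct.map (TensorProduct.map LinearMap.id (mul (k := k) (B := B)).toLinearMap ∘ₗ
      (TensorProduct.leftComm k B B B).toLinearMap) LinearMap.id ∘ₗ
      (TensorProduct.assoc k B (B ⊗[k] B) U).symm.toLinearMap ∘ₗ
      TensorProduct.map LinearMap.id (TensorProduct.map comul LinearMap.id)
  have e1 : ∀ t : U' ⊗[k] U, TensorProduct.map (TensorProduct.map LinearMap.id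
      (TensorProduct.curry (mulCoeff (evCoeff X' ev)) (X.coact v)) ∘ₗ X'.coact) LinearMap.id t =
      Θ (TensorProduct.map LinearMap.id (TensorProduct.map (evCoeff X' ev) LinearMap.id ∘ₗ
        (TensorProduct.assoc k U U' U).symm.toLinearMap ∘ₗ
        (TensorProduct.mk k U (U' ⊗[k] U)).flip t) (X.coact v)) := by
    intro t
    induction t with
    | zero => simp
    | add a b ha hb =>
      simp only [map_add, ha, hb, LinearMap.comp_add, TensorProduct.map_add_right,
        LinearMap.add_apply]
    | tmul x y =>
      induction X.coact v with
      | zero => simp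
      | add a b ha hb =>
        rw [map_add, map_add, map_add, ← ha, ← hb, ← LinearMap.add_apply,
          ← TensorProduct.map_add_left, ← LinearMap.add_comp, ← TensorProduct.map_add_right]
      | tmul b w =>
        change TensorProduct.map LinearMap.id
            (TensorProduct.curry (mulCoeff (evCoeff X' ev)) (b ⊗ₜ w)) (X'.coact x) ⊗ₜ y =
          TensorProduct.map LinearMap.id (mul (k := k) (B := B)).toLinearMap
            (TensorProduct.leftComm k B B B
              (b ⊗ₜ (comul ∘ₗ evCoeff X' ev) (w ⊗ₜ[k] x))) ⊗ₜ y
        rw [comul_evCoeff]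
        change _ = TensorProduct.map LinearMap.id (mul (k := k) (B := B)).toLinearMap
            (TensorProduct.leftComm k B B B
              (b ⊗ₜ (TensorProduct.map LinearMap.id (evCoeff X' ev)
                (TensorProduct.leftComm k U B U' (w ⊗ₜ[k] X'.coact x))))) ⊗ₜ y
        refine congr($(?_) ⊗ₜ[k] y)
        induction X'.coact x with
        | zero => simp
        | add a b ha hb => simp only [tmul_add, map_add, ha, hb]
        | tmul c x' => rfl
  have e2 : TensorProduct.map (evCoeff X' ev) LinearMap.id ∘ₗ
        (TensorProduct.assoc k U U' U).symm.toLinearMap ∘ₗ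
        (TensorProduct.mk k U (U' ⊗[k] U)).flip db =
        TensorProduct.map S LinearMap.id ∘ₗ X.coact :=
    LinearMap.ext fun v => (map_assoc_symm_tmul (evCoeff X' ev) v db).trans (hs v)
  have e3 : TensorProduct.map LinearMap.id (TensorProduct.map S LinearMap.id ∘ₗ X.coact)
      (X.coact v) = TensorProduct.map LinearMap.id (TensorProduct.map S LinearMap.id)
        (TensorProduct.assoc k B B U (TensorProduct.map comul LinearMap.id (X.coact v))) := by
    rw [show TensorProduct.assoc k B B U (TensorProduct.map comul LinearMap.id (X.coact v)) = _
      from LinearMap.congr_fun X.coassoc v, LinearMap.comp_apply, TensorProduct.map_map,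
      LinearMap.id_comp]
  rw [e1, e2, e3]
  induction X.coact v with
  | zero => simp
  | add a b ha hb => simp only [map_add, ha, hb]
  | tmul c w =>
    change Θ (TensorProduct.map LinearMap.id (TensorProduct.map S LinearMap.id)
        (TensorProduct.assoc k B B U (comul (R := k) c ⊗ₜ w))) =
      TensorProduct.map LinearMap.id (mul (k := k) (B := B)).toLinearMap
        (TensorProduct.leftComm k B B B
          (TensorProduct.map LinearMap.id (comul ∘ₗ S) (comul (R := k) c))) ⊗ₜ w
    hopf_tensor_induction comul (R := k) c with p q
    rfl

/-- In the zigzag, ω sees the middle leg x only through ∑ ev(v₀ ⊗ x₀) x₋₁ = E(v₀ ⊗ x), and `hs`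
converts this into S. What remains is the iterated coaction of `v`, acted on by h ↦ ∑ ω(h₁ ⊗ S(h₂) ⊗
h₃). -/
theorem triangle_db (X : LeftCoaction k B U) (X' : LeftCoaction k B U') (ev : U ⊗[k] U' →ₗ[k] k)
    (db : U' ⊗[k] U) (S : B →ₗ[k] B)
    (hs : ∀ v, TensorProduct.map (TensorProduct.curry (evCoeff X' ev) v) LinearMap.id db =
      TensorProduct.map S LinearMap.id (X.coact v)) (v : U) :
    TensorProduct.lid k U (TensorProduct.map ev LinearMap.id
      ((TensorProduct.assoc k U U' U).symm ((triple X X' X).act ω (v ⊗ₜ db)))) =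
    X.act (ω ∘ₗ TensorProduct.map LinearMap.id (TensorProduct.map S LinearMap.id ∘ₗ comul) ∘ₗ
      comul) v := by
  let Ψ : B ⊗[k] (B ⊗[k] U) →ₗ[k] U :=
    (TensorProduct.lid k U).toLinearMap ∘ₗ TensorProduct.map ω LinearMap.id ∘ₗ
      (TensorProduct.assoc k B (B ⊗[k] B) U).symm.toLinearMap ∘ₗ
      TensorProduct.map LinearMap.id ((TensorProduct.assoc k B B U).symm.toLinearMap ∘ₗ
        TensorProduct.map LinearMap.id X.coact)
  have e1 : ∀ t : U' ⊗[k] U, TensorProduct.lid k U (TensorProduct.map ev LinearMap.id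
      ((TensorProduct.assoc k U U' U).symm ((triple X X' X).act ω (v ⊗ₜ t)))) =
      Ψ (TensorProduct.map LinearMap.id (TensorProduct.map (evCoeff X' ev) LinearMap.id ∘ₗ
        (TensorProduct.assoc k U U' U).symm.toLinearMap ∘ₗ
        (TensorProduct.mk k U (U' ⊗[k] U)).flip t) (X.coact v)) := by
    intro t
    induction t with
    | zero => simp
    | add a b ha hb =>
      simp only [tmul_add, map_add, ha, hb, LinearMap.comp_add, TensorProduct.map_add_right,
        LinearMap.add_apply]
    | tmul x y =>
      change TensorProduct.lid k U (TensorProduct.map ev LinearMap.id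
        ((TensorProduct.assoc k U U' U).symm (TensorProduct.lid k _
          (TensorProduct.map ω LinearMap.id
            (TensorProduct.tensorTensorTensorComm k B U (B ⊗[k] B) (U' ⊗[k] U) (X.coact v ⊗ₜ
              TensorProduct.tensorTensorTensorComm k B U' B U
                (X'.coact x ⊗ₜ X.coact y))))))) = _
      induction X.coact v with
      | zero => simp
      | add a b ha hb => simp only [add_tmul, map_add, ha, hb]
      | tmul a w =>
        change _ = TensorProduct.lid k U (TensorProduct.map ω LinearMap.id
          ((TensorProduct.assoc k B (B ⊗[k] B) U).symm (a ⊗ₜ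
            ((TensorProduct.assoc k B B U).symm
              (TensorProduct.rid k B (TensorProduct.map LinearMap.id ev
                (TensorProduct.leftComm k U B U' (w ⊗ₜ X'.coact x))) ⊗ₜ X.coact y)))))
        induction X'.coact x with
        | zero => simp
        | add a b ha hb => simp only [tmul_add, add_tmul, map_add, ha, hb]
        | tmul c x' =>
          induction X.coact y with
          | zero => simp
          | add a b ha hb => simp only [tmul_add, map_add, ha, hb]
          | tmul d y' =>
            simpa [← TensorProduct.smul_tmul', TensorProduct.tmul_smul] using smul_comm _ _ _
  have e2 : TensorProduct.map (evCoeff X' ev) LinearMap.id ∘ₗ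
        (TensorProduct.assoc k U U' U).symm.toLinearMap ∘ₗ
        (TensorProduct.mk k U (U' ⊗[k] U)).flip db =
        TensorProduct.map S LinearMap.id ∘ₗ X.coact :=
    LinearMap.ext fun v => (map_assoc_symm_tmul (evCoeff X' ev) v db).trans (hs v)
  have e3 := act_comul_comul X
    (ω ∘ₗ TensorProduct.map LinearMap.id (TensorProduct.map S LinearMap.id)) v
  have e4 : (ω (k := k) (B := B) ∘ₗ TensorProduct.map LinearMap.id
      (TensorProduct.map S LinearMap.id)) ∘ₗ TensorProduct.map LinearMap.id comul ∘ₗ comul =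
      ω ∘ₗ TensorProduct.map LinearMap.id (TensorProduct.map S LinearMap.id ∘ₗ comul) ∘ₗ
      comul := by
    rw [LinearMap.comp_assoc, ← LinearMap.comp_assoc comul, ← TensorProduct.map_comp,
      LinearMap.id_comp]
  rw [e4] at e3
  rw [e1, e2, e3]
  refine congr(TensorProduct.lid k U $(?_))
  change TensorProduct.map ω LinearMap.id ((TensorProduct.assoc k B (B ⊗[k] B) U).symm
    (TensorProduct.map LinearMap.id ((TensorProduct.assoc k B B U).symm.toLinearMap ∘ₗ
      TensorProduct.map LinearMap.id X.coact) (TensorProduct.map LinearMap.id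
        (TensorProduct.map S LinearMap.id ∘ₗ X.coact) (X.coact v)))) = _
  induction X.coact v with
  | zero => simp
  | add a b ha hb => simp only [map_add, ha, hb]
  | tmul a w =>
    change TensorProduct.map ω LinearMap.id ((TensorProduct.assoc k B (B ⊗[k] B) U).symm
        (a ⊗ₜ (TensorProduct.assoc k B B U).symm (TensorProduct.map LinearMap.id X.coact
          (TensorProduct.map S LinearMap.id (X.coact w))))) =
      TensorProduct.map
        (ω ∘ₗ TensorProduct.map LinearMap.id (TensorProduct.map S LinearMap.id)) LinearMap.id
        ((TensorProduct.assoc k B (B ⊗[k] B) U).symm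
        (a ⊗ₜ (TensorProduct.assoc k B B U).symm (TensorProduct.map LinearMap.id X.coact
          (X.coact w))))
    induction X.coact w with
    | zero => simp
    | add a b ha hb => simp only [tmul_add, map_add, ha, hb]
    | tmul c y =>
      change TensorProduct.map ω LinearMap.id ((TensorProduct.assoc k B (B ⊗[k] B) U).symm
        (a ⊗ₜ (TensorProduct.assoc k B B U).symm (S c ⊗ₜ X.coact y))) =
      TensorProduct.map
        (ω ∘ₗ TensorProduct.map LinearMap.id (TensorProduct.map S LinearMap.id)) LinearMap.id
        ((TensorProduct.assoc k B (B ⊗[k] B) U).symm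
        (a ⊗ₜ (TensorProduct.assoc k B B U).symm (c ⊗ₜ X.coact y)))
      induction X.coact y with
      | zero => simp
      | add a b ha hb => simp only [tmul_add, map_add, ha, hb]
      | tmul d z => rfl

end Tens

end Pairing

end LeftCoaction

/-! ### Evaluation and coevaluation morphisms in terms of linear data -/

namespace FDComod

variable {k : Type u} {B : Type v} [Field k] [AddCommGroup B] [Module k B] [CoquasiBialgebra k B]
  {X X' : FDComod k B}

/-- The bilinear form underlying a morphism `X ⊗ X' ⟶ 𝟙`. -/
def evLin (e : X ⊗ X' ⟶ 𝟙_ (FDComod k B)) : X.carrier ⊗[k] X'.carrier →ₗ[k] k :=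
  Hom.toLin (X := tensor X X') (Y := unitObj k B) e

/-- The tensor underlying a morphism `𝟙 ⟶ X' ⊗ X`. -/
def dbElem (d : 𝟙_ (FDComod k B) ⟶ X' ⊗ X) : X'.carrier ⊗[k] X.carrier :=
  Hom.toLin (X := unitObj k B) (Y := tensor X' X) d (1 : k)

theorem compat_evLin (e : X ⊗ X' ⟶ 𝟙_ (FDComod k B)) :
    Compat (tens X.coaction X'.coaction) (unitCoaction k B) LinearMap.id (evLin e) :=
  Hom.colinear (X := tensor X X') (Y := unitObj k B) e

theorem coact_dbElem (d : 𝟙_ (FDComod k B) ⟶ X' ⊗ X) :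
    (tens X'.coaction X.coaction).coact (dbElem d) = unit (k := k) (B := B) 1 ⊗ₜ dbElem d :=
  LinearMap.congr_fun (Hom.colinear (X := unitObj k B) (Y := tensor X' X) d) (1 : k)

/-- The morphism `X ⊗ X' ⟶ 𝟙` given by a colinear form. -/
def evHom (ev : X.carrier ⊗[k] X'.carrier →ₗ[k] k)
    (h : Compat (tens X.coaction X'.coaction) (unitCoaction k B) LinearMap.id ev) :
    X ⊗ X' ⟶ 𝟙_ (FDComod k B) :=
  Hom.mk (X := tensor X X') (Y := unitObj k B) ev h

/-- The morphism `𝟙 ⟶ X' ⊗ X` given by a coinvariant tensor. -/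
def dbHom (db : X'.carrier ⊗[k] X.carrier)
    (h : (tens X'.coaction X.coaction).coact db = unit (k := k) (B := B) 1 ⊗ₜ db) :
    𝟙_ (FDComod k B) ⟶ X' ⊗ X :=
  Hom.mk (X := unitObj k B) (Y := tensor X' X) (LinearMap.toSpanSingleton k _ db) (by
    refine LinearMap.ext_ring ?_
    change (tens X'.coaction X.coaction).coact ((1 : k) • db) =
      unit (k := k) (B := B) 1 ⊗ₜ ((1 : k) • db)
    rw [one_smul, h])

@[simp]
theorem evLin_evHom (ev : X.carrier ⊗[k] X'.carrier →ₗ[k] k)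
    (h : Compat (tens X.coaction X'.coaction) (unitCoaction k B) LinearMap.id ev) :
    evLin (evHom ev h) = ev := rfl

@[simp]
theorem dbElem_dbHom (db : X'.carrier ⊗[k] X.carrier)
    (h : (tens X'.coaction X.coaction).coact db = unit (k := k) (B := B) 1 ⊗ₜ db) :
    dbElem (dbHom db h) = db := one_smul k db

theorem triangle_left_iff (d : 𝟙_ (FDComod k B) ⟶ X' ⊗ X) (e : X ⊗ X' ⟶ 𝟙_ (FDComod k B)) :
    X ◁ d ≫ (α_ X X' X).inv ≫ e ▷ X = (ρ_ X).hom ≫ (λ_ X).inv ↔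
      ∀ v, TensorProduct.lid k X.carrier (TensorProduct.map (evLin e) LinearMap.id
        ((TensorProduct.assoc k X.carrier X'.carrier X.carrier).symm
          ((triple X.coaction X'.coaction X.coaction).act ω (v ⊗ₜ dbElem d)))) = v := by
  -- Once the unitors are moved to the ends, the zigzag is an endomorphism of `X` whose underlying
  -- map unfolds to the stated formula; the inverse associator contributes ω.
  have h0 : ∀ v, Hom.toLin (((ρ_ X).inv ≫ X ◁ d ≫ (α_ X X' X).inv ≫ e ▷ X) ≫ (λ_ X).hom) v =
      TensorProduct.lid k X.carrier (TensorProduct.map (evLin e) LinearMap.id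
        ((TensorProduct.assoc k X.carrier X'.carrier X.carrier).symm
          ((triple X.coaction X'.coaction X.coaction).act ω (v ⊗ₜ dbElem d)))) := fun _ => rfl
  constructor
  · intro h v
    rw [← h0, h]
    simp
  · intro h
    have h1 : ((ρ_ X).inv ≫ X ◁ d ≫ (α_ X X' X).inv ≫ e ▷ X) ≫ (λ_ X).hom = 𝟙 X :=
      hom_ext (LinearMap.ext h)
    rw [← cancel_epi (ρ_ X).inv, ← cancel_mono (λ_ X).hom, h1]
    simp

theorem triangle_right_toLin (d : 𝟙_ (FDComod k B) ⟶ X' ⊗ X) (e : X ⊗ X' ⟶ 𝟙_ (FDComod k B))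
    (x : X'.carrier) :
    Hom.toLin (((λ_ X').inv ≫ d ▷ X' ≫ (α_ X' X X').hom ≫ X' ◁ e) ≫ (ρ_ X').hom) x =
      TensorProduct.rid k X'.carrier (TensorProduct.map LinearMap.id (evLin e)
        ((triple X'.coaction X.coaction X'.coaction).act ωInv
          (TensorProduct.assoc k X'.carrier X.carrier X'.carrier (dbElem d ⊗ₜ x)))) := rfl

theorem triangle_right_iff (d : 𝟙_ (FDComod k B) ⟶ X' ⊗ X) (e : X ⊗ X' ⟶ 𝟙_ (FDComod k B)) :
    d ▷ X' ≫ (α_ X' X X').hom ≫ X' ◁ e = (λ_ X').hom ≫ (ρ_ X').inv ↔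
      ∀ x, TensorProduct.rid k X'.carrier (TensorProduct.map LinearMap.id (evLin e)
        ((triple X'.coaction X.coaction X'.coaction).act ωInv
          (TensorProduct.assoc k X'.carrier X.carrier X'.carrier (dbElem d ⊗ₜ x)))) = x := by
  constructor
  · intro h x
    rw [← triangle_right_toLin, h]
    simp
  · intro h
    have h1 : ((λ_ X').inv ≫ d ▷ X' ≫ (α_ X' X X').hom ≫ X' ◁ e) ≫ (ρ_ X').hom = 𝟙 X' :=
      hom_ext (LinearMap.ext h)
    rw [← cancel_epi (λ_ X').inv, ← cancel_mono (ρ_ X').hom, h1]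
    simp

end FDComod

/-! ### Zigzags and dual morphisms in a monoidal category -/

section Mates

variable {C : Type*} [Category C] [MonoidalCategory C] {X X' Y Y' : C}

/-- If one zigzag is the identity, then the other one is absorbed by the evaluation. -/
theorem zigzag_comp_ev (d : 𝟙_ C ⟶ X' ⊗ X) (e : X ⊗ X' ⟶ 𝟙_ C)
    (h : X ◁ d ≫ (α_ X X' X).inv ≫ e ▷ X = (ρ_ X).hom ≫ (λ_ X).inv) :
    X ◁ (((λ_ X').inv ≫ d ▷ X' ≫ (α_ X' X X').hom ≫ X' ◁ e) ≫ (ρ_ X').hom) ≫ e = e := by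
  calc
    _ = 𝟙 _ ⊗≫ X ◁ d ▷ X' ⊗≫ ((X ⊗ X') ◁ e ≫ e ▷ 𝟙_ C) ⊗≫ 𝟙 _ := by monoidal
    -- Interchanging the two copies of `e` lets the left one act first, completing the zigzag on
    -- `X`.
    _ = 𝟙 _ ⊗≫ (X ◁ d ≫ (α_ X X' X).inv ≫ e ▷ X) ▷ X' ⊗≫ e := by
      rw [whisker_exchange]; monoidal
    _ = e := by rw [h]; monoidal

theorem whiskerLeft_rightDualMap_comp_ev (p : ExactPairing X' X) (q : ExactPairing Y' Y)
    (f : X ⟶ Y) :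
    X ◁ rightDualMap p q f ≫ p.evaluation' = f ▷ Y' ≫ q.evaluation' :=
  @leftAdjointMate_comp_evaluation C _ _ X Y ⟨X'⟩ ⟨Y'⟩ f

theorem db_comp_rightDualMap_whiskerRight (p : ExactPairing X' X) (q : ExactPairing Y' Y)
    (f : X ⟶ Y) :
    q.coevaluation' ≫ rightDualMap p q f ▷ Y = p.coevaluation' ≫ X' ◁ f :=
  @coevaluation_comp_leftAdjointMate C _ _ X Y ⟨X'⟩ ⟨Y'⟩ f

/-- Under the adjunction between tensoring with `X` and with its dual, `g` corresponds to `X ◁ g`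
followed by evaluation, so that composite determines `g`. -/
theorem rightDualMap_unique (p : ExactPairing X' X) (q : ExactPairing Y' Y)
    (f : X ⟶ Y) (g : Y' ⟶ X') (h : X ◁ g ≫ p.evaluation' = f ▷ Y' ≫ q.evaluation') :
    rightDualMap p q f = g := by
  let : HasLeftDual X := ⟨X'⟩
  let : HasLeftDual Y := ⟨Y'⟩
  have h1 := tensorLeftHomEquiv_whiskerLeft_comp_evaluation (Z := X) g
  have h2 := tensorLeftHomEquiv_whiskerRight_comp_evaluation f
  have h3 : X ◁ g ≫ ε_ (HasLeftDual.leftDual X) X = f ▷ _ ≫ ε_ (HasLeftDual.leftDual Y) Y := h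
  rw [h3] at h1
  exact (cancel_mono (ρ_ X').inv).1 (h2.symm.trans h1)

end Mates

/-! ### From right duals to a preantipode -/

section Rigid

variable {k : Type u} {B : Type v} [Field k] [AddCommGroup B] [Module k B] [CoquasiBialgebra k B]

open FDComod

/-- The family v ↦ (E(v ⊗ –) ⊗ id)(db) is natural and therefore comes from one map S. Only the
triangle identity on `X` is used directly; the one on the dual enters through the mate calculus. -/
theorem nonempty_preantipode_of_isRightRigid (h : IsRightRigid (FDComod k B)) :
    Nonempty (Preantipode k B) := by
  choose D hD using h
  let p : ∀ X, ExactPairing (D X) X := fun X => (hD X).some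
  let ev : ∀ X : FDComod k B, X.carrier ⊗[k] (D X).carrier →ₗ[k] k :=
    fun X => evLin (p X).evaluation'
  let db : ∀ X : FDComod k B, (D X).carrier ⊗[k] X.carrier :=
    fun X => dbElem (p X).coevaluation'
  let E : ∀ X : FDComod k B, X.carrier →ₗ[k] (D X).carrier →ₗ[k] B :=
    fun X => TensorProduct.curry (evCoeff (D X).coaction (ev X))
  let σ : ∀ X : FDComod k B, X.carrier →ₗ[k] B ⊗[k] X.carrier := fun X =>
    TensorProduct.map (evCoeff (D X).coaction (ev X)) LinearMap.id ∘ₗ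
      (TensorProduct.assoc k X.carrier (D X).carrier X.carrier).symm.toLinearMap ∘ₗ
      (TensorProduct.mk k X.carrier ((D X).carrier ⊗[k] X.carrier)).flip (db X)
  have hσ' : ∀ X v, σ X v = TensorProduct.map (E X v) LinearMap.id (db X) :=
    fun X v => map_assoc_symm_tmul _ _ _
  -- The dual morphism `g` of `f` moves `f` across `ev` and across `db`; as `g` is colinear, the
  -- coefficient maps follow.
  have hσ : ∀ (X Y : FDComod k B) (f : X ⟶ Y),
      σ Y ∘ₗ f.toLin = TensorProduct.map LinearMap.id f.toLin ∘ₗ σ X := by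
    intro X Y f
    let g := rightDualMap (p X) (p Y) f
    have h1 : ev X ∘ₗ TensorProduct.map LinearMap.id g.toLin =
        ev Y ∘ₗ TensorProduct.map f.toLin LinearMap.id :=
      congr_arg Hom.toLin (whiskerLeft_rightDualMap_comp_ev (p X) (p Y) f)
    have h2 : TensorProduct.map g.toLin LinearMap.id (db Y) =
        TensorProduct.map LinearMap.id f.toLin (db X) :=
      LinearMap.congr_fun (congr_arg Hom.toLin (db_comp_rightDualMap_whiskerRight (p X) (p Y) f))
        (1 : k)
    have h3 := (evCoeff_comp (compat g) (ev X)).symm.trans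
      (congr(evCoeff (D Y).coaction $h1).trans (evCoeff_map_left _ _ _))
    refine LinearMap.ext fun v => ?_
    have h4 : E Y (f.toLin v) = E X v ∘ₗ g.toLin :=
      LinearMap.ext fun x => (LinearMap.congr_fun h3 (v ⊗ₜ x)).symm
    change σ Y (f.toLin v) = TensorProduct.map LinearMap.id f.toLin (σ X v)
    rw [hσ', hσ', h4]
    have h5 := congr(TensorProduct.map (E X v) (LinearMap.id (R := k) (M := Y.carrier)) $h2)
    rw [TensorProduct.map_map, TensorProduct.map_map] at h5
    rw [TensorProduct.map_map]
    exact h5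
  obtain ⟨S, hS⟩ := exists_linearMap_of_natural σ hσ
  have hs : ∀ X v, TensorProduct.map (E X v) LinearMap.id (db X) =
      TensorProduct.map S LinearMap.id (X.coaction.coact v) := fun X v => by
    rw [← hσ', hS, LinearMap.comp_apply]
  refine ⟨⟨S, ?_, ?_, ?_⟩⟩
  -- First axiom, from coinvariance of `db` tested against E(v ⊗ –).
  · have key : leftTwist (comul ∘ₗ S) = TensorProduct.mk k B B (unit (k := k) (B := B) 1) ∘ₗ S := by
      refine ext_of_fdComod fun X => LinearMap.ext fun v => ?_
      refine (TensorProduct.assoc k B B X.carrier).injective ?_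
      refine (coact_db X.coaction (D X).coaction (E X v) (comul ∘ₗ S) (db X) v ?_).symm.trans ?_
      · rw [map_curry_evCoeff_comp_coact]
        have h1 := congr(TensorProduct.map (comul (R := k) (A := B)) LinearMap.id $(hs X v))
        rw [TensorProduct.map_map, TensorProduct.map_map] at h1
        exact h1
      · rw [show (tens (D X).coaction X.coaction).coact (db X) = _ from coact_dbElem _]
        refine (congr(unit (k := k) (B := B) 1 ⊗ₜ[k] $(hs X v))).trans ?_
        rw [LinearMap.comp_apply]
        hopf_tensor_induction X.coaction.coact v with c w
        rfl
    exact LinearMap.congr_fun key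
  -- Second axiom: colinearity of `ev` gives ∑ x₋₁ ⊗ v₋₁ E(v₀ ⊗ x₀) = E(v ⊗ x) ⊗ 1, which is then
  -- evaluated on `db`.
  · have key : rightTwist S = (TensorProduct.mk k B B).flip (unit (k := k) (B := B) 1) ∘ₗ S := by
      refine ext_of_fdComod fun X => LinearMap.ext fun v => ?_
      refine (mulCoeff_db X.coaction (D X).coaction (ev X) (db X) S (hs X) v).symm.trans ?_
      have h1 := (compat_ev_iff _ _ _).1 (compat_evLin (p X).evaluation') v
      have h2 : TensorProduct.map LinearMap.id (TensorProduct.curry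
          (mulCoeff (evCoeff (D X).coaction (ev X))) (X.coaction.coact v)) ∘ₗ (D X).coaction.coact =
          (TensorProduct.mk k B B).flip (unit (k := k) (B := B) 1) ∘ₗ E X v := by
        have h3 : TensorProduct.curry (mulCoeff (evCoeff (D X).coaction (ev X)))
            (X.coaction.coact v) = LinearMap.toSpanSingleton k B (unit (k := k) (B := B) 1) ∘ₗ
              TensorProduct.curry (ev X) v := LinearMap.ext h1
        rw [h3]
        refine LinearMap.ext fun x => ?_
        change _ = evCoeff (D X).coaction (ev X) (v ⊗ₜ x) ⊗ₜ unit (k := k) (B := B) 1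
        rw [curry_evCoeff_apply, LinearMap.comp_apply]
        hopf_tensor_induction (D X).coaction.coact x with c y
        exact TensorProduct.tmul_smul _ _ _ |>.trans (TensorProduct.smul_tmul' _ _ _)
      rw [h2]
      have h4 := congr(TensorProduct.map ((TensorProduct.mk k B B).flip (unit (k := k) (B := B) 1))
        (LinearMap.id (R := k) (M := X.carrier)) $(hs X v))
      rw [TensorProduct.map_map, TensorProduct.map_map] at h4
      exact h4
    exact LinearMap.congr_fun key
  · have key : ω (k := k) (B := B) ∘ₗ TensorProduct.map LinearMap.id
        (TensorProduct.map S LinearMap.id ∘ₗ comul) ∘ₗ comul = counit := by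
      refine ext_act fun X v => ?_
      rw [← triangle_db X.coaction (D X).coaction (ev X) (db X) S (hs X), act_counit]
      exact (triangle_left_iff _ _).1 (p X).coevaluation_evaluation' v
    exact LinearMap.congr_fun key

end Rigid

/-! ### The pairing of a space with the cofree comodule on its dual -/

namespace LeftCoaction

theorem sum_coeff_tmul_basis {k B U N ι : Type*} [Field k] [AddCommGroup B] [Module k B]
    [AddCommGroup U] [Module k U] [AddCommGroup N] [Module k N] [Fintype ι]
    (b : Module.Basis ι k U)
    (S : B →ₗ[k] N) (t : B ⊗[k] U) :
    ∑ i, S (TensorProduct.rid k B (TensorProduct.map LinearMap.id (b.coord i) t)) ⊗ₜ[k] b i =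
      TensorProduct.map S LinearMap.id t := by
  induction t with
  | zero => simp
  | add x y hx hy => simp only [map_add, add_tmul, Finset.sum_add_distrib, hx, hy]
  | tmul c w =>
    simp only [TensorProduct.map_tmul, TensorProduct.rid_tmul, LinearMap.id_apply, map_smul,
      TensorProduct.smul_tmul]
    rw [← TensorProduct.tmul_sum]
    congr 1
    exact b.sum_repr w

/-- Tensors are separated by a finite family of maps having a joint linear retraction. -/
theorem ext_of_sum_comp_eq_id {k B U U' N ι : Type*} [Field k] [AddCommGroup B] [Module k B]
    [AddCommGroup U] [Module k U] [AddCommGroup U'] [Module k U'] [AddCommGroup N] [Module k N]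
    [Fintype ι] {τ : ι → U' →ₗ[k] N} {r : ι → N →ₗ[k] U'} (hr : ∑ j, r j ∘ₗ τ j = LinearMap.id)
    {t t' : B ⊗[k] (U' ⊗[k] U)}
    (h : ∀ j, TensorProduct.map LinearMap.id (TensorProduct.map (τ j) LinearMap.id) t =
      TensorProduct.map LinearMap.id (TensorProduct.map (τ j) LinearMap.id) t') : t = t' := by
  have h1 : ∀ t : B ⊗[k] (U' ⊗[k] U), t =
      ∑ j, TensorProduct.map LinearMap.id (TensorProduct.map (r j) LinearMap.id)
        (TensorProduct.map LinearMap.id (TensorProduct.map (τ j) LinearMap.id) t) := by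
    intro t
    induction t with
    | zero => simp
    | add x y hx hy => simp only [map_add, Finset.sum_add_distrib, ← hx, ← hy]
    | tmul c z =>
      simp only [TensorProduct.map_tmul, LinearMap.id_apply]
      rw [← TensorProduct.tmul_sum]
      congr 1
      induction z with
      | zero => simp
      | add x y hx hy => simp only [map_add, Finset.sum_add_distrib, ← hx, ← hy]
      | tmul x y =>
        simp only [TensorProduct.map_tmul, LinearMap.id_apply]
        rw [← TensorProduct.sum_tmul]
        congr 1
        simpa using (LinearMap.congr_fun hr x).symm
  rw [h1 t, h1 t']
  simp only [h]

section CofreePairing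

variable {k B U : Type*} [Field k] [AddCommGroup B] [Module k B] [Coalgebra k B]
  [AddCommGroup U] [Module k U]

variable (k B U) in
/-- The pairing `v ⊗ (b ⊗ f) ↦ ε(b) f(v)` of `U` with the cofree comodule on its dual. -/
def cofreePairing : U ⊗[k] (B ⊗[k] Module.Dual k U) →ₗ[k] k :=
  (TensorProduct.lid k k).toLinearMap ∘ₗ
    TensorProduct.map counit (TensorProduct.lift (Module.Dual.eval k U)) ∘ₗ
    (TensorProduct.leftComm k U B (Module.Dual k U)).toLinearMap

/-- The coaction duplicates b and the pairing removes one copy by ε, so the coefficient map is the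
plain contraction v ⊗ (b ⊗ f) ↦ f(v) b. It identifies B ⊗ U* with Hom(U, B) for finite-dimensional
U, so it separates points even though the scalar pairing need not. -/
theorem curry_evCoeff_cofree (v : U) :
    TensorProduct.curry (evCoeff (cofree k B (Module.Dual k U)) (cofreePairing k B U)) v =
      (TensorProduct.rid k B).toLinearMap ∘ₗ
        TensorProduct.map LinearMap.id (Module.Dual.eval k U v) := by
  refine TensorProduct.ext' fun b f => ?_
  change evCoeff _ _ (v ⊗ₜ (b ⊗ₜ f)) = f v • b
  rw [curry_evCoeff_apply]
  change TensorProduct.rid k B (TensorProduct.map LinearMap.id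
    (TensorProduct.curry (cofreePairing k B U) v)
      (TensorProduct.assoc k B B (Module.Dual k U) (comul (R := k) b ⊗ₜ f))) = _
  have e : ∀ t : B ⊗[k] B, TensorProduct.rid k B (TensorProduct.map LinearMap.id
      (TensorProduct.curry (cofreePairing k B U) v)
      (TensorProduct.assoc k B B (Module.Dual k U) (t ⊗ₜ f))) =
      f v • TensorProduct.rid k B (counit.lTensor B t) := by
    intro t
    induction t with
    | zero => simp
    | add a b ha hb => simp only [add_tmul, map_add, smul_add, ha, hb]
    | tmul p q => simp [cofreePairing, smul_smul, mul_comm]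
  rw [e, Coalgebra.lTensor_counit_comul, TensorProduct.rid_tmul, one_smul]

variable {ι : Type*} [Fintype ι]

theorem sum_curry_evCoeff_cofree (b : Module.Basis ι k U) (m : B ⊗[k] Module.Dual k U) :
    ∑ j, TensorProduct.curry (evCoeff (cofree k B (Module.Dual k U)) (cofreePairing k B U)) (b j) m
      ⊗ₜ[k] b.coord j = m := by
  simp only [curry_evCoeff_cofree]
  induction m with
  | zero => simp
  | add x y hx hy => simp only [map_add, add_tmul, Finset.sum_add_distrib, hx, hy]
  | tmul c f =>
    simp only [LinearMap.comp_apply, TensorProduct.map_tmul, LinearEquiv.coe_coe,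
      TensorProduct.rid_tmul, LinearMap.id_apply, Module.Dual.eval_apply, TensorProduct.smul_tmul]
    rw [← TensorProduct.tmul_sum]
    congr 1
    exact b.ext fun i => by
      simp

/-- The element of `B ⊗ U*` corresponding to the linear map `g : U → B`. -/
def cofreeOfMap (b : Module.Basis ι k U) (g : U →ₗ[k] B) : B ⊗[k] Module.Dual k U :=
  ∑ j, g (b j) ⊗ₜ b.coord j

theorem curry_evCoeff_cofreeOfMap (b : Module.Basis ι k U) (g : U →ₗ[k] B) (v : U) :
    TensorProduct.curry (evCoeff (cofree k B (Module.Dual k U)) (cofreePairing k B U)) v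
      (cofreeOfMap b g) = g v := by
  rw [curry_evCoeff_cofree, cofreeOfMap, map_sum]
  conv_rhs => rw [← b.sum_repr v, map_sum]
  exact Finset.sum_congr rfl fun j _ => (map_smul g _ _).symm

end CofreePairing

end LeftCoaction

/-! ### From a preantipode to right duals -/

section Rigid

variable {k : Type u} {B : Type v} [Field k] [AddCommGroup B] [Module k B] [CoquasiBialgebra k B]

open FDComod

/-- A right dual is determined by a colinear form satisfying one triangle identity, provided that
the form is nondegenerate on the side of the dual. -/
theorem exists_exactPairing {X X' : FDComod k B} (S : Preantipode k B)
    (ev : X.carrier ⊗[k] X'.carrier →ₗ[k] k) (db : X'.carrier ⊗[k] X.carrier)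
    (hev : Compat (tens X.coaction X'.coaction) (unitCoaction k B) LinearMap.id ev)
    (hs : ∀ v, TensorProduct.map (TensorProduct.curry (evCoeff X'.coaction ev) v) LinearMap.id db =
      TensorProduct.map S.S LinearMap.id (X.coaction.coact v))
    {ι : Type*} [Fintype ι] (e : ι → X.carrier) (r : ι → B →ₗ[k] X'.carrier)
    (hr : ∑ j, r j ∘ₗ TensorProduct.curry (evCoeff X'.coaction ev) (e j) = LinearMap.id) :
    Nonempty (ExactPairing X' X) := by
  have hl : leftTwist (comul ∘ₗ S.S) =
      TensorProduct.mk k B B (unit (k := k) (B := B) 1) ∘ₗ S.S := LinearMap.ext S.left_eq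
  -- By `hr` the maps E(eⱼ ⊗ –) jointly separate the dual leg, and after applying them coinvariance
  -- of `db` is the first preantipode axiom.
  have hdb : (tens X'.coaction X.coaction).coact db = unit (k := k) (B := B) 1 ⊗ₜ db := by
    refine ext_of_sum_comp_eq_id hr fun v => ?_
    rw [coact_db X.coaction X'.coaction _ (comul ∘ₗ S.S) db (e v), hl]
    · refine Eq.trans ?_ (congr(unit (k := k) (B := B) 1 ⊗ₜ[k] $(hs (e v)))).symm
      hopf_tensor_induction X.coaction.coact (e v) with c w
      rfl
    · rw [map_curry_evCoeff_comp_coact]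
      have h1 := congr(TensorProduct.map (comul (R := k) (A := B)) LinearMap.id $(hs (e v)))
      rw [TensorProduct.map_map, TensorProduct.map_map] at h1
      exact h1
  have htri : X ◁ dbHom db hdb ≫ (α_ X X' X).inv ≫ evHom ev hev ▷ X =
      (ρ_ X).hom ≫ (λ_ X).inv := by
    refine (triangle_left_iff _ _).2 fun v => ?_
    rw [dbElem_dbHom, evLin_evHom, triangle_db X.coaction X'.coaction ev db S.S hs]
    have hω : ω (k := k) (B := B) ∘ₗ TensorProduct.map LinearMap.id
        (TensorProduct.map S.S LinearMap.id ∘ₗ comul) ∘ₗ comul = counit := LinearMap.ext S.ω_eq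
    rw [hω, act_counit, LinearMap.id_apply]
  let Φ : X' ⟶ X' := ((λ_ X').inv ≫ dbHom db hdb ▷ X' ≫ (α_ X' X X').hom ≫ X' ◁ evHom ev hev) ≫
    (ρ_ X').hom
  have hΦ : ev ∘ₗ TensorProduct.map LinearMap.id Φ.toLin = ev :=
    congr_arg Hom.toLin (zigzag_comp_ev _ _ htri)
  -- `Φ` is colinear and absorbed by `ev`, so E(v ⊗ Φ(x)) = E(v ⊗ x); joint injectivity of the E(eⱼ
  -- ⊗ –) gives Φ(x) = x.
  have hΦ' : Φ = 𝟙 X' := by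
    refine hom_ext (LinearMap.ext fun x => ?_)
    have h1 := evCoeff_comp (compat Φ) ev
    rw [hΦ] at h1
    have h2 : ∀ x, x = ∑ j, r j (evCoeff X'.coaction ev (e j ⊗ₜ x)) := fun x => by
      simpa using (LinearMap.congr_fun hr x).symm
    rw [h2 (Φ.toLin x), id_toLin, LinearMap.id_apply, h2 x]
    refine Finset.sum_congr rfl fun j _ => ?_
    rw [← h2 x]
    exact congr(r j $(LinearMap.congr_fun h1 (e j ⊗ₜ x))).symm
  refine ⟨⟨dbHom db hdb, evHom ev hev, htri, ?_⟩⟩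
  rw [← cancel_epi (λ_ X').inv, ← cancel_mono (ρ_ X').hom]
  refine hΦ'.trans ?_
  simp

/-- The requirement (E(v ⊗ –) ⊗ id)(db) = ∑ S(v₋₁) ⊗ v₀ forces the dual legs of db once E is
contraction on B ⊗ X*. The subcomodule generated by these legs is the dual. It is cut out of the
cofree comodule because the scalar pairing need not be colinear on all of it. -/
theorem isRightRigid_of_preantipode (S : Preantipode k B) : IsRightRigid (FDComod k B) := by
  intro X
  let U := X.carrier
  let b := Module.finBasis k U
  let M := cofree k B (Module.Dual k U)
  let E := evCoeff M (cofreePairing k B U)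
  let x : Fin (Module.finrank k U) → B ⊗[k] Module.Dual k U :=
    fun i => cofreeOfMap b (S.S ∘ₗ X.coaction.coeff (b.coord i))
  have hx : ∀ v i, TensorProduct.curry E v (x i) = S.S (X.coaction.coeff (b.coord i) v) :=
    fun v i => curry_evCoeff_cofreeOfMap b _ v
  have hsM : ∀ v, TensorProduct.map (TensorProduct.curry E v) LinearMap.id
      (∑ i, x i ⊗ₜ[k] b i) = TensorProduct.map S.S LinearMap.id (X.coaction.coact v) := by
    intro v
    rw [← sum_coeff_tmul_basis b S.S, map_sum]
    refine Finset.sum_congr rfl fun i _ => ?_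
    rw [TensorProduct.map_tmul, hx]
    rfl
  have hright : rightTwist S.S =
      (TensorProduct.mk k B B).flip (unit (k := k) (B := B) 1) ∘ₗ S.S :=
    LinearMap.ext S.right_eq
  -- The second preantipode axiom with the free B-leg kept: ∑ m₋₁ ⊗ v₋₁ E(v₀ ⊗ m₀) = E(v ⊗ m) ⊗ 1
  -- for m = xᵢ. The components are isolated by applying the coordinates of `b` to the leg in `X`.
  have hgen : ∀ v i, TensorProduct.map LinearMap.id
      (TensorProduct.curry (mulCoeff E) (X.coaction.coact v)) (M.coact (x i)) =
      TensorProduct.curry E v (x i) ⊗ₜ unit (k := k) (B := B) 1 := by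
    intro v
    have h1 := mulCoeff_db X.coaction M (cofreePairing k B U) (∑ i, x i ⊗ₜ[k] b i) S.S hsM v
    have h2 := congr(TensorProduct.map ((TensorProduct.mk k B B).flip (unit (k := k) (B := B) 1))
      (LinearMap.id (R := k) (M := X.carrier)) $(hsM v))
    rw [TensorProduct.map_map, TensorProduct.map_map, ← hright] at h2
    have h3 := h1.trans h2.symm
    simp only [map_sum, TensorProduct.map_tmul] at h3
    classical
    intro i
    have h4 := congr(TensorProduct.rid k _ (TensorProduct.map LinearMap.id (b.coord i) $h3))
    simpa [Finsupp.single_apply] using h4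
  have : FiniteDimensional k (Submodule.span k (Set.range x)) :=
    Module.Finite.span_of_finite k (Set.finite_range x)
  obtain ⟨Y, ι, π, hπ, hι, hran⟩ := exists_fdComod M (Submodule.span k (Set.range x))
  have hy : ∀ i, ∃ y, ι y = x i := fun i => by
    have : x i ∈ LinearMap.range ι := by
      rw [hran]
      exact le_closure _ _ (Submodule.subset_span ⟨i, rfl⟩)
    exact this
  choose y hy using hy
  let ev : U ⊗[k] Y.carrier →ₗ[k] k := cofreePairing k B U ∘ₗ TensorProduct.map LinearMap.id ι
  have hE : evCoeff Y.coaction ev = E ∘ₗ TensorProduct.map LinearMap.id ι := evCoeff_comp hι _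
  have hE' : ∀ v, TensorProduct.curry (evCoeff Y.coaction ev) v = TensorProduct.curry E v ∘ₗ ι :=
    fun v => by rw [hE]; rfl
  -- Elements of the generated subcomodule are sums of ∑ f(m₋₁) m₀ with m in the span of the xᵢ;
  -- applying f to the free leg in `hgen` gives the colinearity equation for all of them.
  have hcol : ∀ v, ∀ m ∈ LinearMap.range ι, mulCoeff E (X.coaction.coact v ⊗ₜ m) =
      cofreePairing k B U (v ⊗ₜ m) • unit (k := k) (B := B) 1 := by
    intro v
    suffices LinearMap.range ι ≤ LinearMap.eqLocus
        (TensorProduct.curry (mulCoeff E) (X.coaction.coact v))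
        (LinearMap.toSpanSingleton k B (unit (k := k) (B := B) 1) ∘ₗ
          TensorProduct.curry (cofreePairing k B U) v) from this
    rw [hran]
    refine iSup_le fun f => ?_
    rw [Submodule.map_span, Submodule.span_le]
    rintro _ ⟨_, ⟨i, rfl⟩, rfl⟩
    have h1 : ∀ (D : B ⊗[k] Module.Dual k U →ₗ[k] B) (m : B ⊗[k] Module.Dual k U), D (M.act f m) =
        TensorProduct.lid k B (TensorProduct.map f D (M.coact m)) := by
      intro D m
      change D (TensorProduct.lid k _ (TensorProduct.map f LinearMap.id (M.coact m))) = _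
      hopf_tensor_induction M.coact m with p q
      simp
    change TensorProduct.curry (mulCoeff E) (X.coaction.coact v) (M.act f (x i)) =
      (LinearMap.toSpanSingleton k B (unit (k := k) (B := B) 1) ∘ₗ
          TensorProduct.curry (cofreePairing k B U) v) (M.act f (x i))
    rw [h1, h1]
    have h2 := congr(TensorProduct.lid k B (TensorProduct.map f LinearMap.id $(hgen v i)))
    rw [TensorProduct.map_map, LinearMap.id_comp, LinearMap.comp_id] at h2
    refine h2.trans ?_
    change f (evCoeff M (cofreePairing k B U) (v ⊗ₜ x i)) • unit (k := k) (B := B) 1 = _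
    rw [curry_evCoeff_apply]
    induction M.coact (x i) with
    | zero => simp
    | add a b ha hb => simp only [map_add, add_smul, ha, hb]
    | tmul p q => simp [smul_smul, mul_comm]
  -- The retraction c ↦ π(c ⊗ bⱼ*) is chosen because m = ∑ E(bⱼ ⊗ m) ⊗ bⱼ* in the cofree comodule.
  refine ⟨Y, exists_exactPairing S ev (∑ i, y i ⊗ₜ b i) ((compat_ev_iff _ _ _).2 fun v z => ?_)
    (fun v => ?_) b (fun j => π ∘ₗ (TensorProduct.mk k B (Module.Dual k U)).flip (b.coord j)) ?_⟩
  · refine Eq.trans ?_ (hcol v (ι z) ⟨z, rfl⟩)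
    rw [hE]
    hopf_tensor_induction X.coaction.coact v with c w
    rfl
  · rw [hE', ← hsM, map_sum, map_sum]
    refine Finset.sum_congr rfl fun i _ => ?_
    rw [TensorProduct.map_tmul, TensorProduct.map_tmul, LinearMap.comp_apply, hy]
  · refine LinearMap.ext fun z => ?_
    have h1 := congr(π $(sum_curry_evCoeff_cofree b (ι z)))
    rw [map_sum] at h1
    refine Eq.trans ?_ (h1.trans (LinearMap.congr_fun hπ z))
    rw [LinearMap.sum_apply]
    refine Finset.sum_congr rfl fun j _ => ?_
    rw [hE']
    rfl

theorem nonempty_preantipode_iff :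
    Nonempty (Preantipode k B) ↔ IsRightRigid (FDComod k B) :=
  ⟨fun ⟨S⟩ => isRightRigid_of_preantipode S, nonempty_preantipode_of_isRightRigid⟩

end Rigid

/-! ### Moving functionals between tensor legs -/

section Convolution

variable {k C M N : Type*} [Field k] [AddCommGroup C] [Module k C] [Coalgebra k C]
  [AddCommGroup M] [Module k M] [AddCommGroup N] [Module k N]

theorem leftConv_eq_comp_act (f : C →ₗ[k] k) (φ : C →ₗ[k] M) :
    leftConv f φ = φ ∘ₗ (regular k C).act f := by
  refine LinearMap.ext fun x => ?_
  change TensorProduct.lid k M (TensorProduct.map f φ (comul (R := k) x)) =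
    φ (TensorProduct.lid k C (TensorProduct.map f LinearMap.id (comul (R := k) x)))
  hopf_tensor_induction comul (R := k) x with p q
  simp

theorem map_leftConv_comul (φ : C →ₗ[k] M) (f : C →ₗ[k] k) (ψ : C →ₗ[k] N) :
    TensorProduct.map φ (leftConv f ψ) ∘ₗ comul =
      TensorProduct.map (rightConv φ f) ψ ∘ₗ comul := by
  have h := congr(TensorProduct.map (LinearMap.id (R := k) (M := M)) ψ ∘ₗ
    $(map_act_coact (regular k C) f φ))
  rw [← LinearMap.comp_assoc, ← LinearMap.comp_assoc, ← TensorProduct.map_comp,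
    ← TensorProduct.map_comp, LinearMap.id_comp, LinearMap.id_comp, LinearMap.comp_id,
    ← leftConv_eq_comp_act] at h
  exact h

theorem leftConv_map_comul (f : C →ₗ[k] k) (φ : C →ₗ[k] M) (ψ : C →ₗ[k] N) :
    leftConv f (TensorProduct.map φ ψ ∘ₗ comul) =
      TensorProduct.map (leftConv f φ) ψ ∘ₗ comul := by
  have h := congr(TensorProduct.map (LinearMap.id (R := k) (M := M)) ψ ∘ₗ
    $(map_coact_act_left (regular k C) f φ))
  rw [← LinearMap.comp_assoc, ← LinearMap.comp_assoc, ← LinearMap.comp_assoc,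
    ← TensorProduct.map_comp, ← TensorProduct.map_comp, LinearMap.id_comp, LinearMap.id_comp,
    LinearMap.comp_id] at h
  rw [leftConv_eq_comp_act]
  exact h

theorem leftConv_rightConv (f g : C →ₗ[k] k) (φ : C →ₗ[k] M) :
    leftConv f (rightConv φ g) = rightConv (leftConv f φ) g := by
  have h := leftConv_map_comul f φ g
  rw [leftConv_eq_comp_act] at h ⊢
  exact congr((TensorProduct.rid k M).toLinearMap ∘ₗ $h)

/-- Coassociativity allows α and β to be attached to the outer legs or to the middle one. The outer
form arises from the zigzag on the dual, the middle form is the one in the axiom for ω⁻¹. -/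
theorem map_rightConv_map_leftConv (s : C →ₗ[k] C) (α β : C →ₗ[k] k) :
    TensorProduct.map (rightConv s α)
        (TensorProduct.map LinearMap.id (leftConv β s) ∘ₗ comul) ∘ₗ comul =
      TensorProduct.map s (TensorProduct.map (rightConv (leftConv α LinearMap.id) β) s ∘ₗ comul) ∘ₗ
        comul := by
  rw [map_leftConv_comul, ← map_leftConv_comul s, leftConv_map_comul, leftConv_rightConv]

end Convolution

namespace LeftCoaction

/-! ### Coefficients of comodules and dinatural pairings -/

section Coeff

variable {k C U V N : Type*} [Field k] [AddCommGroup C] [Module k C] [Coalgebra k C]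
  [AddCommGroup U] [Module k U] [AddCommGroup V] [Module k V] [AddCommGroup N] [Module k N]

theorem apply_coeff (X : LeftCoaction k C U) (T : C →ₗ[k] N) (f : U →ₗ[k] k) (v : U) :
    T (X.coeff f v) = TensorProduct.rid k N (TensorProduct.map LinearMap.id f
      (TensorProduct.map T LinearMap.id (X.coact v))) := by
  change T (TensorProduct.rid k C (TensorProduct.map LinearMap.id f (X.coact v))) = _
  hopf_tensor_induction X.coact v with c w
  simp

theorem apply_coeff_eq_act (X : LeftCoaction k C U) (T : C →ₗ[k] k) (f : U →ₗ[k] k) (v : U) :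
    T (X.coeff f v) = f (X.act T v) := by
  rw [apply_coeff]
  change _ = f (TensorProduct.lid k U (TensorProduct.map T LinearMap.id (X.coact v)))
  hopf_tensor_induction X.coact v with c w
  simp [mul_comm]

theorem coeff_comp {X : LeftCoaction k C U} {Y : LeftCoaction k C V} {f : U →ₗ[k] V}
    (hf : Compat X Y LinearMap.id f) (g : V →ₗ[k] k) (v : U) :
    X.coeff (g ∘ₗ f) v = Y.coeff g (f v) := by
  change TensorProduct.rid k C (TensorProduct.map LinearMap.id (g ∘ₗ f) (X.coact v)) =
    TensorProduct.rid k C (TensorProduct.map LinearMap.id g ((Y.coact ∘ₗ f) v))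
  rw [hf, LinearMap.comp_apply, TensorProduct.map_map, LinearMap.id_comp]

theorem comul_coeff (X : LeftCoaction k C U) (f : U →ₗ[k] k) (v : U) :
    comul (R := k) (X.coeff f v) = TensorProduct.map LinearMap.id (X.coeff f) (X.coact v) :=
  LinearMap.congr_fun (compat_coeff X f) v

end Coeff

section ReconstructionDual

variable {k : Type u} {C : Type v} {N : Type*} [Field k] [AddCommGroup C] [Module k C]
  [Coalgebra k C] [AddCommGroup N] [Module k N]

theorem ext_of_coeff {L R : C →ₗ[k] N}
    (h : ∀ (X : FDComod k C) (f : Module.Dual k X.carrier) (v : X.carrier),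
      L (X.coaction.coeff f v) = R (X.coaction.coeff f v)) : L = R := by
  refine ext_of_fdComod fun X => LinearMap.ext fun v => tensor_ext_of_slices fun f => ?_
  have h1 := h X f v
  rw [apply_coeff, apply_coeff] at h1
  exact h1

/-- Dinatural families of pairings `X ⊗ X* → N` are given by a linear map on coefficients. -/
theorem exists_linearMap_of_dinatural
    (P : ∀ X : FDComod k C, X.carrier ⊗[k] Module.Dual k X.carrier →ₗ[k] N)
    (hP : ∀ (X Y : FDComod k C) (f : X ⟶ Y) (v : X.carrier) (g : Module.Dual k Y.carrier),
      P X (v ⊗ₜ (g ∘ₗ f.toLin)) = P Y (f.toLin v ⊗ₜ g)) :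
    ∃ T : C →ₗ[k] N, ∀ (X : FDComod k C) (v : X.carrier) (f : Module.Dual k X.carrier),
      P X (v ⊗ₜ f) = T (X.coaction.coeff f v) := by
  let b : ∀ X : FDComod k C, Module.Basis _ k X.carrier := fun X => Module.finBasis k X.carrier
  -- For finite-dimensional X, pairings X ⊗ X* → N are the same as maps X → N ⊗ X; dinaturality
  -- becomes naturality.
  let σ : ∀ X : FDComod k C, X.carrier →ₗ[k] N ⊗[k] X.carrier := fun X =>
    ∑ i, (TensorProduct.mk k N X.carrier).flip (b X i) ∘ₗ P X ∘ₗ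
      (TensorProduct.mk k X.carrier (Module.Dual k X.carrier)).flip ((b X).coord i)
  have hσ : ∀ X v (f : Module.Dual k X.carrier),
      TensorProduct.rid k N (TensorProduct.map LinearMap.id f (σ X v)) = P X (v ⊗ₜ f) := by
    intro X v f
    have h1 : f = ∑ i, f (b X i) • (b X).coord i := (b X).ext fun j => by
      simp
    conv_rhs => rw [h1, TensorProduct.tmul_sum, map_sum]
    rw [LinearMap.sum_apply, map_sum, map_sum]
    refine Finset.sum_congr rfl fun i _ => ?_
    rw [TensorProduct.tmul_smul, map_smul]
    rfl
  obtain ⟨T, hT⟩ := exists_linearMap_of_natural σ fun X Y f => LinearMap.ext fun v =>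
    tensor_ext_of_slices fun g => by
      rw [LinearMap.comp_apply, hσ, LinearMap.comp_apply, TensorProduct.map_map,
        LinearMap.id_comp, hσ, hP]
  refine ⟨T, fun X v f => ?_⟩
  rw [apply_coeff, ← hσ, hT]
  rfl

end ReconstructionDual

/-! ### Coactions on the linear dual -/

section DualActing

variable {k B U : Type*} [Field k] [AddCommGroup B] [Module k B] [Coalgebra k B]
  [AddCommGroup U] [Module k U]

variable (k U) in
/-- The canonical pairing of a vector space with its dual. -/
def dualPair : U ⊗[k] Module.Dual k U →ₗ[k] k :=
  TensorProduct.lift (Module.Dual.eval k U)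

/-- The functional form `g ↦ ∑ s(v₋₁) g(v₀)` of the coaction. -/
def dualActing (X : LeftCoaction k B U) (s : B →ₗ[k] B) (v : U) : Module.Dual k U →ₗ[k] B :=
  dualTensorHom k (Module.Dual k U) B
    (TensorProduct.map (Module.Dual.eval k U) s (TensorProduct.comm k B U (X.coact v)))

theorem dualActing_apply (X : LeftCoaction k B U) (s : B →ₗ[k] B) (v : U) (g : Module.Dual k U) :
    dualActing X s v g = s (X.coeff g v) := by
  rw [apply_coeff]
  unfold dualActing
  induction X.coact v with
  | zero => simp
  | add a b ha hb => simp only [map_add, LinearMap.add_apply, ha, hb]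
  | tmul c w => simp

/-- With d(f) = ∑ f₋₁ ⊗ f₀ the left side is ∑ f₋₁ f₀(v₀) ⊗ s(v₋₁) = ∑ s(c(v₀)) ⊗ s(v₋₁), where c is
the coefficient map of `f`. The reversed order of the legs is why coassociativity of the dual
coaction matches anti-comultiplicativity of `s`; the lemma is used in both directions. -/
theorem map_apply_coeff (X : LeftCoaction k B U) (s : B →ₗ[k] B)
    (d : Module.Dual k U →ₗ[k] B ⊗[k] Module.Dual k U)
    (hd : ∀ f v, TensorProduct.rid k B (TensorProduct.map LinearMap.id (Module.Dual.eval k U v)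
      (d f)) = s (X.coeff f v)) (P : Module.Dual k U →ₗ[k] B) (f : Module.Dual k U) (v : U)
    (hP : ∀ g, P g = s (X.coeff g v)) :
    TensorProduct.map LinearMap.id P (d f) =
      TensorProduct.map s s (TensorProduct.comm k B B (comul (R := k) (X.coeff f v))) := by
  have hP' : P = dualActing X s v :=
    LinearMap.ext fun g => (hP g).trans (dualActing_apply X s v g).symm
  rw [hP', comul_coeff]
  change TensorProduct.map LinearMap.id (dualTensorHom k (Module.Dual k U) B
    (TensorProduct.map (Module.Dual.eval k U) s (TensorProduct.comm k B U (X.coact v)))) (d f) = _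
  induction X.coact v with
  | zero => simp
  | add a b ha hb => simp only [map_add, TensorProduct.map_add_right, LinearMap.add_apply, ha, hb]
  | tmul c w =>
    change _ = s (X.coeff f w) ⊗ₜ s c
    rw [← hd]
    induction d f with
    | zero => simp
    | add a b ha hb => simp only [map_add, add_tmul, ha, hb]
    | tmul b g => exact (TensorProduct.tmul_smul _ _ _).trans (TensorProduct.smul_tmul' _ _ _)

end DualActing

section DualPairing

variable {k B U : Type*} [Field k] [AddCommGroup B] [Module k B]
  [AddCommGroup U] [Module k U] [FiniteDimensional k U]

/-- The identity f = ∑ f(bⱼ) bⱼ*, in the shape required by `ext_of_sum_comp_eq_id`. -/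
theorem exists_retraction_eval : ∃ (n : ℕ) (e : Fin n → U) (r : Fin n → k →ₗ[k] Module.Dual k U),
    ∑ j, r j ∘ₗ Module.Dual.eval k U (e j) = LinearMap.id := by
  let b := Module.finBasis k U
  refine ⟨_, b, fun j => LinearMap.toSpanSingleton k _ (b.coord j), LinearMap.ext fun f => ?_⟩
  refine b.ext fun i => ?_
  simp

theorem tensor_dual_ext {N : Type*} [AddCommGroup N] [Module k N]
    {t t' : N ⊗[k] Module.Dual k U}
    (h : ∀ v, TensorProduct.rid k N (TensorProduct.map LinearMap.id (Module.Dual.eval k U v) t) =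
      TensorProduct.rid k N (TensorProduct.map LinearMap.id (Module.Dual.eval k U v) t')) :
    t = t' := by
  refine tensor_ext_of_slices fun F => ?_
  obtain ⟨v, rfl⟩ := (Module.evalEquiv k U).surjective F
  exact h v

section Coalg

variable [Coalgebra k B]

/-- The map `f ↦ ∑ s(b₋₁) f(b₀) ⊗ b*`, where `b` runs through a basis with dual basis `b*`. -/
def dualCoact (X : LeftCoaction k B U) (s : B →ₗ[k] B) :
    Module.Dual k U →ₗ[k] B ⊗[k] Module.Dual k U :=
  ∑ j, (TensorProduct.mk k B (Module.Dual k U)).flip ((Module.finBasis k U).coord j) ∘ₗ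
    dualActing X s (Module.finBasis k U j)

theorem dualCoact_eval (X : LeftCoaction k B U) (s : B →ₗ[k] B) (f : Module.Dual k U) (v : U) :
    TensorProduct.rid k B (TensorProduct.map LinearMap.id (Module.Dual.eval k U v)
      (dualCoact X s f)) = s (X.coeff f v) := by
  have h1 : dualCoact X s f = cofreeOfMap (Module.finBasis k U) (s ∘ₗ X.coeff f) := by
    rw [dualCoact, LinearMap.sum_apply, cofreeOfMap]
    exact Finset.sum_congr rfl fun j _ =>
      congr($(dualActing_apply X s (Module.finBasis k U j) f) ⊗ₜ _)
  have h2 := curry_evCoeff_cofreeOfMap (Module.finBasis k U) (s ∘ₗ X.coeff f) v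
  rw [curry_evCoeff_cofree] at h2
  rw [h1]
  exact h2

/-- The coaction on the dual space induced by an anti-coalgebra endomorphism:
`∑ f₋₁ f₀(v) = ∑ s(v₋₁) f(v₀)`. -/
def dual (X : LeftCoaction k B U) (s : B →ₗ[k] B)
    (hs : ∀ h : B, comul (R := k) (s h) =
      TensorProduct.map s s (TensorProduct.comm k B B (comul (R := k) h)))
    (hε : ∀ h : B, counit (R := k) (s h) = counit (R := k) h) :
    LeftCoaction k B (Module.Dual k U) where
  coact := dualCoact X s
  coassoc := by
    refine LinearMap.ext fun f => ?_
    -- With the dual space as the last factor, evaluations at vectors separate tensors.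
    refine (TensorProduct.assoc k B B (Module.Dual k U)).symm.injective ?_
    refine tensor_dual_ext fun v => ?_
    have e1 : ∀ t : B ⊗[k] Module.Dual k U, TensorProduct.rid k (B ⊗[k] B)
        (TensorProduct.map LinearMap.id (Module.Dual.eval k U v)
          (TensorProduct.map comul LinearMap.id t)) =
        comul (R := k) (TensorProduct.rid k B (TensorProduct.map LinearMap.id
          (Module.Dual.eval k U v) t)) := by
      intro t
      hopf_tensor_induction t with b g
      simp
    have e2 : ∀ t : B ⊗[k] (B ⊗[k] Module.Dual k U), TensorProduct.rid k (B ⊗[k] B)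
        (TensorProduct.map LinearMap.id (Module.Dual.eval k U v)
          ((TensorProduct.assoc k B B (Module.Dual k U)).symm t)) =
        TensorProduct.map LinearMap.id ((TensorProduct.rid k B).toLinearMap ∘ₗ
          TensorProduct.map LinearMap.id (Module.Dual.eval k U v)) t := by
      intro t
      induction t with
      | zero => simp
      | add a b ha hb => simp only [map_add, ha, hb]
      | tmul b t =>
        induction t with
        | zero => simp
        | add a b ha hb => simp only [tmul_add, map_add, ha, hb]
        | tmul c g => exact (TensorProduct.tmul_smul _ _ _).symm
    simp only [LinearMap.comp_apply, LinearEquiv.coe_coe, LinearEquiv.symm_apply_apply]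
    rw [e1, e2, dualCoact_eval, hs, TensorProduct.map_map, LinearMap.id_comp]
    exact (map_apply_coeff X s (dualCoact X s) (dualCoact_eval X s) _ f v
      fun g => dualCoact_eval X s g v).symm
  counit_coact := by
    refine LinearMap.ext fun f => LinearMap.ext fun v => ?_
    have e1 : ∀ t : B ⊗[k] Module.Dual k U,
        (TensorProduct.lid k (Module.Dual k U) (TensorProduct.map counit LinearMap.id t)) v =
        counit (R := k) (TensorProduct.rid k B (TensorProduct.map LinearMap.id
          (Module.Dual.eval k U v) t)) := by
      intro t
      induction t with
      | zero => simp
      | add a b ha hb => simp only [map_add, LinearMap.add_apply, ha, hb]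
      | tmul b g => simp [mul_comm]
    refine (e1 _).trans ?_
    rw [dualCoact_eval, hε]
    exact LinearMap.congr_fun (counit_comp_coeff X f) v

end Coalg

end DualPairing

end LeftCoaction

/-! ### Dual data given by s, α and β -/

namespace LeftCoaction

section Tens

variable {k B U U' : Type*} [Field k] [AddCommGroup B] [Module k B] [CoquasiBialgebra k B]
  [AddCommGroup U] [Module k U] [AddCommGroup U'] [Module k U']

/-- The auxiliary form `τ` tests the zigzag on the dual, while `ev` is the form inside it. Each
absorbs one dual leg of the coaction, so ω⁻¹ is evaluated on coefficients of `τ`, on y₋₁ and on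
coefficients of `ev`. -/
theorem triangle_right_db (X : LeftCoaction k B U) (X' : LeftCoaction k B U')
    (ev τ : U ⊗[k] U' →ₗ[k] k) (db : U' ⊗[k] U) (v : U) (x : U') :
    τ (v ⊗ₜ TensorProduct.rid k U' (TensorProduct.map LinearMap.id ev
      ((triple X' X X').act ωInv (TensorProduct.assoc k U' U U' (db ⊗ₜ x))))) =
    ωInv (k := k) (B := B) (TensorProduct.map LinearMap.id
      (TensorProduct.map LinearMap.id (evCoeff X' ev) ∘ₗ
        (TensorProduct.assoc k B U U').toLinearMap ∘ₗ
        (TensorProduct.mk k (B ⊗[k] U) U').flip x ∘ₗ X.coact)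
      (TensorProduct.map (TensorProduct.curry (evCoeff X' τ) v) LinearMap.id db)) := by
  induction db with
  | zero => simp
  | add a b ha hb => simp only [add_tmul, tmul_add, map_add, ha, hb]
  | tmul e y =>
    change τ (v ⊗ₜ TensorProduct.rid k U' (TensorProduct.map LinearMap.id ev
      (TensorProduct.lid k _ (TensorProduct.map ωInv LinearMap.id
        (TensorProduct.tensorTensorTensorComm k B U' (B ⊗[k] B) (U ⊗[k] U')
          (X'.coact e ⊗ₜ TensorProduct.tensorTensorTensorComm k B U B U'
            (X.coact y ⊗ₜ X'.coact x))))))) =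
      ωInv (k := k) (B := B) (evCoeff X' τ (v ⊗ₜ e) ⊗ₜ
        TensorProduct.map LinearMap.id (evCoeff X' ev)
          (TensorProduct.assoc k B U U' (X.coact y ⊗ₜ x)))
    rw [curry_evCoeff_apply]
    induction X'.coact e with
    | zero => simp
    | add a b ha hb => simp only [add_tmul, tmul_add, map_add, ha, hb]
    | tmul p e' =>
      induction X.coact y with
      | zero => simp
      | add a b ha hb => simp only [add_tmul, tmul_add, map_add, ha, hb]
      | tmul q y' =>
        change _ = ωInv (k := k) (B := B) ((τ (v ⊗ₜ e') • p) ⊗ₜ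
          (q ⊗ₜ evCoeff X' ev (y' ⊗ₜ x)))
        rw [curry_evCoeff_apply]
        induction X'.coact x with
        | zero => simp
        | add a b ha hb => simp only [tmul_add, map_add, ha, hb]
        | tmul r x' =>
          simp only [TensorProduct.tensorTensorTensorComm_tmul, TensorProduct.map_tmul,
            LinearMap.id_apply, TensorProduct.lid_tmul, map_smul, TensorProduct.rid_tmul,
            TensorProduct.tmul_smul, smul_eq_mul, TensorProduct.curry_apply,
            ← TensorProduct.smul_tmul']
          ring

end Tens

section DualData

variable {k B U : Type*} [Field k] [AddCommGroup B] [Module k B] [CoquasiBialgebra k B]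
  [AddCommGroup U] [Module k U]

/-- A coaction on the dual space of a comodule together with an evaluation form and a dual basis
tensor, all given by `s`, `β` and `α`. -/
structure IsDualData (X : LeftCoaction k B U) (D : LeftCoaction k B (Module.Dual k U))
    (s : B →ₗ[k] B) (α β : B →ₗ[k] k) (ev : U ⊗[k] Module.Dual k U →ₗ[k] k)
    (db : Module.Dual k U ⊗[k] U) : Prop where
  coact_eval : ∀ v f, TensorProduct.rid k B (TensorProduct.map LinearMap.id
    (Module.Dual.eval k U v) (D.coact f)) = s (X.coeff f v)
  ev_eq : ∀ v f, ev (v ⊗ₜ f) = β (X.coeff f v)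
  db_eq : ∀ v, TensorProduct.map (Module.Dual.eval k U v) LinearMap.id db =
    (1 : k) ⊗ₜ[k] X.act α v

namespace IsDualData

variable {X : LeftCoaction k B U} {D : LeftCoaction k B (Module.Dual k U)}
  {s : B →ₗ[k] B} {α β : B →ₗ[k] k} {ev : U ⊗[k] Module.Dual k U →ₗ[k] k}
  {db : Module.Dual k U ⊗[k] U} (H : IsDualData X D s α β ev db)

include H

theorem evCoeff_dualPair (v : U) (f : Module.Dual k U) :
    evCoeff D (dualPair k U) (v ⊗ₜ f) = s (X.coeff f v) := by
  rw [curry_evCoeff_apply]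
  exact H.coact_eval v f

theorem ev_eq_comp : ev = dualPair k U ∘ₗ TensorProduct.map (X.act β) LinearMap.id :=
  TensorProduct.ext' fun v f => (H.ev_eq v f).trans (apply_coeff_eq_act X β f v)

/-- The form `ev` is the canonical pairing after the action of β on `U`, so its coefficients are
those of the canonical pairing with β convolved on the left. -/
theorem evCoeff_ev (v : U) (f : Module.Dual k U) :
    evCoeff D ev (v ⊗ₜ f) = leftConv β s (X.coeff f v) := by
  rw [H.ev_eq_comp, evCoeff_map_left]
  change evCoeff D (dualPair k U) (X.act β v ⊗ₜ f) = _
  rw [H.evCoeff_dualPair, apply_coeff, apply_coeff]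
  exact congr(TensorProduct.rid k B (TensorProduct.map LinearMap.id f
    $(LinearMap.congr_fun (map_coact_act_left X β s) v)))

/-- Contracting `db` with evaluation at v₀ yields the action of α on v₀; coassociativity moves α to
the right of `T`. For `T` = β * s this identifies β * s * α as the map playing the role of the
preantipode. -/
theorem map_db_of_coeff (T : B →ₗ[k] B) (P : Module.Dual k U →ₗ[k] B) (v : U)
    (hP : ∀ f, P f = T (X.coeff f v)) :
    TensorProduct.map P LinearMap.id db =
      TensorProduct.map (rightConv T α) LinearMap.id (X.coact v) := by
  have h1 : P = dualActing X T v :=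
    LinearMap.ext fun g => (hP g).trans (dualActing_apply X T v g).symm
  have h2 := LinearMap.congr_fun (map_act_coact X α T) v
  rw [h1]
  refine Eq.trans ?_ h2
  change TensorProduct.map (dualTensorHom k (Module.Dual k U) B
    (TensorProduct.map (Module.Dual.eval k U) T (TensorProduct.comm k B U (X.coact v))))
      LinearMap.id db = TensorProduct.map T (X.act α) (X.coact v)
  induction X.coact v with
  | zero => simp
  | add a b ha hb => simp only [map_add, TensorProduct.map_add_left, LinearMap.add_apply, ha, hb]
  | tmul c w =>
    have h3 := congr(TensorProduct.map (LinearMap.toSpanSingleton k B (T c))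
      (LinearMap.id (R := k) (M := U)) $(H.db_eq w))
    rw [TensorProduct.map_map] at h3
    refine Eq.trans ?_ (h3.trans ?_)
    · rfl
    · simp

theorem map_evCoeff_dualPair_db (v : U) :
    TensorProduct.map (TensorProduct.curry (evCoeff D (dualPair k U)) v) LinearMap.id db =
      TensorProduct.map (rightConv s α) LinearMap.id (X.coact v) :=
  H.map_db_of_coeff s _ v fun f => H.evCoeff_dualPair v f

theorem map_evCoeff_ev_db (v : U) :
    TensorProduct.map (TensorProduct.curry (evCoeff D ev) v) LinearMap.id db =
      TensorProduct.map (rightConv (leftConv β s) α) LinearMap.id (X.coact v) :=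
  H.map_db_of_coeff _ _ v fun f => H.evCoeff_ev v f

theorem mulCoeff_evCoeff (v : U) (f : Module.Dual k U) :
    mulCoeff (evCoeff D ev) (X.coact v ⊗ₜ f) = mul (k := k) (B := B)
      (TensorProduct.map LinearMap.id (leftConv β s) (comul (R := k) (X.coeff f v))) := by
  rw [comul_coeff]
  change mul (k := k) (B := B) (TensorProduct.map LinearMap.id (evCoeff D ev)
    (TensorProduct.assoc k B U (Module.Dual k U) (X.coact v ⊗ₜ f))) = _
  induction X.coact v with
  | zero => simp
  | add a b ha hb => simp only [map_add, add_tmul, ha, hb]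
  | tmul c w => simp [H.evCoeff_ev]

theorem coact_db (v : U) :
    TensorProduct.map LinearMap.id (TensorProduct.map (Module.Dual.eval k U v) LinearMap.id)
      ((tens D X).coact db) = TensorProduct.assoc k B k U
        (TensorProduct.map ((TensorProduct.mk k B k).flip 1 ∘ₗ
          (mul (k := k) (B := B)).toLinearMap ∘ₗ
          TensorProduct.map (rightConv s α) LinearMap.id ∘ₗ comul) LinearMap.id (X.coact v)) := by
  rw [LeftCoaction.coact_db X D (Module.Dual.eval k U v)
    ((TensorProduct.mk k B k).flip 1 ∘ₗ rightConv s α) db v]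
  · have h1 : leftTwist ((TensorProduct.mk k B k).flip 1 ∘ₗ rightConv s α) =
        (TensorProduct.mk k B k).flip 1 ∘ₗ (mul (k := k) (B := B)).toLinearMap ∘ₗ
          TensorProduct.map (rightConv s α) LinearMap.id ∘ₗ comul := by
      refine LinearMap.ext fun h => ?_
      change TensorProduct.map (mul (k := k) (B := B)).toLinearMap LinearMap.id
        (TensorProduct.rightComm k B k B (TensorProduct.map
          ((TensorProduct.mk k B k).flip 1 ∘ₗ rightConv s α) LinearMap.id (comul (R := k) h))) =
        mul (k := k) (B := B) (TensorProduct.map (rightConv s α) LinearMap.id (comul (R := k) h))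
          ⊗ₜ 1
      induction comul (R := k) h with
      | zero => simp
      | add a b ha hb => simp only [map_add, add_tmul, ha, hb]
      | tmul p q => rfl
    rw [h1]
  · have h2 : TensorProduct.map LinearMap.id (Module.Dual.eval k U v) ∘ₗ D.coact =
        (TensorProduct.mk k B k).flip 1 ∘ₗ
          TensorProduct.curry (evCoeff D (dualPair k U)) v := by
      refine LinearMap.ext fun f => (TensorProduct.rid k B).injective ?_
      refine (H.coact_eval v f).trans ((H.evCoeff_dualPair v f).symm.trans ?_)
      change _ = (1 : k) • evCoeff D (dualPair k U) (v ⊗ₜ f)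
      rw [one_smul]
    have h3 := congr(TensorProduct.map ((TensorProduct.mk k B k).flip 1)
      (LinearMap.id (R := k) (M := U)) $(H.map_evCoeff_dualPair_db v))
    rw [TensorProduct.map_map, TensorProduct.map_map, ← h2] at h3
    exact h3

/-- Coinvariance of `db`, contracted with evaluation at `v`, is the axiom ∑ s(h₁) α(h₂) h₃ = α(h) 1
read on the comodule `X`. -/
theorem map_mul_rightConv (hdb : (tens D X).coact db = unit (k := k) (B := B) 1 ⊗ₜ db) (v : U) :
    TensorProduct.map ((mul (k := k) (B := B)).toLinearMap ∘ₗ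
      TensorProduct.map (rightConv s α) LinearMap.id ∘ₗ comul) LinearMap.id (X.coact v) =
    TensorProduct.map (LinearMap.toSpanSingleton k B (unit (k := k) (B := B) 1) ∘ₗ α)
      LinearMap.id (X.coact v) := by
  have h1 := H.coact_db v
  rw [hdb, TensorProduct.map_tmul, H.db_eq] at h1
  have h2 := congr(TensorProduct.map (TensorProduct.rid k B).toLinearMap LinearMap.id
    ((TensorProduct.assoc k B k U).symm $h1))
  rw [LinearEquiv.symm_apply_apply, TensorProduct.map_map, LinearMap.id_comp] at h2
  have h3 : ∀ T : B →ₗ[k] B, (TensorProduct.rid k B).toLinearMap ∘ₗ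
      (TensorProduct.mk k B k).flip 1 ∘ₗ T = T := fun T => by
    ext; simp
  rw [h3] at h2
  refine h2.symm.trans ?_
  change ((1 : k) • unit (k := k) (B := B) 1) ⊗ₜ[k] TensorProduct.lid k U
    (TensorProduct.map α LinearMap.id (X.coact v)) = _
  induction X.coact v with
  | zero => simp
  | add a b ha hb => simp only [map_add, tmul_add, ha, hb]
  | tmul c w => simp [TensorProduct.smul_tmul, TensorProduct.tmul_smul]

theorem triangle_left (v : U) :
    TensorProduct.lid k U (TensorProduct.map ev LinearMap.id
      ((TensorProduct.assoc k U (Module.Dual k U) U).symm ((triple X D X).act ω (v ⊗ₜ db)))) =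
    X.act (ω ∘ₗ TensorProduct.map LinearMap.id
      (TensorProduct.map (rightConv (leftConv β s) α) LinearMap.id ∘ₗ comul) ∘ₗ comul) v :=
  triangle_db X D ev db _ H.map_evCoeff_ev_db v

theorem triangle_right (v : U) (f : Module.Dual k U) :
    dualPair k U (v ⊗ₜ TensorProduct.rid k (Module.Dual k U) (TensorProduct.map LinearMap.id ev
      ((triple D X D).act ωInv (TensorProduct.assoc k (Module.Dual k U) U (Module.Dual k U)
        (db ⊗ₜ f))))) =
    ωInv (k := k) (B := B) (TensorProduct.map s
        (TensorProduct.map (rightConv (leftConv α LinearMap.id) β) s ∘ₗ comul (R := k))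
        (comul (R := k) (X.coeff f v))) := by
  rw [triangle_right_db, H.map_evCoeff_dualPair_db, TensorProduct.map_map, LinearMap.id_comp,
    LinearMap.comp_id]
  have h1 : TensorProduct.map LinearMap.id (evCoeff D ev) ∘ₗ
        (TensorProduct.assoc k B U (Module.Dual k U)).toLinearMap ∘ₗ
        (TensorProduct.mk k (B ⊗[k] U) (Module.Dual k U)).flip f ∘ₗ X.coact =
      (TensorProduct.map LinearMap.id (leftConv β s) ∘ₗ comul) ∘ₗ X.coeff f := by
    refine LinearMap.ext fun w => ?_
    rw [LinearMap.comp_assoc, LinearMap.comp_apply (TensorProduct.map LinearMap.id (leftConv β s)),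
      LinearMap.comp_apply comul, comul_coeff]
    change TensorProduct.map LinearMap.id (evCoeff D ev)
      (TensorProduct.assoc k B U (Module.Dual k U) (X.coact w ⊗ₜ f)) = _
    induction X.coact w with
    | zero => simp
    | add a b ha hb => simp only [map_add, add_tmul, ha, hb]
    | tmul c w => simp [H.evCoeff_ev]
  have h2 := LinearMap.congr_fun (map_rightConv_map_leftConv s α β) (X.coeff f v)
  rw [LinearMap.comp_apply, LinearMap.comp_apply, comul_coeff, TensorProduct.map_map,
    LinearMap.comp_id, ← h1] at h2
  rw [h2, comul_coeff]

end IsDualData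

end DualData

end LeftCoaction

/-! ### Coquasi-antipodes and linear duals -/

section Hopf

variable {k : Type u} {B : Type v} [Field k] [AddCommGroup B] [Module k B] [CoquasiBialgebra k B]

open FDComod

theorem exists_exactPairing_of_triangle {X X' : FDComod k B}
    (ev : X.carrier ⊗[k] X'.carrier →ₗ[k] k)
    (db : X'.carrier ⊗[k] X.carrier)
    (hev : Compat (tens X.coaction X'.coaction) (unitCoaction k B) LinearMap.id ev)
    (hdb : (tens X'.coaction X.coaction).coact db = unit (k := k) (B := B) 1 ⊗ₜ db)
    (hl : ∀ v, TensorProduct.lid k X.carrier (TensorProduct.map ev LinearMap.id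
        ((TensorProduct.assoc k X.carrier X'.carrier X.carrier).symm
          ((triple X.coaction X'.coaction X.coaction).act ω (v ⊗ₜ db)))) = v)
    (hr : ∀ x, TensorProduct.rid k X'.carrier (TensorProduct.map LinearMap.id ev
        ((triple X'.coaction X.coaction X'.coaction).act ωInv
          (TensorProduct.assoc k X'.carrier X.carrier X'.carrier (db ⊗ₜ x)))) = x) :
    ∃ p : ExactPairing X' X, evLin p.evaluation' = ev :=
  ⟨⟨dbHom db hdb, evHom ev hev,
    (triangle_left_iff _ _).2 fun v => by rw [dbElem_dbHom, evLin_evHom, hl],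
    (triangle_right_iff _ _).2 fun x => by rw [dbElem_dbHom, evLin_evHom, hr]⟩, rfl⟩

/-- Over a coquasi-antipode, dual data make the linear dual of `X` a right dual of `X`. -/
theorem LeftCoaction.IsDualData.exists_exactPairing (A : CoquasiAntipode k B) {X : FDComod k B}
    {D : LeftCoaction k B (Module.Dual k X.carrier)}
    {ev : X.carrier ⊗[k] Module.Dual k X.carrier →ₗ[k] k}
    {db : Module.Dual k X.carrier ⊗[k] X.carrier}
    (H : IsDualData X.coaction D A.s A.α A.β ev db) :
    ∃ p : ExactPairing (linearDual X D) X, evLin p.evaluation' = ev := by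
  have hev : Compat (tens X.coaction D) (unitCoaction k B) LinearMap.id ev :=
    (compat_ev_iff _ _ _).2 fun v f => by
      rw [H.mulCoeff_evCoeff, A.mul_β_s, H.ev_eq]
  have hdb : (tens D X.coaction).coact db = unit (k := k) (B := B) 1 ⊗ₜ db := by
    obtain ⟨n, e, r, hr⟩ := exists_retraction_eval (k := k) (U := X.carrier)
    refine ext_of_sum_comp_eq_id hr fun j => ?_
    have hm : (mul (k := k) (B := B)).toLinearMap ∘ₗ
          TensorProduct.map (rightConv A.s A.α) LinearMap.id ∘ₗ comul =
        LinearMap.toSpanSingleton k B (unit (k := k) (B := B) 1) ∘ₗ A.α := LinearMap.ext A.s_α_mul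
    rw [H.coact_db, hm, TensorProduct.map_tmul, H.db_eq]
    change _ = unit (k := k) (B := B) 1 ⊗ₜ ((1 : k) ⊗ₜ TensorProduct.lid k X.carrier
      (TensorProduct.map A.α LinearMap.id (X.coaction.coact (e j))))
    induction X.coaction.coact (e j) with
    | zero => simp
    | add a b ha hb => simp only [map_add, tmul_add, ha, hb]
    | tmul c w => simp [TensorProduct.smul_tmul, TensorProduct.tmul_smul]
  refine exists_exactPairing_of_triangle (X' := linearDual X D) ev db hev hdb
    (fun v => ?_) (fun f => ?_)
  · refine (H.triangle_left v).trans ?_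
    have hω : ω (k := k) (B := B) ∘ₗ TensorProduct.map LinearMap.id
      (TensorProduct.map (rightConv (leftConv A.β A.s) A.α) LinearMap.id ∘ₗ comul) ∘ₗ comul =
        counit := LinearMap.ext A.ω_eq
    rw [hω, act_counit, LinearMap.id_apply]
  · refine LinearMap.ext fun v => ?_
    refine (H.triangle_right v f).trans ((A.ωInv_eq _).trans ?_)
    exact LinearMap.congr_fun (counit_comp_coeff X.coaction f) v

theorem exists_isDualData (A : CoquasiAntipode k B) (X : FDComod k B) :
    ∃ ev db, IsDualData X.coaction
      (X.coaction.dual A.s A.comul_s A.counit_s) A.s A.α A.β ev db := by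
  let b := Module.finBasis k X.carrier
  refine ⟨dualPair k X.carrier ∘ₗ TensorProduct.map (X.coaction.act A.β) LinearMap.id,
    ∑ i, b.coord i ⊗ₜ X.coaction.act A.α (b i), ⟨fun v f => dualCoact_eval _ _ _ _,
      fun v f => (apply_coeff_eq_act X.coaction A.β f v).symm, fun v => ?_⟩⟩
  rw [map_sum]
  have h1 : ∀ i, TensorProduct.map (Module.Dual.eval k X.carrier v) LinearMap.id
      (b.coord i ⊗ₜ X.coaction.act A.α (b i)) =
      (1 : k) ⊗ₜ[k] X.coaction.act A.α (b.coord i v • b i) := by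
    intro i
    rw [map_smul]
    change b.coord i v ⊗ₜ[k] X.coaction.act A.α (b i) = _
    rw [TensorProduct.tmul_smul, TensorProduct.smul_tmul', smul_eq_mul, mul_one]
  rw [Finset.sum_congr rfl fun i _ => h1 i, ← TensorProduct.tmul_sum, ← map_sum]
  exact congr((1 : k) ⊗ₜ[k] X.coaction.act A.α $(b.sum_repr v))

/-- All structure is a function of coefficients, and coefficients satisfy c(g ∘ f, v) = c(g, f(v))
for colinear f. Hence transposes are colinear and compatible with the evaluations, which
characterises the dual morphism. -/
theorem nonempty_linearDuals (A : CoquasiAntipode k B) : Nonempty (LinearDuals k B) := by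
  choose ev db H using exists_isDualData A
  choose p hp using fun X => (H X).exists_exactPairing A
  refine ⟨⟨fun X => X.coaction.dual A.s A.comul_s A.counit_s, p, fun {X Y} f => ?_⟩⟩
  have hcol : Compat (Y.coaction.dual A.s A.comul_s A.counit_s)
      (X.coaction.dual A.s A.comul_s A.counit_s) LinearMap.id
      (Module.Dual.transpose (R := k) f.toLin) := by
    refine LinearMap.ext fun g => tensor_dual_ext fun v => ?_
    change TensorProduct.rid k B (TensorProduct.map LinearMap.id
      (Module.Dual.eval k X.carrier v) (dualCoact X.coaction A.s (g ∘ₗ f.toLin))) =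
      TensorProduct.rid k B (TensorProduct.map LinearMap.id
      (Module.Dual.eval k X.carrier v) (TensorProduct.map LinearMap.id
      (Module.Dual.transpose (R := k) f.toLin) (dualCoact Y.coaction A.s g)))
    rw [dualCoact_eval, TensorProduct.map_map, LinearMap.id_comp, coeff_comp (compat f)]
    exact (dualCoact_eval Y.coaction A.s g (f.toLin v)).symm
  let t : linearDual Y (Y.coaction.dual A.s A.comul_s A.counit_s) ⟶
      linearDual X (X.coaction.dual A.s A.comul_s A.counit_s) := Hom.mk _ hcol
  refine congr_arg Hom.toLin (rightDualMap_unique (p X) (p Y) f t ?_)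
  refine hom_ext (TensorProduct.ext' fun v g => ?_)
  refine (LinearMap.congr_fun (hp X) _).trans (((H X).ev_eq v (g ∘ₗ f.toLin)).trans (Eq.trans ?_
    ((LinearMap.congr_fun (hp Y) _).trans ((H Y).ev_eq (f.toLin v) g)).symm))
  exact congr(A.β $(coeff_comp (compat f) g v))

/-- The dual coaction, `ev` and `db` each give a dinatural family of pairings on X ⊗ X*, and these
reconstruct to s, β and α. -/
theorem nonempty_coquasiAntipode (L : LinearDuals k B) : Nonempty (CoquasiAntipode k B) := by
  have htr : ∀ (X Y : FDComod k B) (f : X ⟶ Y), Compat (L.coaction Y) (L.coaction X) LinearMap.id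
      (Module.Dual.transpose (R := k) f.toLin) := fun X Y f => by
    rw [← L.map_eq f]
    exact compat (rightDualMap (L.pairing X) (L.pairing Y) f)
  let ev : ∀ X : FDComod k B, X.carrier ⊗[k] Module.Dual k X.carrier →ₗ[k] k :=
    fun X => evLin (L.pairing X).evaluation'
  let db : ∀ X : FDComod k B, Module.Dual k X.carrier ⊗[k] X.carrier :=
    fun X => dbElem (L.pairing X).coevaluation'
  -- The canonical pairing is used here rather than `ev`, so that s records the coaction alone; its
  -- dinaturality needs only that transposes are colinear.
  obtain ⟨s, hs⟩ := exists_linearMap_of_dinatural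
    (fun X : FDComod k B => evCoeff (L.coaction X) (dualPair k X.carrier)) fun X Y f v g => by
      have h1 := LinearMap.congr_fun (evCoeff_comp (htr X Y f) (dualPair k X.carrier)) (v ⊗ₜ g)
      have h2 := LinearMap.congr_fun
        (evCoeff_map_left (L.coaction Y) f.toLin (dualPair k Y.carrier)) (v ⊗ₜ g)
      have h3 : dualPair k X.carrier ∘ₗ TensorProduct.map LinearMap.id
          (Module.Dual.transpose (R := k) f.toLin) =
          dualPair k Y.carrier ∘ₗ TensorProduct.map f.toLin LinearMap.id :=
        TensorProduct.ext' fun _ _ => rfl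
      rw [h3] at h1
      exact h1.symm.trans h2
  obtain ⟨β, hβ⟩ := exists_linearMap_of_dinatural ev fun X Y f v g => by
    have h1 := LinearMap.congr_fun
      (congr_arg Hom.toLin (whiskerLeft_rightDualMap_comp_ev (L.pairing X) (L.pairing Y) f))
      (v ⊗ₜ g)
    have h2 := LinearMap.congr_fun (L.map_eq f) g
    refine Eq.trans ?_ h1
    exact congr(ev X (v ⊗ₜ $h2)).symm
  -- Contraction of `db` with v. It is a natural linear endomorphism of the underlying space, not a
  -- colinear one in general, and will be the action of α.
  let φ : ∀ X : FDComod k B, X.carrier →ₗ[k] X.carrier := fun X =>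
    (TensorProduct.lid k X.carrier).toLinearMap ∘ₗ
      TensorProduct.map (dualPair k X.carrier) LinearMap.id ∘ₗ
      (TensorProduct.assoc k X.carrier (Module.Dual k X.carrier) X.carrier).symm.toLinearMap ∘ₗ
      (TensorProduct.mk k X.carrier (Module.Dual k X.carrier ⊗[k] X.carrier)).flip (db X)
  have hφ : ∀ X v, φ X v = TensorProduct.lid k X.carrier
      (TensorProduct.map (Module.Dual.eval k X.carrier v) LinearMap.id (db X)) := fun X v =>
    congr(TensorProduct.lid k X.carrier $(map_assoc_symm_tmul (dualPair k X.carrier) v (db X)))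
  obtain ⟨α, hα⟩ := exists_linearMap_of_dinatural
    (fun X : FDComod k B => dualPair k X.carrier ∘ₗ TensorProduct.map (φ X) LinearMap.id)
    fun X Y f v g => by
      have h1 : TensorProduct.map (Hom.toLin (rightDualMap (L.pairing X) (L.pairing Y) f))
          LinearMap.id (db Y) = TensorProduct.map LinearMap.id f.toLin (db X) :=
        LinearMap.congr_fun (congr_arg Hom.toLin
          (db_comp_rightDualMap_whiskerRight (L.pairing X) (L.pairing Y) f)) (1 : k)
      rw [L.map_eq f] at h1
      have h2 := congr(TensorProduct.map (Module.Dual.eval k X.carrier v)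
        (LinearMap.id (R := k) (M := Y.carrier)) $h1)
      have h3 : f.toLin (φ X v) = φ Y (f.toLin v) := by
        rw [hφ, hφ]
        refine Eq.trans ?_ (congr(TensorProduct.lid k Y.carrier $h2).symm.trans ?_)
        · rw [TensorProduct.map_map, LinearMap.id_comp, LinearMap.comp_id]
          refine (LinearMap.congr_fun (lid_natural f.toLin) _).symm.trans ?_
          change TensorProduct.lid k Y.carrier (TensorProduct.map LinearMap.id f.toLin
            (TensorProduct.map (Module.Dual.eval k X.carrier v) LinearMap.id (db X))) = _
          rw [TensorProduct.map_map, LinearMap.id_comp, LinearMap.comp_id]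
        · exact congr(TensorProduct.lid k Y.carrier $(TensorProduct.map_map
            (Module.Dual.eval k X.carrier v) LinearMap.id (Module.Dual.transpose (R := k) f.toLin)
            LinearMap.id (db Y)))
      exact congr(g $h3)
  have H : ∀ X : FDComod k B, IsDualData X.coaction (L.coaction X) s α β (ev X) (db X) := fun X =>
    { coact_eval := fun v f =>
        (curry_evCoeff_apply (L.coaction X) (dualPair k X.carrier) v f).symm.trans
          (hs X v f)
      ev_eq := hβ X
      db_eq := fun v => by
        refine (TensorProduct.lid k X.carrier).injective ?_
        rw [← hφ, TensorProduct.lid_tmul, one_smul]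
        refine (Module.forall_dual_apply_eq_zero_iff k _).1 ?_ |> sub_eq_zero.1
        intro f
        rw [map_sub, ← apply_coeff_eq_act, ← hα, sub_eq_zero]
        rfl }
  -- The six axioms come, in order, from coassociativity and counitality of the dual coaction,
  -- colinearity of `ev`, coinvariance of `db`, and the triangle identities on X and on its dual.
  refine ⟨⟨s, α, β, LinearMap.congr_fun (f := comul ∘ₗ s) (g := TensorProduct.map s s ∘ₗ
      (TensorProduct.comm k B B).toLinearMap ∘ₗ comul) (ext_of_coeff fun X f v => ?_),
    LinearMap.congr_fun (f := counit ∘ₗ s) (g := counit) (ext_of_coeff fun X f v => ?_),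
    LinearMap.congr_fun (f := (mul (k := k) (B := B)).toLinearMap ∘ₗ
      TensorProduct.map LinearMap.id (leftConv β s) ∘ₗ comul)
      (g := LinearMap.toSpanSingleton k B (unit (k := k) (B := B) 1) ∘ₗ β)
      (ext_of_coeff fun X f v => ?_),
    LinearMap.congr_fun (f := (mul (k := k) (B := B)).toLinearMap ∘ₗ
      TensorProduct.map (rightConv s α) LinearMap.id ∘ₗ comul)
      (g := LinearMap.toSpanSingleton k B (unit (k := k) (B := B) 1) ∘ₗ α)
      (ext_of_fdComod fun X => LinearMap.ext fun v => ?_),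
    LinearMap.congr_fun (f := ω (k := k) (B := B) ∘ₗ TensorProduct.map LinearMap.id
      (TensorProduct.map (rightConv (leftConv β s) α) LinearMap.id ∘ₗ comul) ∘ₗ comul)
      (g := counit) (ext_act fun X v => ?_),
    LinearMap.congr_fun (f := ωInv (k := k) (B := B) ∘ₗ TensorProduct.map s
      (TensorProduct.map (rightConv (leftConv α LinearMap.id) β) s ∘ₗ comul) ∘ₗ comul)
      (g := counit) (ext_of_coeff fun X f v => ?_)⟩⟩
  · refine Eq.trans ?_ (map_apply_coeff X.coaction s (L.coaction X).coact
      (fun f v => (H X).coact_eval v f)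
      (TensorProduct.curry (evCoeff (L.coaction X) (dualPair k X.carrier)) v) f v
      fun g => hs X v g)
    refine congr(comul (R := k) $(hs X v f)).symm.trans ?_
    exact (LinearMap.congr_fun
      (map_curry_evCoeff_comp_coact (L.coaction X) (dualPair k X.carrier) v)
      f).symm
  · refine congr(counit (R := k) $(hs X v f)).symm.trans ?_
    refine (LinearMap.congr_fun (counit_evCoeff (L.coaction X) (dualPair k X.carrier))
      (v ⊗ₜ f)).trans ?_
    exact (LinearMap.congr_fun (counit_comp_coeff X.coaction f) v).symm
  · refine ((H X).mulCoeff_evCoeff v f).symm.trans ?_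
    refine ((compat_ev_iff _ _ _).1 (compat_evLin (L.pairing X).evaluation') v f).trans ?_
    exact congr($(hβ X v f) • unit (k := k) (B := B) 1)
  · exact (H X).map_mul_rightConv (coact_dbElem (L.pairing X).coevaluation') v
  · refine ((H X).triangle_left v).symm.trans ?_
    rw [act_counit]
    exact (triangle_left_iff _ _).1 (L.pairing X).coevaluation_evaluation' v
  · refine ((H X).triangle_right v f).symm.trans ?_
    refine Eq.trans ?_ (LinearMap.congr_fun (counit_comp_coeff X.coaction f) v).symm
    exact congr(dualPair k X.carrier (v ⊗ₜ
      $((triangle_right_iff _ _).1 (L.pairing X).evaluation_coevaluation' f)))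

end Hopf

end CoquasiHopf

end

theorem mainTheorem2 {k : Type u} {B : Type v} [Field k] [AddCommGroup B] [Module k B]
    [CoquasiHopf.CoquasiBialgebra k B] :
    (Nonempty (CoquasiHopf.Preantipode k B) ↔
      CoquasiHopf.IsRightRigid (CoquasiHopf.FDComod k B)) ∧
    (Nonempty (CoquasiHopf.CoquasiAntipode k B) ↔
      CoquasiHopf.IsRightRigid (CoquasiHopf.FDComod k B) ∧
        Nonempty (CoquasiHopf.LinearDuals k B)) :=
  ⟨CoquasiHopf.nonempty_preantipode_iff,
    ⟨fun ⟨A⟩ =>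
      have L := CoquasiHopf.nonempty_linearDuals A
      ⟨fun X => ⟨CoquasiHopf.linearDual X (L.some.coaction X), ⟨L.some.pairing X⟩⟩, L⟩,
    fun ⟨_, ⟨L⟩⟩ => CoquasiHopf.nonempty_coquasiAntipode L⟩⟩
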